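/- Let $\mathbb K\in\{\mathbb R,\mathbb C\}$, let $H=\bigoplus_{n\ge 0}H_n$ be a graded connected Hopf algebra over $\mathbb K$ (the grading is an algebra and a coalgebra grading, $\varepsilon$ vanishes on $H_n$ for $n\geq 1$, and $\dim H_0=1$; $H$ need not be commutative or cocommutative), let $I\subseteq H$ be a Hopf ideal, not necessarily homogeneous, and let $B$ be a commutative locally convex (Hausdorff) unital topological $\mathbb K$-algebra. Equip $A=\operatorname{Hom}_{\mathbb K}(H,B)$ with the convolution product $\star$ and the topology of pointwise convergence. Let $\operatorname{Char}(H,B)\subseteq A$ be the group, under $\star$, of unital algebra homomorphisms; let $\operatorname{InfChar}(H,B)\subseteq A$ be the Lie algebra, under the commutator bracket of $\star$, of all $\phi$ with $\phi(ab)=\phi(a)\varepsilon(b)+\varepsilon(a)\phi(b)$; and let $\operatorname{Ann}(I,B)=\{\phi\in A:\phi(I)=0\}$. Analyticity and manifolds are understood in the sense of Keller's $C^\infty_c$-calculus on locally convex spaces: complex analytic means $C^\infty_{\mathbb C}$, and real analytic means extending to a $C^\infty_{\mathbb C}$-map on an open neighbourhood in the complexification. The group $\operatorname{Char}(H,B)$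 carries its $\mathbb K$-analytic Lie group structure as a closed analytic submanifold of $A$ modelled on $\operatorname{InfChar}(H,B)$; its Lie algebra is $\operatorname{InfChar}(H,B)$, and its exponential function is $\exp(\phi)=\sum_{n\ge 0}\phi^{\star n}/n!$, a global $\mathbb K$-analytic diffeomorphism $\operatorname{InfChar}(H,B)\to\operatorname{Char}(H,B)$. Then: (i) With $q\colon H\to H/I$ the quotient map, $\phi\mapsto\phi\circ q$ is an isomorphism of topological groups $\operatorname{Char}(H/I,B)\to\operatorname{Ann}(I,B)\cap\operatorname{Char}(H,B)$. The group $\operatorname{Ann}(I,B)\cap\operatorname{Char}(H,B)$ is a closed Lie subgroup of $\operatorname{Char}(H,B)$ (a closed subgroup and closed analytic submanifold, and a Lie group with the induced structure), with Lie algebra $\operatorname{Ann}(I,B)\cap\operatorname{InfChar}(H,B)$. It is a BCH–Lie group (a $\mathbb K$-analytic Lie group whose exponential function is a local analytic diffeomorphism at $0$), and it is exponential (its exponential function is a global $\mathbb K$-analytic diffeomorphism). (ii) $\operatorname{Ann}(I,B)\cap\operatorname{InfChar}(H,B)$ is a closed Lie subalgebra of $\operatorname{InfChar}(H,B)$, and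 a BCH–Lie algebra: on some open neighbourhood $U$ of $0$ the Baker–Campbell–Hausdorff series converges and defines a $\mathbb K$-analytic function on $U\times U$. (iii) $\exp$ restricts to a global $\mathbb K$-analytic diffeomorphism $\operatorname{Ann}(I,B)\cap\operatorname{InfChar}(H,B)\to\operatorname{Ann}(I,B)\cap\operatorname{Char}(H,B)$, which is the exponential function of the latter Lie group. (iv) If $I$ is homogeneous, then $H/I$ with the induced grading is again a graded connected Hopf algebra, and the isomorphism in (i) is a $\mathbb K$-analytic diffeomorphism from $\operatorname{Char}(H/I,B)$, with the Lie group structure described above for $H/I$ in place of $H$, onto $\operatorname{Ann}(I,B)\cap\operatorname{Char}(H,B)$. -/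

import Mathlib

open scoped TensorProduct Topology

noncomputable section

namespace CharLie

/-! ## Differential calculus in locally convex spaces -/

section Calculus

/-- `E` is a locally convex space over `𝕜`: a Hausdorff topological vector space whose topology is
given by seminorms. -/
structure IsLocallyConvexTVS (𝕜 E : Type*) [NormedField 𝕜] [AddCommGroup E] [Module 𝕜 E]
    [TopologicalSpace E] : Prop where
  isTopologicalAddGroup : IsTopologicalAddGroup E
  continuousSMul : ContinuousSMul 𝕜 E
  t2 : T2Space E
  polynormable : PolynormableSpace 𝕜 E

/-- `d` is the directional derivative of `f` at `x` in direction `h`: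
`d = lim_{t → 0, t ≠ 0} t⁻¹ (f (x + t h) - f x)` with `t` in `𝕜`. -/
def HasDirDeriv (𝕜 : Type*) {E F : Type*} [NormedField 𝕜] [AddCommGroup E] [Module 𝕜 E]
    [AddCommGroup F] [Module 𝕜 F] [TopologicalSpace F] (f : E → F) (x h : E) (d : F) : Prop :=
  Filter.Tendsto (fun t : 𝕜 => t⁻¹ • (f (x + t • h) - f x)) (𝓝[≠] 0) (𝓝 d)

/-- `f` is of class `C^∞` over `𝕜` on the (open) set `U` in the sense of Keller's `C^∞_c`-theory:
all iterated directional derivatives `D k x (y₁, …, y_k) = (D_{y_k} ⋯ D_{y_1} f) (x)` exist for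
`x ∈ U` and are continuous on `U × E^k`. -/
def CInftyOn (𝕜 : Type*) {E F : Type*} [NormedField 𝕜] [AddCommGroup E] [Module 𝕜 E]
    [TopologicalSpace E] [AddCommGroup F] [Module 𝕜 F] [TopologicalSpace F]
    (f : E → F) (U : Set E) : Prop :=
  ∃ D : (k : ℕ) → E → (Fin k → E) → F,
    (∀ x ∈ U, ∀ y : Fin 0 → E, D 0 x y = f x) ∧
    (∀ k, ∀ x ∈ U, ∀ (y : Fin k → E) (h : E),
      HasDirDeriv 𝕜 (fun x' => D k x' y) x h (D (k + 1) x (Fin.snoc y h))) ∧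
    (∀ k, ContinuousOn (fun p : E × (Fin k → E) => D k p.1 p.2) (U ×ˢ Set.univ))

/-- The complexification `E ⊕ iE` of (the real space underlying) `E`, with the product topology. -/
def Complexify (_𝕜 E : Type*) := E × E

section Complexify

variable {𝕜 E : Type*}

instance [AddCommGroup E] : AddCommGroup (Complexify 𝕜 E) := inferInstanceAs (AddCommGroup (E × E))

instance [TopologicalSpace E] : TopologicalSpace (Complexify 𝕜 E) :=
  inferInstanceAs (TopologicalSpace (E × E))

variable [RCLike 𝕜] [AddCommGroup E] [Module 𝕜 E]

/-- `(a + i b) (x, y) = (a x - b y, a y + b x)`. -/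
instance : SMul ℂ (Complexify 𝕜 E) where
  smul z p := (((z.re : 𝕜) • p.1 - (z.im : 𝕜) • p.2, (z.re : 𝕜) • p.2 + (z.im : 𝕜) • p.1) : E × E)

theorem Complexify.smul_def (z : ℂ) (p : Complexify 𝕜 E) :
    z • p = (((z.re : 𝕜) • p.1 - (z.im : 𝕜) • p.2,
      (z.re : 𝕜) • p.2 + (z.im : 𝕜) • p.1) : E × E) := rfl

instance : Module ℂ (Complexify 𝕜 E) where
  one_smul p := by
    rw [Complexify.smul_def]
    refine Prod.ext ?_ ?_ <;> simp
  mul_smul z w p := by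
    simp only [Complexify.smul_def]
    refine Prod.ext ?_ ?_
    · change ((z * w).re : 𝕜) • p.1 - ((z * w).im : 𝕜) • p.2 =
        (z.re : 𝕜) • ((w.re : 𝕜) • p.1 - (w.im : 𝕜) • p.2) -
          (z.im : 𝕜) • ((w.re : 𝕜) • p.2 + (w.im : 𝕜) • p.1)
      simp only [Complex.mul_re, Complex.mul_im, RCLike.ofReal_sub, RCLike.ofReal_add,
        RCLike.ofReal_mul]
      module
    · change ((z * w).re : 𝕜) • p.2 + ((z * w).im : 𝕜) • p.1 =
        (z.re : 𝕜) • ((w.re : 𝕜) • p.2 + (w.im : 𝕜) • p.1) +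
          (z.im : 𝕜) • ((w.re : 𝕜) • p.1 - (w.im : 𝕜) • p.2)
      simp only [Complex.mul_re, Complex.mul_im, RCLike.ofReal_sub, RCLike.ofReal_add,
        RCLike.ofReal_mul]
      module
  smul_zero z := by
    rw [Complexify.smul_def]
    refine Prod.ext ?_ ?_
    · change (z.re : 𝕜) • (0 : E) - (z.im : 𝕜) • (0 : E) = 0; simp
    · change (z.re : 𝕜) • (0 : E) + (z.im : 𝕜) • (0 : E) = 0; simp
  smul_add z p q := by
    simp only [Complexify.smul_def]
    refine Prod.ext ?_ ?_
    · change (z.re : 𝕜) • (p.1 + q.1) - (z.im : 𝕜) • (p.2 + q.2) =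
        ((z.re : 𝕜) • p.1 - (z.im : 𝕜) • p.2) + ((z.re : 𝕜) • q.1 - (z.im : 𝕜) • q.2)
      module
    · change (z.re : 𝕜) • (p.2 + q.2) + (z.im : 𝕜) • (p.1 + q.1) =
        ((z.re : 𝕜) • p.2 + (z.im : 𝕜) • p.1) + ((z.re : 𝕜) • q.2 + (z.im : 𝕜) • q.1)
      module
  add_smul z w p := by
    simp only [Complexify.smul_def]
    refine Prod.ext ?_ ?_
    · change ((z + w).re : 𝕜) • p.1 - ((z + w).im : 𝕜) • p.2 =
        ((z.re : 𝕜) • p.1 - (z.im : 𝕜) • p.2) + ((w.re : 𝕜) • p.1 - (w.im : 𝕜) • p.2)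
      simp only [Complex.add_re, Complex.add_im, RCLike.ofReal_add]
      module
    · change ((z + w).re : 𝕜) • p.2 + ((z + w).im : 𝕜) • p.1 =
        ((z.re : 𝕜) • p.2 + (z.im : 𝕜) • p.1) + ((w.re : 𝕜) • p.2 + (w.im : 𝕜) • p.1)
      simp only [Complex.add_re, Complex.add_im, RCLike.ofReal_add]
      module
  zero_smul p := by
    rw [Complexify.smul_def]
    refine Prod.ext ?_ ?_
    · change ((0 : ℂ).re : 𝕜) • p.1 - ((0 : ℂ).im : 𝕜) • p.2 = (0 : E); simp
    · change ((0 : ℂ).re : 𝕜) • p.2 + ((0 : ℂ).im : 𝕜) • p.1 = (0 : E); simp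

/-- The inclusion `E → E ⊕ iE`. -/
def Complexify.incl (𝕜 : Type*) {E : Type*} [AddCommGroup E] (x : E) : Complexify 𝕜 E :=
  ((x, 0) : E × E)

end Complexify

variable (𝕜 : Type*) {E F : Type*} [RCLike 𝕜] [AddCommGroup E] [Module 𝕜 E] [TopologicalSpace E]
  [AddCommGroup F] [Module 𝕜 F] [TopologicalSpace F]

/-- `f` is real analytic on `U`: it extends to a complex `C^∞`-map, with values in the
complexification of `F`, on an open neighbourhood of `U` in the complexification of `E`. -/
def RealAnalyticOn (f : E → F) (U : Set E) : Prop :=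
  ∃ V : Set (Complexify 𝕜 E), IsOpen V ∧ (∀ x ∈ U, Complexify.incl 𝕜 x ∈ V) ∧
    ∃ g : Complexify 𝕜 E → Complexify 𝕜 F, CInftyOn ℂ g V ∧
      ∀ x ∈ U, g (Complexify.incl 𝕜 x) = Complexify.incl 𝕜 (f x)

/-- `f` is `𝕜`-analytic on the open set `U`. If `𝕜 = ℝ`, that is, `RCLike.I = 0`, this means
real analytic; if `𝕜 = ℂ`, that is, `RCLike.I ≠ 0`, it means complex analytic, that is,
`C^∞` over `𝕜`. -/
def LCAnalyticOn (f : E → F) (U : Set E) : Prop :=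
  IsOpen U ∧ ((RCLike.I : 𝕜) = 0 → RealAnalyticOn 𝕜 f U) ∧
    ((RCLike.I : 𝕜) ≠ 0 → CInftyOn 𝕜 f U)

end Calculus

/-! ## Analytic manifolds modelled on locally convex spaces -/

section Manifolds

variable (𝕜 : Type*) [RCLike 𝕜]

/-- The charts which are analytically compatible with all charts of the given atlas of `M`. -/
def analyticMaximalAtlas (E M : Type*) [AddCommGroup E] [Module 𝕜 E] [TopologicalSpace E]
    [TopologicalSpace M] [ChartedSpace E M] : Set (OpenPartialHomeomorph M E) :=
  {e | ∀ e' ∈ atlas E M, LCAnalyticOn 𝕜 (e.symm.trans e') (e.symm.trans e').source ∧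
    LCAnalyticOn 𝕜 (e'.symm.trans e) (e'.symm.trans e).source}

/-- `M` with its atlas is a `𝕜`-analytic manifold modelled on the locally convex space `E`. -/
structure IsAnalyticManifold (E M : Type*) [AddCommGroup E] [Module 𝕜 E] [TopologicalSpace E]
    [TopologicalSpace M] [ChartedSpace E M] : Prop where
  model : IsLocallyConvexTVS 𝕜 E
  t2 : T2Space M
  compatible : ∀ e ∈ atlas E M, e ∈ analyticMaximalAtlas 𝕜 E M

/-- A map between manifolds is `𝕜`-analytic if it is so in all charts (in particular, the domains
of its coordinate expressions are open, so that the map is continuous). -/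
def IsAnalyticMap (E F : Type*) {M N : Type*} [AddCommGroup E] [Module 𝕜 E] [TopologicalSpace E]
    [AddCommGroup F] [Module 𝕜 F] [TopologicalSpace F]
    [TopologicalSpace M] [ChartedSpace E M] [TopologicalSpace N] [ChartedSpace F N]
    (f : M → N) : Prop :=
  ∀ e ∈ atlas E M, ∀ e' ∈ atlas F N,
    LCAnalyticOn 𝕜 (fun x => e' (f (e.symm x))) (e.target ∩ {x | f (e.symm x) ∈ e'.source})

/-- A global `𝕜`-analytic diffeomorphism. -/
def IsAnalyticDiffeo (E F : Type*) {M N : Type*} [AddCommGroup E] [Module 𝕜 E]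
    [TopologicalSpace E] [AddCommGroup F] [Module 𝕜 F] [TopologicalSpace F]
    [TopologicalSpace M] [ChartedSpace E M] [TopologicalSpace N] [ChartedSpace F N]
    (f : M ≃ N) : Prop :=
  IsAnalyticMap 𝕜 E F f ∧ IsAnalyticMap 𝕜 F E f.symm

/-- The manifold `M` (modelled on `F`) is, via the injection `ι`, a closed analytic submanifold of
the manifold `N` (modelled on `E`), where `F` is regarded as a closed vector subspace of `E` via
`j`: around each point of `M` there is a chart `φ` of `N` which maps `ι M` to the subspace `F`, and
such that the restriction of `φ` to `M` is a chart of `M`. -/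
structure IsClosedSubmanifold {E F M N : Type*} [AddCommGroup E] [Module 𝕜 E] [TopologicalSpace E]
    [AddCommGroup F] [Module 𝕜 F] [TopologicalSpace F]
    [TopologicalSpace M] [ChartedSpace F M] [TopologicalSpace N] [ChartedSpace E N]
    (j : F →ₗ[𝕜] E) (ι : M → N) : Prop where
  model_closed : Topology.IsClosedEmbedding j
  injective : Function.Injective ι
  isClosed_range : IsClosed (Set.range ι)
  adapted : ∀ m : M, ∃ φ ∈ analyticMaximalAtlas 𝕜 E N, ∃ ψ ∈ analyticMaximalAtlas 𝕜 F M,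
    m ∈ ψ.source ∧ ψ.source = ι ⁻¹' φ.source ∧
    φ '' (φ.source ∩ Set.range ι) = φ.target ∩ Set.range j ∧
    ∀ x ∈ ψ.source, j (ψ x) = φ (ι x)

end Manifolds

/-! ## Lie groups -/

section LieGroups

variable (𝕜 : Type*) [RCLike 𝕜]

/-- `G` is a `𝕜`-analytic Lie group modelled on the locally convex space `E`. -/
structure IsAnalyticLieGroup (E G : Type*) [AddCommGroup E] [Module 𝕜 E] [TopologicalSpace E]
    [Group G] [TopologicalSpace G] [ChartedSpace E G] : Prop
    extends IsAnalyticManifold 𝕜 E G where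
  analytic_mul : ∀ e₁ ∈ atlas E G, ∀ e₂ ∈ atlas E G, ∀ e₃ ∈ atlas E G,
    LCAnalyticOn 𝕜 (fun p : E × E => e₃ (e₁.symm p.1 * e₂.symm p.2))
      ((e₁.target ×ˢ e₂.target) ∩ {p | e₁.symm p.1 * e₂.symm p.2 ∈ e₃.source})
  analytic_inv : IsAnalyticMap 𝕜 E E (fun g : G => g⁻¹)

/-- `b` is the mixed derivative `∂_t ∂_s m (s v, t w)` at `s = t = 0`. -/
def HasMixedDeriv {E : Type*} [AddCommGroup E] [Module 𝕜 E] [TopologicalSpace E]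
    (m : E → E → E) (v w b : E) : Prop :=
  ∃ D : 𝕜 → E, (∀ᶠ t in 𝓝 (0 : 𝕜), HasDirDeriv 𝕜 (fun x => m x (t • w)) 0 v (D t)) ∧
    HasDirDeriv 𝕜 D 0 1 b

/-- The tangent space at the identity of a Lie group `G` is identified with the model space `E` by
the preferred chart `e` at `1`. In this chart the multiplication is
`(x, y) ↦ e (e⁻¹ (e 1 + x) * e⁻¹ (e 1 + y)) = e 1 + x + y + b (x, y) + ⋯` with a bilinear `b`,
and the Lie bracket of `G` is `[v, w] = b (v, w) - b (w, v)`. This says that `z = [v, w]`. -/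
def HasLieBracketAtOne {E : Type*} (G : Type*) [AddCommGroup E] [Module 𝕜 E] [TopologicalSpace E]
    [Group G] [TopologicalSpace G] [ChartedSpace E G] (v w z : E) : Prop :=
  let e : OpenPartialHomeomorph G E := chartAt E (1 : G)
  let m : E → E → E := fun x y => e (e.symm (e 1 + x) * e.symm (e 1 + y))
  ∃ b₁ b₂, HasMixedDeriv 𝕜 m v w b₁ ∧ HasMixedDeriv 𝕜 m w v b₂ ∧ z = b₁ - b₂

/-- The Lie algebra of the Lie group `G` is the Lie algebra `L` on which `G` is modelled
(where the tangent space at `1` is identified with `L` by the preferred chart at `1`). -/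
def HasLieAlgebra (L G : Type*) [LieRing L] [LieAlgebra 𝕜 L] [TopologicalSpace L]
    [Group G] [TopologicalSpace G] [ChartedSpace L G] : Prop :=
  ∀ v w : L, HasLieBracketAtOne 𝕜 G v w ⁅v, w⁆

/-- `exp` is the exponential function of the Lie group `G`: it is analytic, and for each `v` in the
tangent space `E` at `1`, the curve `t ↦ exp (t v)`, for `t` real, is a one-parameter group with
velocity `v` at `t = 0`. -/
structure IsLieExponential {E G : Type*} [AddCommGroup E] [Module 𝕜 E] [TopologicalSpace E]
    [Group G] [TopologicalSpace G] [ChartedSpace E G] (exp : E → G) : Prop where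
  analytic : IsAnalyticMap 𝕜 E E exp
  map_add : ∀ (v : E) (s t : ℝ), exp (((s + t : ℝ) : 𝕜) • v) = exp ((s : 𝕜) • v) * exp ((t : 𝕜) • v)
  velocity : ∀ v : E, Filter.Tendsto
    (fun t : ℝ => ((t⁻¹ : ℝ) : 𝕜) •
      (chartAt E (1 : G) (exp ((t : 𝕜) • v)) - chartAt E (1 : G) (1 : G))) (𝓝[≠] 0) (𝓝 v)

/-- `G` is a Baker–Campbell–Hausdorff–Lie group: a `𝕜`-analytic Lie group with an exponential
function which is a local analytic diffeomorphism at `0`. -/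
structure IsBCHLieGroup (E G : Type*) [AddCommGroup E] [Module 𝕜 E] [TopologicalSpace E]
    [Group G] [TopologicalSpace G] [ChartedSpace E G] : Prop
    extends IsAnalyticLieGroup 𝕜 E G where
  exists_exp : ∃ exp : E → G, IsLieExponential 𝕜 exp ∧
    ∃ φ : OpenPartialHomeomorph E G, 0 ∈ φ.source ∧ (∀ x ∈ φ.source, φ x = exp x) ∧
      φ.symm ∈ analyticMaximalAtlas 𝕜 E G

/-- The subgroup `K` of the Lie group `G` (modelled on `E`), with its induced topology and the given
atlas (modelled on `F`), is a closed Lie subgroup: it is a Lie group and a closed submanifold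
of `G`. -/
structure IsClosedLieSubgroup {E F G : Type*} [AddCommGroup E] [Module 𝕜 E] [TopologicalSpace E]
    [AddCommGroup F] [Module 𝕜 F] [TopologicalSpace F]
    [Group G] [TopologicalSpace G] [ChartedSpace E G]
    (j : F →ₗ[𝕜] E) (K : Subgroup G) [ChartedSpace F K] : Prop where
  isAnalyticLieGroup : IsAnalyticLieGroup 𝕜 F K
  isClosedSubmanifold : IsClosedSubmanifold 𝕜 j ((↑) : K → G)

end LieGroups

/-! ## The Baker–Campbell–Hausdorff series -/

section BCH

variable (𝕜 : Type*) [RCLike 𝕜]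

open Finset Nat in
/-- The homogeneous part `H_n (x, y)` of degree `n` of the Baker–Campbell–Hausdorff series
`x + ∑_{k, m ≥ 0, p_i + q_i > 0} (-1)^k / ((k + 1) (q_1 + ⋯ + q_k + 1)) ·
  ((ad x)^{p_1} (ad y)^{q_1} ⋯ (ad x)^{p_k} (ad y)^{q_k} (ad x)^m) / (p_1! q_1! ⋯ p_k! q_k! m!) y`.
-/
def bchTerm {L : Type*} [LieRing L] [LieAlgebra 𝕜 L] (n : ℕ) (x y : L) : L :=
  (if n = 1 then x else 0) +
  ∑ k ∈ range n, ∑ p ∈ Fintype.piFinset (fun _ : Fin k => range n),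
    ∑ q ∈ Fintype.piFinset (fun _ : Fin k => range n), ∑ m ∈ range n,
      if (∀ i, 0 < p i + q i) ∧ (∑ i, (p i + q i)) + m + 1 = n then
        ((-1 : 𝕜) ^ k / (((k : 𝕜) + 1) * ((∑ i, (q i : 𝕜)) + 1) *
            (∏ i, (((p i)! : 𝕜) * ((q i)! : 𝕜))) * (m ! : 𝕜))) •
          ((List.ofFn fun i => LieAlgebra.ad 𝕜 L x ^ p i * LieAlgebra.ad 𝕜 L y ^ q i).prod *
            LieAlgebra.ad 𝕜 L x ^ m) y
      else 0

/-- The locally convex Lie algebra `L` is a Baker–Campbell–Hausdorff–Lie algebra: on some open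
neighbourhood `U` of `0` the series `∑_{n ≥ 1} H_n (x, y)` converges and defines an analytic
function `U × U → L`. -/
structure IsBCHLieAlgebra (L : Type*) [LieRing L] [LieAlgebra 𝕜 L] [TopologicalSpace L] :
    Prop where
  isLocallyConvexTVS : IsLocallyConvexTVS 𝕜 L
  continuous_bracket : Continuous fun p : L × L => ⁅p.1, p.2⁆
  exists_bch : ∃ U : Set L, IsOpen U ∧ 0 ∈ U ∧ ∃ f : L × L → L, LCAnalyticOn 𝕜 f (U ×ˢ U) ∧
    ∀ x ∈ U, ∀ y ∈ U, Filter.Tendsto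
      (fun N : ℕ => ∑ n ∈ Finset.Icc 1 N, bchTerm 𝕜 n x y) Filter.atTop (𝓝 (f (x, y)))

end BCH

/-! ## Graded and connected Hopf algebras -/

section Graded

variable {𝕜 H : Type*} [Field 𝕜] [Ring H] [HopfAlgebra 𝕜 H]

/-- The family `(𝓗 n)` is a connected grading of the Hopf algebra `H`: a vector space grading, an
algebra grading and a coalgebra grading, with `𝓗 0` one-dimensional. -/
structure IsConnectedGrading (𝓗 : ℕ → Submodule 𝕜 H) : Prop where
  isInternal : DirectSum.IsInternal 𝓗
  one_mem : (1 : H) ∈ 𝓗 0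
  mul_mem : ∀ m n, ∀ a ∈ 𝓗 m, ∀ b ∈ 𝓗 n, a * b ∈ 𝓗 (m + n)
  comul_mem : ∀ n, ∀ a ∈ 𝓗 n, Coalgebra.comul (R := 𝕜) a ∈
    ⨆ p ∈ Finset.HasAntidiagonal.antidiagonal n,
      LinearMap.range (TensorProduct.map (𝓗 p.1).subtype (𝓗 p.2).subtype)
  counit_eq_zero : ∀ n, 1 ≤ n → ∀ a ∈ 𝓗 n, Coalgebra.counit (R := 𝕜) a = 0
  connected : Module.finrank 𝕜 (𝓗 0) = 1

/-- The ideal `I` is homogeneous: it contains the homogeneous components of its elements. -/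
def IsHomogeneousIdeal (𝓗 : ℕ → Submodule 𝕜 H) (I : Ideal H) : Prop :=
  ∀ c : ℕ →₀ H, (∀ n, c n ∈ 𝓗 n) → (c.sum fun _ a => a) ∈ I → ∀ n, c n ∈ I

/-- The family of subspaces of `H ⧸ I` induced by `(𝓗 n)`. -/
def quotientGrading (𝓗 : ℕ → Submodule 𝕜 H) (I : Ideal H) [I.IsTwoSided] :
    ℕ → Submodule 𝕜 (H ⧸ I) :=
  fun n => (𝓗 n).map (Ideal.Quotient.mkₐ 𝕜 I).toLinearMap

end Graded

/-! ## Characters and infinitesimal characters -/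

section Characters

/-- The algebra `Hom_𝕜 (H, B)` of linear maps, with the convolution product. -/
abbrev ConvAlg (𝕜 H B : Type*) [CommSemiring 𝕜] [AddCommMonoid H] [Module 𝕜 H]
    [AddCommMonoid B] [Module 𝕜 B] := WithConv (H →ₗ[𝕜] B)

/-- The topology of pointwise convergence on `Hom_𝕜 (H, B)`. -/
instance ConvAlg.topologicalSpace (𝕜 H B : Type*) [CommSemiring 𝕜] [AddCommMonoid H] [Module 𝕜 H]
    [AddCommMonoid B] [Module 𝕜 B] [TopologicalSpace B] : TopologicalSpace (ConvAlg 𝕜 H B) :=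
  TopologicalSpace.induced (fun (φ : ConvAlg 𝕜 H B) (a : H) => φ.ofConv a) Pi.topologicalSpace

variable (𝕜 H B : Type*) [Field 𝕜] [Ring H] [HopfAlgebra 𝕜 H] [CommRing B] [Algebra 𝕜 B]

/-- The set of `B`-valued characters of `H`, that is, of unital algebra homomorphisms `H → B`. -/
abbrev CharGroup := WithConv (H →ₐ[𝕜] B)

variable {𝕜 H B}

/-- A character as an element of the algebra `Hom_𝕜 (H, B)`. -/
def CharGroup.toHom (φ : CharGroup 𝕜 H B) : ConvAlg 𝕜 H B :=
  WithConv.toConv (WithConv.ofConv φ).toLinearMap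

theorem CharGroup.toHom_injective :
    Function.Injective (CharGroup.toHom : CharGroup 𝕜 H B → ConvAlg 𝕜 H B) := fun φ ψ h => by
  apply WithConv.ofConv_injective
  exact AlgHom.toLinearMap_injective (WithConv.toConv_injective h)

theorem CharGroup.toHom_one : (1 : CharGroup 𝕜 H B).toHom = 1 := AlgHom.toLinearMap_convOne

theorem CharGroup.toHom_mul (φ ψ : CharGroup 𝕜 H B) :
    (φ * ψ).toHom = φ.toHom * ψ.toHom := AlgHom.toLinearMap_convMul φ ψ

/-- The inverse of the character `φ` is `φ ∘ S`, where `S` is the antipode. -/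
instance : Inv (CharGroup 𝕜 H B) where
  inv φ := WithConv.toConv <| AlgHom.ofLinearMap
    ((WithConv.ofConv φ).toLinearMap ∘ₗ HopfAlgebra.antipode 𝕜)
    (by simp)
    (fun a b => by simp [HopfAlgebra.antipode_mul_antidistrib, mul_comm])

theorem CharGroup.inv_apply (φ : CharGroup 𝕜 H B) (a : H) :
    φ⁻¹ a = φ (HopfAlgebra.antipode 𝕜 a) := rfl

/-- Characters form a group with respect to the convolution product. -/
instance : Group (CharGroup 𝕜 H B) where
  inv_mul_cancel φ := by
    apply CharGroup.toHom_injective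
    rw [CharGroup.toHom_mul, CharGroup.toHom_one]
    have h := LinearMap.algHom_comp_convMul_distrib (WithConv.ofConv φ)
      (WithConv.toConv (HopfAlgebra.antipode 𝕜 (A := H))) (WithConv.toConv LinearMap.id)
    rw [LinearMap.antipode_mul_id] at h
    refine Eq.trans (WithConv.ofConv_injective h).symm ?_
    ext a
    simp

/-- The topology induced by that of `Hom_𝕜 (H, B)`. -/
instance [TopologicalSpace B] : TopologicalSpace (CharGroup 𝕜 H B) :=
  TopologicalSpace.induced CharGroup.toHom inferInstance

/-- The convolution product of two infinitesimal characters on a product. -/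
theorem convMul_apply_mul {φ ψ : ConvAlg 𝕜 H B}
    (hφ : ∀ a b : H, φ.ofConv (a * b) =
      Coalgebra.counit (R := 𝕜) b • φ.ofConv a + Coalgebra.counit (R := 𝕜) a • φ.ofConv b)
    (hψ : ∀ a b : H, ψ.ofConv (a * b) =
      Coalgebra.counit (R := 𝕜) b • ψ.ofConv a + Coalgebra.counit (R := 𝕜) a • ψ.ofConv b)
    (a b : H) : (φ * ψ).ofConv (a * b) =
      Coalgebra.counit (R := 𝕜) b • (φ * ψ).ofConv a + φ.ofConv a * ψ.ofConv b +
        φ.ofConv b * ψ.ofConv a + Coalgebra.counit (R := 𝕜) a • (φ * ψ).ofConv b := by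
  let M : ConvAlg 𝕜 H B → ConvAlg 𝕜 H B → H ⊗[𝕜] H →ₗ[𝕜] B := fun f g =>
    LinearMap.mul' 𝕜 B ∘ₗ TensorProduct.map f.ofConv g.ofConv
  have hM : ∀ f g c, M f g (Coalgebra.comul c) = (f * g).ofConv c := fun f g c => rfl
  have key : ∀ u v : H ⊗[𝕜] H, M φ ψ (u * v) = M 1 1 v * M φ ψ u + M φ 1 u * M 1 ψ v +
      M φ 1 v * M 1 ψ u + M 1 1 u * M φ ψ v := by
    intro u v
    induction u using TensorProduct.induction_on with
    | zero => simp
    | add u₁ u₂ h₁ h₂ => simp only [add_mul, mul_add, map_add, h₁, h₂]; ring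
    | tmul a₁ a₂ =>
      induction v using TensorProduct.induction_on with
      | zero => simp
      | add v₁ v₂ h₁ h₂ => simp only [add_mul, mul_add, map_add, h₁, h₂]; ring
      | tmul b₁ b₂ =>
        simp only [M, Algebra.TensorProduct.tmul_mul_tmul, LinearMap.comp_apply,
          TensorProduct.map_tmul, LinearMap.mul'_apply, LinearMap.convOne_apply, hφ, hψ,
          Algebra.smul_def]
        ring
  rw [← hM, Bialgebra.comul_mul, key]
  simp only [hM, mul_one, one_mul, LinearMap.convOne_apply, Algebra.smul_def]

variable (𝕜 H B)

/-- The commutator bracket of the convolution product. -/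
instance : LieRing (ConvAlg 𝕜 H B) := LieRing.ofAssociativeRing

instance : LieAlgebra 𝕜 (ConvAlg 𝕜 H B) := LieAlgebra.ofAssociativeAlgebra

/-- The Lie algebra of infinitesimal characters, with the commutator bracket of the convolution
product. -/
def InfChar : LieSubalgebra 𝕜 (ConvAlg 𝕜 H B) where
  carrier := {φ | ∀ a b : H, φ.ofConv (a * b) =
    Coalgebra.counit (R := 𝕜) b • φ.ofConv a + Coalgebra.counit (R := 𝕜) a • φ.ofConv b}
  add_mem' {φ ψ} hφ hψ a b := by
    simp only [WithConv.ofConv_add, LinearMap.add_apply, hφ a b, hψ a b]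
    module
  zero_mem' a b := by simp
  smul_mem' c φ hφ a b := by
    simp only [WithConv.ofConv_smul, LinearMap.smul_apply, hφ a b]
    module
  lie_mem' {φ ψ} hφ hψ a b := by
    simp only [Ring.lie_def, WithConv.ofConv_sub, LinearMap.sub_apply, convMul_apply_mul hφ hψ a b,
      convMul_apply_mul hψ hφ a b]
    rw [mul_comm (ψ.ofConv a), mul_comm (ψ.ofConv b)]
    module

variable {𝕜 H}

/-- The annihilator of the Hopf ideal `I`, a subalgebra of `Hom_𝕜 (H, B)`. -/
def annihilator (I : Ideal H) [I.IsTwoSided] [I.IsHopfIdeal 𝕜] :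
    Subalgebra 𝕜 (ConvAlg 𝕜 H B) where
  carrier := {φ | ∀ a ∈ I, φ.ofConv a = 0}
  mul_mem' {φ ψ} hφ hψ a ha := by
    have hφ' : (I.restrictScalars 𝕜) ≤ LinearMap.ker φ.ofConv := hφ
    have hψ' : (I.restrictScalars 𝕜) ≤ LinearMap.ker ψ.ofConv := hψ
    have h : TensorProduct.map φ.ofConv ψ.ofConv =
        TensorProduct.map ((I.restrictScalars 𝕜).liftQ _ hφ') ((I.restrictScalars 𝕜).liftQ _ hψ') ∘ₗ
          TensorProduct.map (I.restrictScalars 𝕜).mkQ (I.restrictScalars 𝕜).mkQ := by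
      rw [← TensorProduct.map_comp, Submodule.liftQ_mkQ, Submodule.liftQ_mkQ]
    rw [LinearMap.convMul_apply, h, LinearMap.comp_apply,
      Submodule.IsCoideal.map_mkQ_comul_eq_zero (I := I.restrictScalars 𝕜) ha, map_zero, map_zero]
  add_mem' {φ ψ} hφ hψ a ha := by simp [hφ a ha, hψ a ha]
  algebraMap_mem' r a ha := by
    simp [LinearMap.convAlgebraMap_apply,
      Submodule.IsCoideal.counit_eq_zero (I := I.restrictScalars 𝕜) ha]

/-- The subgroup `Ann (I, B) ∩ Char (H, B)` of `Char (H, B)`. -/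
def annGroup (I : Ideal H) [I.IsTwoSided] [I.IsHopfIdeal 𝕜] : Subgroup (CharGroup 𝕜 H B) where
  carrier := {φ | φ.toHom ∈ annihilator (𝕜 := 𝕜) B I}
  mul_mem' {φ ψ} hφ hψ := by
    simpa only [Set.mem_ofPred_eq, CharGroup.toHom_mul] using mul_mem hφ hψ
  one_mem' := by
    simpa only [Set.mem_ofPred_eq, CharGroup.toHom_one] using one_mem _
  inv_mem' {φ} hφ a ha := hφ _ (Ideal.IsHopfIdeal.antipode_mem ha)

/-- The Lie subalgebra `Ann (I, B) ∩ InfChar (H, B)` of `InfChar (H, B)`. -/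
def annLie (I : Ideal H) [I.IsTwoSided] [I.IsHopfIdeal 𝕜] : LieSubalgebra 𝕜 (InfChar 𝕜 H B) where
  carrier := {φ | (φ : ConvAlg 𝕜 H B) ∈ annihilator (𝕜 := 𝕜) B I}
  add_mem' {φ ψ} hφ hψ := (annihilator (𝕜 := 𝕜) B I).add_mem hφ hψ
  zero_mem' := zero_mem (annihilator (𝕜 := 𝕜) B I)
  smul_mem' c φ hφ := (annihilator (𝕜 := 𝕜) B I).smul_mem hφ c
  lie_mem' {φ ψ} hφ hψ := by
    change ⁅(φ : ConvAlg 𝕜 H B), (ψ : ConvAlg 𝕜 H B)⁆ ∈ annihilator (𝕜 := 𝕜) B I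
    rw [Ring.lie_def]
    exact sub_mem (mul_mem hφ hψ) (mul_mem hψ hφ)

end Characters

/-- The Lie group structure on `Char (H, B)` given by the atlas is the one as a closed analytic
submanifold, modelled on the closed subspace of infinitesimal characters, of the locally convex
space `Hom_𝕜 (H, B)`, and `exp`, given by the exponential series with respect to the convolution
product, is a global analytic diffeomorphism onto it. -/
structure IsCharLieGroup (𝕜 H B : Type*) [RCLike 𝕜] [Ring H] [HopfAlgebra 𝕜 H] [CommRing B]
    [Algebra 𝕜 B] [TopologicalSpace B]
    [ChartedSpace (InfChar 𝕜 H B) (CharGroup 𝕜 H B)]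
    (exp : InfChar 𝕜 H B ≃ CharGroup 𝕜 H B) : Prop where
  isAnalyticLieGroup : IsAnalyticLieGroup 𝕜 (InfChar 𝕜 H B) (CharGroup 𝕜 H B)
  isClosedSubmanifold : IsClosedSubmanifold 𝕜 (InfChar 𝕜 H B).toSubmodule.subtype
    (CharGroup.toHom : CharGroup 𝕜 H B → ConvAlg 𝕜 H B)
  hasSum_exp : ∀ φ : InfChar 𝕜 H B, HasSum
    (fun n : ℕ => ((n.factorial : 𝕜)⁻¹) • (φ : ConvAlg 𝕜 H B) ^ n) (CharGroup.toHom (exp φ))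
  isAnalyticDiffeo_exp : IsAnalyticDiffeo 𝕜 (InfChar 𝕜 H B) (InfChar 𝕜 H B) exp

end CharLie

end

open CharLie

/-!
The exponential series with respect to the convolution product is a global chart, and everything
else is read off in this chart.

*Convergence.* The linear maps `H → B` which vanish in all degrees below `n` form a multiplicative
filtration `filt B 𝓗 n` of `Hom (H, B)`, and each `a : H` is killed by `filt B 𝓗 n` for large `n`.
So a power series can be evaluated at every `X` with `X 1 = 0`: at each `a` the sum is finite
(`seriesEval`). This evaluation is multiplicative and compatible with substitution, hence `exp` and
`log` are inverse to each other between the maps with value `0` at `1` and those with value `1`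
at `1`. Since `(exp (c X)) a` is a polynomial in `c`, comparing coefficients shows that `exp φ` is a
character if and only if `φ` is an infinitesimal character (`convExp_apply_mul`,
`mem_infChar_of_convExp`). The powers of an element of the subalgebra `Ann (I, B)` stay in it, so
that `exp` restricts to a bijection of the annihilators of `I`.

*Analyticity.* All maps which occur have values at `a : H` that are continuous polynomial maps, of a
degree depending on `a`. Such maps form an algebra `polyMaps`, they are differentiated formally, and
they extend to the complexification. The model spaces are spaces of all linear maps vanishing on a
given subspace `J` of `H` (`IsAnnihilatorEmbedding`), so by a basis of `H ⧸ J` they are powers of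
`B`, and a map into them is analytic as soon as its values are continuous polynomial maps. No chain
rule is needed.

*Lie groups.* Both `Char (H, B)` and `Ann (I, B) ∩ Char (H, B)` are instances of one situation
(`IsExpModel`): a group inside `Hom (H, B)` parametrized by `exp` on such a model space. With `log`
as the only chart, the group is an analytic Lie group and `exp` is the identity in charts. The Lie
bracket comes from the second order terms of `log (exp (s v) exp (t w))`, and the chart of
`Hom (H, B)` which makes the group a submanifold is an extension of `log` (`extendedLog`). The
`n`-th term of the Baker–Campbell–Hausdorff series lies in `filt B 𝓗 n`, so the series converges
everywhere.

*Quotients.* If `I` is homogeneous, then `H ⧸ I` is graded and connected. Composition with the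
quotient map is a continuous homomorphism of convolution algebras and hence commutes with `exp`. In
exponential coordinates it is an isomorphism of topological vector spaces, and so it is an analytic
diffeomorphism.
-/

noncomputable section

namespace CharLie

/-! ### Directional derivatives and smooth maps -/

section DirDeriv

variable {𝕜 : Type*} [NontriviallyNormedField 𝕜] {E E' F G R : Type*}
  [AddCommGroup E] [Module 𝕜 E] [AddCommGroup E'] [Module 𝕜 E']
  [AddCommGroup F] [Module 𝕜 F] [TopologicalSpace F]
  [AddCommGroup G] [Module 𝕜 G] [TopologicalSpace G]

theorem HasDirDeriv.unique [T2Space F] {f : E → F} {x h : E} {d d' : F}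
    (H : HasDirDeriv 𝕜 f x h d) (H' : HasDirDeriv 𝕜 f x h d') : d = d' :=
  tendsto_nhds_unique H H'

theorem hasDirDeriv_const (c : F) (x h : E) : HasDirDeriv 𝕜 (fun _ => c) x h 0 := by
  simp [HasDirDeriv, tendsto_const_nhds]

theorem hasDirDeriv_linear (l : E →ₗ[𝕜] F) (x h : E) : HasDirDeriv 𝕜 l x h (l h) := by
  refine (tendsto_const_nhds (x := l h)).congr' ?_
  filter_upwards [self_mem_nhdsWithin] with t ht
  simp [smul_smul, inv_mul_cancel₀ (show t ≠ 0 from ht)]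

theorem HasDirDeriv.add [ContinuousAdd F] {f g : E → F} {x h : E} {d e : F}
    (hf : HasDirDeriv 𝕜 f x h d) (hg : HasDirDeriv 𝕜 g x h e) :
    HasDirDeriv 𝕜 (fun y => f y + g y) x h (d + e) := by
  refine (Filter.Tendsto.add hf hg).congr fun t => ?_
  rw [← smul_add, add_sub_add_comm]

theorem HasDirDeriv.clm_comp {f : E → F} {x h : E} {d : F} (hf : HasDirDeriv 𝕜 f x h d)
    (L : F →L[𝕜] G) : HasDirDeriv 𝕜 (fun y => L (f y)) x h (L d) := by
  refine ((L.continuous.tendsto d).comp hf).congr fun t => ?_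
  simp

theorem HasDirDeriv.comp_linear (L : E' →ₗ[𝕜] E) {f : E → F} {x h : E'} {d : F}
    (hf : HasDirDeriv 𝕜 f (L x) (L h) d) : HasDirDeriv 𝕜 (fun y => f (L y)) x h d := by
  refine Filter.Tendsto.congr (fun t => ?_) hf
  simp

theorem HasDirDeriv.tendsto_line [ContinuousSMul 𝕜 F] [ContinuousAdd F] {f : E → F} {x h : E}
    {d : F} (hf : HasDirDeriv 𝕜 f x h d) :
    Filter.Tendsto (fun t : 𝕜 => f (x + t • h)) (𝓝[≠] 0) (𝓝 (f x)) := by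
  have h0 : Filter.Tendsto (fun t : 𝕜 => t) (𝓝[≠] 0) (𝓝 0) := nhdsWithin_le_nhds
  have h1 : Filter.Tendsto
      (fun t : 𝕜 => t • (t⁻¹ • (f (x + t • h) - f x)) + f x) (𝓝[≠] 0) (𝓝 ((0 : 𝕜) • d + f x)) :=
    (h0.smul hf).add_const (f x)
  rw [zero_smul, zero_add] at h1
  refine h1.congr' ?_
  filter_upwards [self_mem_nhdsWithin] with t ht
  rw [smul_smul, mul_inv_cancel₀ (show t ≠ 0 from ht), one_smul, sub_add_cancel]

/-- The product rule in a (not necessarily commutative) topological algebra. -/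
theorem HasDirDeriv.mul [Ring R] [Algebra 𝕜 R] [TopologicalSpace R] [IsTopologicalRing R]
    [ContinuousSMul 𝕜 R] {f g : E → R} {x h : E} {d e : R}
    (hf : HasDirDeriv 𝕜 f x h d) (hg : HasDirDeriv 𝕜 g x h e) :
    HasDirDeriv 𝕜 (fun y => f y * g y) x h (d * g x + f x * e) := by
  refine ((Filter.Tendsto.mul hf hg.tendsto_line).add
    (Filter.Tendsto.const_mul (f x) hg)).congr fun t => ?_
  rw [smul_mul_assoc, mul_smul_comm, ← smul_add]
  congr 1
  noncomm_ring

end DirDeriv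

section Smooth

variable {𝕜 : Type*} [NontriviallyNormedField 𝕜] {E E' F G : Type*}
  [AddCommGroup E] [Module 𝕜 E] [TopologicalSpace E]
  [AddCommGroup E'] [Module 𝕜 E'] [TopologicalSpace E']
  [AddCommGroup F] [Module 𝕜 F] [TopologicalSpace F]
  [AddCommGroup G] [Module 𝕜 G] [TopologicalSpace G]

theorem CInftyOn.clm_comp {f : E → F} {U : Set E} (hf : CInftyOn 𝕜 f U) (L : F →L[𝕜] G) :
    CInftyOn 𝕜 (fun x => L (f x)) U := by
  obtain ⟨D, h0, h1, h2⟩ := hf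
  refine ⟨fun k x y => L (D k x y), fun x hx y => congrArg L (h0 x hx y),
    fun k x hx y h => (h1 k x hx y h).clm_comp L, fun k => L.continuous.comp_continuousOn (h2 k)⟩

theorem CInftyOn.comp_clm {f : E → F} {U : Set E} (hf : CInftyOn 𝕜 f U) (L : E' →L[𝕜] E) :
    CInftyOn 𝕜 (fun x => f (L x)) (L ⁻¹' U) := by
  obtain ⟨D, h0, h1, h2⟩ := hf
  refine ⟨fun k x y => D k (L x) (L ∘ y), fun x hx y => h0 _ hx _, fun k x hx y h => ?_,
    fun k => ?_⟩
  · have := h1 k (L x) hx (L ∘ y) (L h)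
    rw [← Fin.comp_snoc] at this
    exact HasDirDeriv.comp_linear (L : E' →ₗ[𝕜] E) this
  · refine ContinuousOn.comp (g := fun p : E × (Fin k → E) => D k p.1 p.2)
      (f := fun p : E' × (Fin k → E') => (L p.1, L ∘ p.2)) (h2 k) ?_ ?_
    · refine Continuous.continuousOn ?_
      refine (L.continuous.comp continuous_fst).prodMk (continuous_pi fun i => ?_)
      exact L.continuous.comp ((continuous_apply i).comp continuous_snd)
    · rintro ⟨x, y⟩ hx
      exact ⟨hx.1, trivial⟩

end Smooth

/-! ### Continuous polynomial maps -/

section PolyMaps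

/-- The algebra of continuous polynomial maps from `E` to the algebra `B`: the maps which are
polynomials, with coefficients in `B`, in continuous linear maps `E → B`. -/
def polyMaps (𝕜 E B : Type*) [Semiring 𝕜] [AddCommMonoid E] [Module 𝕜 E] [TopologicalSpace E]
    [CommRing B] [Module 𝕜 B] [TopologicalSpace B] : Subalgebra B (E → B) :=
  Algebra.adjoin B (Set.range fun (l : E →L[𝕜] B) (x : E) => l x)

variable {𝕜 : Type*} [NontriviallyNormedField 𝕜] {E E' B : Type*}
  [AddCommGroup E] [Module 𝕜 E] [TopologicalSpace E]
  [AddCommGroup E'] [Module 𝕜 E'] [TopologicalSpace E']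
  [CommRing B] [Algebra 𝕜 B] [TopologicalSpace B]

theorem clm_mem_polyMaps (l : E →L[𝕜] B) : (fun x => l x) ∈ polyMaps 𝕜 E B :=
  Algebra.subset_adjoin ⟨l, rfl⟩

theorem const_mem_polyMaps (b : B) : (fun _ => b) ∈ polyMaps 𝕜 E B :=
  (polyMaps 𝕜 E B).algebraMap_mem b

theorem smul_mem_polyMaps (c : 𝕜) {p : E → B} (hp : p ∈ polyMaps 𝕜 E B) :
    (fun x => c • p x) ∈ polyMaps 𝕜 E B := by
  have := (polyMaps 𝕜 E B).smul_mem hp (algebraMap 𝕜 B c)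
  convert this using 1
  ext x
  simp [Algebra.smul_def]

theorem sum_mem_polyMaps {ι : Type*} (s : Finset ι) {p : ι → E → B}
    (hp : ∀ i ∈ s, p i ∈ polyMaps 𝕜 E B) : (fun x => ∑ i ∈ s, p i x) ∈ polyMaps 𝕜 E B := by
  have := sum_mem hp
  convert this using 1
  ext x
  simp

theorem comp_clm_mem_polyMaps (L : E' →L[𝕜] E) {p : E → B} (hp : p ∈ polyMaps 𝕜 E B) :
    (fun x => p (L x)) ∈ polyMaps 𝕜 E' B := by
  induction hp using Algebra.adjoin_induction with
  | mem p hp =>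
    obtain ⟨l, rfl⟩ := hp
    exact clm_mem_polyMaps (l.comp L)
  | algebraMap b => exact const_mem_polyMaps b
  | add p q _ _ hp hq => exact add_mem hp hq
  | mul p q _ _ hp hq => exact mul_mem hp hq

variable [IsTopologicalRing B]

theorem continuous_of_mem_polyMaps {p : E → B} (hp : p ∈ polyMaps 𝕜 E B) : Continuous p := by
  induction hp using Algebra.adjoin_induction with
  | mem p hp =>
    obtain ⟨l, rfl⟩ := hp
    exact l.continuous
  | algebraMap b => exact continuous_const
  | add p q _ _ hp hq => exact hp.add hq
  | mul p q _ _ hp hq => exact hp.mul hq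

variable [ContinuousSMul 𝕜 B]

/-- The directional derivative of a continuous polynomial map is a continuous polynomial map in
the point and the direction. -/
theorem exists_hasDirDeriv_of_mem_polyMaps {p : E → B} (hp : p ∈ polyMaps 𝕜 E B) :
    ∃ q ∈ polyMaps 𝕜 (E × E) B, ∀ x h, HasDirDeriv 𝕜 p x h (q (x, h)) := by
  induction hp using Algebra.adjoin_induction with
  | mem p hp =>
    obtain ⟨l, rfl⟩ := hp
    exact ⟨_, clm_mem_polyMaps (l.comp (ContinuousLinearMap.snd 𝕜 E E)),
      fun x h => hasDirDeriv_linear (l : E →ₗ[𝕜] B) x h⟩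
  | algebraMap b => exact ⟨_, zero_mem _, fun x h => hasDirDeriv_const b x h⟩
  | add p q _ _ hp hq =>
    obtain ⟨p', hp', hp⟩ := hp
    obtain ⟨q', hq', hq⟩ := hq
    exact ⟨_, add_mem hp' hq', fun x h => (hp x h).add (hq x h)⟩
  | mul p q hp₀ hq₀ hp hq =>
    obtain ⟨p', hp', hp⟩ := hp
    obtain ⟨q', hq', hq⟩ := hq
    have hp₁ := comp_clm_mem_polyMaps (ContinuousLinearMap.fst 𝕜 E E) hp₀
    have hq₁ := comp_clm_mem_polyMaps (ContinuousLinearMap.fst 𝕜 E E) hq₀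
    exact ⟨_, add_mem (mul_mem hp' hq₁) (mul_mem hp₁ hq'), fun x h => (hp x h).mul (hq x h)⟩

/-- The continuous linear map `(x, (y₁, …, y_{k + 1})) ↦ ((x, (y₁, …, y_k)), (y_{k + 1}, 0))`. -/
def splitLast (𝕜 E : Type*) [NontriviallyNormedField 𝕜] [AddCommGroup E] [Module 𝕜 E]
    [TopologicalSpace E] (k : ℕ) :
    E × (Fin (k + 1) → E) →L[𝕜] (E × (Fin k → E)) × (E × (Fin k → E)) where
  toFun p := ((p.1, Fin.init p.2), (p.2 (Fin.last k), 0))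
  map_add' p q := by simp [Fin.init_def]; rfl
  map_smul' c p := by simp [Fin.init_def]; rfl
  cont := by
    refine Continuous.prodMk (continuous_fst.prodMk (continuous_pi fun i => ?_))
      (Continuous.prodMk ?_ continuous_const)
    · exact (continuous_apply (Fin.castSucc i)).comp continuous_snd
    · exact (continuous_apply (Fin.last k)).comp continuous_snd

/-- The derivative in the point of a continuous polynomial map of a point and `k` directions is a
continuous polynomial map of the point and `k + 1` directions. -/
theorem exists_iterated_of_mem_polyMaps {k : ℕ} {p : E × (Fin k → E) → B}
    (hp : p ∈ polyMaps 𝕜 (E × (Fin k → E)) B) :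
    ∃ q ∈ polyMaps 𝕜 (E × (Fin (k + 1) → E)) B, ∀ x (y : Fin k → E) h,
      HasDirDeriv 𝕜 (fun x' => p (x', y)) x h (q (x, Fin.snoc y h)) := by
  obtain ⟨q, hq, hpq⟩ := exists_hasDirDeriv_of_mem_polyMaps hp
  refine ⟨_, comp_clm_mem_polyMaps (splitLast 𝕜 E k) hq, fun x y h => ?_⟩
  have := hpq (x, y) (h, 0)
  have h' : splitLast 𝕜 E k (x, Fin.snoc y h) = ((x, y), (h, 0)) := by
    simp [splitLast]
  rw [h']
  refine Filter.Tendsto.congr (fun t => ?_) this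
  simp

/-- A family of continuous polynomial maps is smooth. -/
theorem cInftyOn_pi_of_mem_polyMaps {ι : Type*} {p : ι → E → B}
    (hp : ∀ i, p i ∈ polyMaps 𝕜 E B) : CInftyOn 𝕜 (fun x i => p i x) Set.univ := by
  choose! next hnext hderiv using
    fun (k : ℕ) (p : E × (Fin k → E) → B) (hp : p ∈ polyMaps 𝕜 (E × (Fin k → E)) B) =>
      exists_iterated_of_mem_polyMaps hp
  -- The iterated derivatives of each `p i`, obtained by iterating `next`.
  let D : ι → (k : ℕ) → E × (Fin k → E) → B := fun i k =>
    Nat.rec (motive := fun k => E × (Fin k → E) → B) (fun z => p i z.1) (fun k q => next k q) k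
  have hD : ∀ i k, D i k ∈ polyMaps 𝕜 (E × (Fin k → E)) B := by
    intro i k
    induction k with
    | zero => exact comp_clm_mem_polyMaps (ContinuousLinearMap.fst 𝕜 E (Fin 0 → E)) (hp i)
    | succ k ih => exact hnext k _ ih
  refine ⟨fun k x y i => D i k (x, y), fun x _ y => rfl, fun k x _ y h => ?_, fun k => ?_⟩
  · refine tendsto_pi_nhds.2 fun i => ?_
    exact hderiv k (D i k) (hD i k) x y h
  · exact (continuous_pi fun i => continuous_of_mem_polyMaps (hD i k)).continuousOn

end PolyMaps

/-! ### Complexification of algebras and of polynomial maps -/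

section ComplexifyAlgebra

namespace Complexify

section Coordinates

variable {𝕜 E B : Type*}

theorem ext {p q : Complexify 𝕜 E} (h₁ : p.1 = q.1) (h₂ : p.2 = q.2) : p = q := Prod.ext h₁ h₂

theorem fst_add [AddCommGroup E] (p q : Complexify 𝕜 E) : (p + q).1 = p.1 + q.1 := rfl
theorem snd_add [AddCommGroup E] (p q : Complexify 𝕜 E) : (p + q).2 = p.2 + q.2 := rfl
theorem fst_zero [AddCommGroup E] : (0 : Complexify 𝕜 E).1 = 0 := rfl
theorem snd_zero [AddCommGroup E] : (0 : Complexify 𝕜 E).2 = 0 := rfl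

theorem fst_smul [RCLike 𝕜] [AddCommGroup E] [Module 𝕜 E] (z : ℂ) (p : Complexify 𝕜 E) :
    (z • p).1 = (z.re : 𝕜) • p.1 - (z.im : 𝕜) • p.2 := rfl

theorem snd_smul [RCLike 𝕜] [AddCommGroup E] [Module 𝕜 E] (z : ℂ) (p : Complexify 𝕜 E) :
    (z • p).2 = (z.re : 𝕜) • p.2 + (z.im : 𝕜) • p.1 := rfl

variable [CommRing B]

/-- The product `(a + i b) (c + i d) = (a c - b d) + i (a d + b c)`. -/
instance : Mul (Complexify 𝕜 B) where
  mul p q := ((p.1 * q.1 - p.2 * q.2, p.1 * q.2 + p.2 * q.1) : B × B)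

instance : One (Complexify 𝕜 B) := ⟨((1, 0) : B × B)⟩

theorem fst_mul (p q : Complexify 𝕜 B) : (p * q).1 = p.1 * q.1 - p.2 * q.2 := rfl
theorem snd_mul (p q : Complexify 𝕜 B) : (p * q).2 = p.1 * q.2 + p.2 * q.1 := rfl
theorem fst_one : (1 : Complexify 𝕜 B).1 = 1 := rfl
theorem snd_one : (1 : Complexify 𝕜 B).2 = 0 := rfl

instance : CommRing (Complexify 𝕜 B) where
  __ := (inferInstance : AddCommGroup (Complexify 𝕜 B))
  mul_assoc p q r := by
    refine ext ?_ ?_ <;> simp only [fst_mul, snd_mul] <;> ring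
  one_mul p := by refine ext ?_ ?_ <;> simp [fst_mul, snd_mul, fst_one, snd_one]
  mul_one p := by refine ext ?_ ?_ <;> simp [fst_mul, snd_mul, fst_one, snd_one]
  left_distrib p q r := by
    refine ext ?_ ?_ <;> simp only [fst_mul, snd_mul, fst_add, snd_add] <;> ring
  right_distrib p q r := by
    refine ext ?_ ?_ <;> simp only [fst_mul, snd_mul, fst_add, snd_add] <;> ring
  zero_mul p := by refine ext ?_ ?_ <;> simp [fst_mul, snd_mul, fst_zero, snd_zero]
  mul_zero p := by refine ext ?_ ?_ <;> simp [fst_mul, snd_mul, fst_zero, snd_zero]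
  mul_comm p q := by
    refine ext ?_ ?_ <;> simp only [fst_mul, snd_mul] <;> ring

end Coordinates

instance {𝕜 B : Type*} [RCLike 𝕜] [CommRing B] [Algebra 𝕜 B] : Algebra ℂ (Complexify 𝕜 B) :=
  Algebra.ofModule
  (fun z p q => by
    refine ext ?_ ?_ <;> simp only [fst_mul, snd_mul, fst_smul, snd_smul, Algebra.smul_def] <;>
      ring)
  (fun z p q => by
    refine ext ?_ ?_ <;> simp only [fst_mul, snd_mul, fst_smul, snd_smul, Algebra.smul_def] <;>
      ring)

instance {𝕜 B : Type*} [CommRing B] [TopologicalSpace B] [IsTopologicalRing B] :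
    IsTopologicalRing (Complexify 𝕜 B) where
  continuous_add := (inferInstance : ContinuousAdd (B × B)).continuous_add
  continuous_neg := (inferInstance : ContinuousNeg (B × B)).continuous_neg
  continuous_mul := by
    change Continuous fun p : (B × B) × (B × B) =>
      ((p.1.1 * p.2.1 - p.1.2 * p.2.2, p.1.1 * p.2.2 + p.1.2 * p.2.1) : B × B)
    fun_prop

variable {𝕜 : Type*} [RCLike 𝕜] {E F B : Type*}
  [AddCommGroup E] [Module 𝕜 E] [TopologicalSpace E]
  [AddCommGroup F] [Module 𝕜 F] [TopologicalSpace F]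
  [CommRing B] [Algebra 𝕜 B] [TopologicalSpace B]

instance [IsTopologicalAddGroup E] [ContinuousSMul 𝕜 E] : ContinuousSMul ℂ (Complexify 𝕜 E) where
  continuous_smul := by
    change Continuous fun p : ℂ × (E × E) =>
      (((p.1.re : 𝕜) • p.2.1 - (p.1.im : 𝕜) • p.2.2,
        (p.1.re : 𝕜) • p.2.2 + (p.1.im : 𝕜) • p.2.1) : E × E)
    have h₁ : Continuous fun p : ℂ × (E × E) => (p.1.re : 𝕜) :=
      RCLike.continuous_ofReal.comp (Complex.continuous_re.comp continuous_fst)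
    have h₂ : Continuous fun p : ℂ × (E × E) => (p.1.im : 𝕜) :=
      RCLike.continuous_ofReal.comp (Complex.continuous_im.comp continuous_fst)
    fun_prop

/-- The complex linear extension of a continuous linear map. -/
def map (L : E →L[𝕜] F) : Complexify 𝕜 E →L[ℂ] Complexify 𝕜 F where
  toFun p := ((L p.1, L p.2) : F × F)
  map_add' p q := ext (L.map_add _ _) (L.map_add _ _)
  map_smul' z p := by
    refine ext ?_ ?_
    · change L _ = _
      rw [fst_smul, map_sub, map_smul, map_smul]; rfl
    · change L _ = _
      rw [snd_smul, map_add, map_smul, map_smul]; rfl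
  cont := (L.continuous.prodMap L.continuous :)

theorem map_incl (L : E →L[𝕜] F) (x : E) : map L (incl 𝕜 x) = incl 𝕜 (L x) :=
  ext rfl (L.map_zero)

/-- Complexification commutes with products. -/
def piMap (𝕜 B : Type*) [RCLike 𝕜] [AddCommGroup B] [Module 𝕜 B] [TopologicalSpace B] (ι : Type*) :
    (ι → Complexify 𝕜 B) →L[ℂ] Complexify 𝕜 (ι → B) where
  toFun p := ((fun i => (p i).1, fun i => (p i).2) : (ι → B) × (ι → B))
  map_add' p q := rfl
  map_smul' z p := rfl
  cont := by
    refine Continuous.prodMk (continuous_pi fun i => ?_) (continuous_pi fun i => ?_)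
    · exact (continuous_fst (X := B) (Y := B)).comp (continuous_apply i)
    · exact (continuous_snd (X := B) (Y := B)).comp (continuous_apply i)

/-- A continuous polynomial map extends to a complex polynomial map of the complexifications. -/
theorem exists_polyMaps_extension {p : E → B} (hp : p ∈ polyMaps 𝕜 E B) :
    ∃ q ∈ polyMaps ℂ (Complexify 𝕜 E) (Complexify 𝕜 B),
      ∀ x, q (incl 𝕜 x) = incl 𝕜 (p x) := by
  induction hp using Algebra.adjoin_induction with
  | mem p hp =>
    obtain ⟨l, rfl⟩ := hp
    exact ⟨_, clm_mem_polyMaps (map l), fun x => map_incl l x⟩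
  | algebraMap b => exact ⟨_, const_mem_polyMaps (incl 𝕜 b), fun x => rfl⟩
  | add p q _ _ hp hq =>
    obtain ⟨p', hp', hp⟩ := hp
    obtain ⟨q', hq', hq⟩ := hq
    refine ⟨_, add_mem hp' hq', fun x => ?_⟩
    rw [Pi.add_apply, hp, hq]
    exact ext rfl (add_zero _)
  | mul p q _ _ hp hq =>
    obtain ⟨p', hp', hp⟩ := hp
    obtain ⟨q', hq', hq⟩ := hq
    refine ⟨_, mul_mem hp' hq', fun x => ?_⟩
    rw [Pi.mul_apply, hp, hq]
    refine ext ?_ ?_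
    · change p x * q x - 0 * 0 = p x * q x
      ring
    · change p x * 0 + 0 * q x = 0
      ring

end Complexify

end ComplexifyAlgebra

/-! ### Analytic maps -/

section Analytic

variable {𝕜 : Type*} [RCLike 𝕜] {E E' F G B ι : Type*}
  [AddCommGroup E] [Module 𝕜 E] [TopologicalSpace E]
  [AddCommGroup E'] [Module 𝕜 E'] [TopologicalSpace E']
  [AddCommGroup F] [Module 𝕜 F] [TopologicalSpace F]
  [AddCommGroup G] [Module 𝕜 G] [TopologicalSpace G]
  [CommRing B] [Algebra 𝕜 B] [TopologicalSpace B]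

theorem LCAnalyticOn.clm_comp {f : E → F} {U : Set E} (hf : LCAnalyticOn 𝕜 f U) (L : F →L[𝕜] G) :
    LCAnalyticOn 𝕜 (fun x => L (f x)) U := by
  refine ⟨hf.1, fun h => ?_, fun h => (hf.2.2 h).clm_comp L⟩
  obtain ⟨V, hV, hUV, g, hg, hgf⟩ := hf.2.1 h
  refine ⟨V, hV, hUV, _, hg.clm_comp (Complexify.map L), fun x hx => ?_⟩
  rw [hgf x hx, Complexify.map_incl]

theorem LCAnalyticOn.comp_clm {f : E → F} {U : Set E} (hf : LCAnalyticOn 𝕜 f U) (L : E' →L[𝕜] E) :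
    LCAnalyticOn 𝕜 (fun x => f (L x)) (L ⁻¹' U) := by
  refine ⟨hf.1.preimage L.continuous, fun h => ?_, fun h => (hf.2.2 h).comp_clm L⟩
  obtain ⟨V, hV, hUV, g, hg, hgf⟩ := hf.2.1 h
  refine ⟨Complexify.map L ⁻¹' V, hV.preimage (Complexify.map L).continuous, fun x hx => ?_, _,
    hg.comp_clm (Complexify.map L), fun x hx => ?_⟩
  · rw [Set.mem_preimage, Complexify.map_incl]
    exact hUV _ hx
  · rw [Complexify.map_incl, hgf _ hx]

/-- A family of continuous polynomial maps is analytic, also after a continuous linear map. -/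
theorem lcAnalyticOn_of_mem_polyMaps [IsTopologicalRing B] [ContinuousSMul 𝕜 B] {p : ι → E → B}
    (hp : ∀ i, p i ∈ polyMaps 𝕜 E B) (L : (ι → B) →L[𝕜] F) :
    LCAnalyticOn 𝕜 (fun x => L fun i => p i x) Set.univ := by
  suffices LCAnalyticOn 𝕜 (fun x i => p i x) Set.univ from this.clm_comp L
  refine ⟨isOpen_univ, fun h => ?_, fun h => cInftyOn_pi_of_mem_polyMaps hp⟩
  choose q hq hqp using fun i => Complexify.exists_polyMaps_extension (hp i)
  refine ⟨Set.univ, isOpen_univ, fun _ _ => trivial, _,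
    (cInftyOn_pi_of_mem_polyMaps hq).clm_comp (Complexify.piMap 𝕜 B ι), fun x _ => ?_⟩
  simp only [hqp]
  rfl

end Analytic

/-! ### The topological algebra `Hom (H, B)` -/

section Pointwise

variable {𝕜 H B : Type*} [NormedField 𝕜] [AddCommGroup H] [Module 𝕜 H]
  [CommRing B] [Algebra 𝕜 B]

/-- A linear map as a family of values. -/
def ConvAlg.toPi (𝕜 H B : Type*) [NormedField 𝕜] [AddCommGroup H] [Module 𝕜 H]
    [CommRing B] [Algebra 𝕜 B] : ConvAlg 𝕜 H B →ₗ[𝕜] (H → B) where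
  toFun φ a := φ.ofConv a
  map_add' _ _ := rfl
  map_smul' _ _ := rfl

theorem ConvAlg.ext_apply {φ ψ : ConvAlg 𝕜 H B} (h : ∀ a, φ.ofConv a = ψ.ofConv a) : φ = ψ :=
  WithConv.ext (LinearMap.ext h)

variable [TopologicalSpace B]

theorem ConvAlg.isInducing_toPi : Topology.IsInducing (ConvAlg.toPi 𝕜 H B) := ⟨rfl⟩

/-- Evaluation at `a`, as a continuous linear map. -/
def ConvAlg.evalCLM (𝕜 B : Type*) {H : Type*} [NormedField 𝕜] [AddCommGroup H] [Module 𝕜 H]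
    [CommRing B] [Algebra 𝕜 B] [TopologicalSpace B] (a : H) : ConvAlg 𝕜 H B →L[𝕜] B where
  toLinearMap := (LinearMap.proj a).comp (ConvAlg.toPi 𝕜 H B)
  cont := (continuous_apply a).comp ConvAlg.isInducing_toPi.continuous

@[simp]
theorem ConvAlg.evalCLM_apply (a : H) (φ : ConvAlg 𝕜 H B) :
    ConvAlg.evalCLM 𝕜 B a φ = φ.ofConv a := rfl

theorem ConvAlg.continuous_iff {X : Type*} [TopologicalSpace X] {f : X → ConvAlg 𝕜 H B} :
    Continuous f ↔ ∀ a, Continuous fun x => (f x).ofConv a := by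
  rw [ConvAlg.isInducing_toPi.continuous_iff, continuous_pi_iff]
  rfl

theorem ConvAlg.hasSum_iff {u : ℕ → ConvAlg 𝕜 H B} {φ : ConvAlg 𝕜 H B} :
    HasSum u φ ↔ ∀ a, HasSum (fun n => (u n).ofConv a) (φ.ofConv a) := by
  rw [← ConvAlg.isInducing_toPi.hasSum_iff, Pi.hasSum]
  rfl

instance [IsTopologicalRing B] : IsTopologicalAddGroup (ConvAlg 𝕜 H B) :=
  topologicalAddGroup_induced (ConvAlg.toPi 𝕜 H B)

instance [ContinuousSMul 𝕜 B] : ContinuousSMul 𝕜 (ConvAlg 𝕜 H B) :=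
  continuousSMul_induced (ConvAlg.toPi 𝕜 H B)

instance [T2Space B] : T2Space (ConvAlg 𝕜 H B) :=
  (Topology.IsEmbedding.mk ConvAlg.isInducing_toPi
    fun _ _ h => ConvAlg.ext_apply (congrFun h)).t2Space

end Pointwise

section Convolution

variable {𝕜 H B : Type*} [NormedField 𝕜] [AddCommGroup H] [Module 𝕜 H] [Coalgebra 𝕜 H]
  [CommRing B] [Algebra 𝕜 B]

/-- The convolution product at `a` is a finite sum of products of values. -/
theorem ConvAlg.exists_mul_apply (a : H) : ∃ (s : Finset (H × H)),
    ∀ φ ψ : ConvAlg 𝕜 H B, (φ * ψ).ofConv a = ∑ i ∈ s, φ.ofConv i.1 * ψ.ofConv i.2 := by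
  obtain ⟨s, hs⟩ := TensorProduct.exists_finset (R := 𝕜) (Coalgebra.comul (R := 𝕜) a)
  refine ⟨s, fun φ ψ => ?_⟩
  rw [LinearMap.convMul_apply, hs]
  simp

instance [TopologicalSpace B] [IsTopologicalRing B] : IsTopologicalRing (ConvAlg 𝕜 H B) where
  continuous_mul := by
    refine ConvAlg.continuous_iff.2 fun a => ?_
    obtain ⟨s, hs⟩ := ConvAlg.exists_mul_apply (𝕜 := 𝕜) (B := B) a
    simp only [hs]
    refine continuous_finsetSum _ fun i _ => ?_
    exact ((ConvAlg.evalCLM 𝕜 B i.1).continuous.comp continuous_fst).mul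
      ((ConvAlg.evalCLM 𝕜 B i.2).continuous.comp continuous_snd)

end Convolution

/-! ### Spaces of linear maps which vanish on a subspace -/

section AnnihilatorEmbedding

variable {𝕜 : Type*} [RCLike 𝕜] {H B F E : Type*} [AddCommGroup H] [Module 𝕜 H]
  [CommRing B] [Algebra 𝕜 B] [TopologicalSpace B]
  [AddCommGroup F] [Module 𝕜 F] [TopologicalSpace F]
  [AddCommGroup E] [Module 𝕜 E] [TopologicalSpace E]

instance [PolynormableSpace 𝕜 B] : PolynormableSpace 𝕜 (ConvAlg 𝕜 H B) :=
  have : PolynormableSpace 𝕜 (H → B) := inferInstance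
  ConvAlg.isInducing_toPi.polynormableSpace

/-- The linear map `ι` identifies the topological vector space `F` with the space of all linear
maps `H → B` which vanish on the subspace `J`. -/
structure IsAnnihilatorEmbedding (ι : F →ₗ[𝕜] ConvAlg 𝕜 H B) (J : Submodule 𝕜 H) : Prop where
  isEmbedding : Topology.IsEmbedding ι
  mem_range_iff : ∀ φ, φ ∈ LinearMap.range ι ↔ ∀ a ∈ J, φ.ofConv a = 0

theorem isAnnihilatorEmbedding_id :
    IsAnnihilatorEmbedding (LinearMap.id : ConvAlg 𝕜 H B →ₗ[𝕜] ConvAlg 𝕜 H B) ⊥ :=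
  ⟨Topology.IsEmbedding.id, fun φ => by simp⟩

namespace IsAnnihilatorEmbedding

variable {ι : F →ₗ[𝕜] ConvAlg 𝕜 H B} {J : Submodule 𝕜 H} (hι : IsAnnihilatorEmbedding ι J)
include hι

theorem isClosedEmbedding [T2Space B] : Topology.IsClosedEmbedding ι := by
  refine ⟨hι.isEmbedding, ?_⟩
  have : Set.range ι = ⋂ a ∈ J, ConvAlg.evalCLM 𝕜 B a ⁻¹' {0} := by
    ext φ
    simpa using hι.mem_range_iff φ
  rw [this]
  exact isClosed_biInter fun a _ => isClosed_singleton.preimage (ConvAlg.evalCLM 𝕜 B a).continuous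

theorem isLocallyConvexTVS [T2Space B] [IsTopologicalRing B] [ContinuousSMul 𝕜 B]
    [PolynormableSpace 𝕜 B] : IsLocallyConvexTVS 𝕜 F where
  isTopologicalAddGroup := hι.isEmbedding.isInducing.topologicalAddGroup ι
  continuousSMul :=
    hι.isEmbedding.isInducing.continuousSMul continuous_id fun {c x} => map_smul ι c x
  t2 := hι.isEmbedding.t2Space
  polynormable := hι.isEmbedding.isInducing.polynormableSpace

/-- A space of linear maps `H → B` vanishing on `J` is a power of `B`, by means of a basis of
`H ⧸ J`. -/
theorem exists_coordinates [IsTopologicalRing B] [ContinuousSMul 𝕜 B] :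
    ∃ (κ : Set (H ⧸ J)) (r : κ → H) (L : (κ → B) →L[𝕜] F),
      ∀ x, L (fun i => (ι x).ofConv (r i)) = x := by
  let b := Module.Basis.ofVectorSpace 𝕜 (H ⧸ J)
  let r := fun i => Function.surjInv J.mkQ_surjective (b i)
  have hr : ∀ i, J.mkQ (r i) = b i := fun i => Function.surjInv_eq J.mkQ_surjective (b i)
  -- The linear map `H → B` with prescribed values `c` on the basis `b` of `H ⧸ J`.
  let M : (Module.Basis.ofVectorSpaceIndex 𝕜 (H ⧸ J) → B) →ₗ[𝕜] ConvAlg 𝕜 H B :=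
    { toFun := fun c => WithConv.toConv ((b.constr 𝕜 c).comp J.mkQ)
      map_add' := fun c d => by simp [LinearMap.add_comp]
      map_smul' := fun c d => by simp [LinearMap.smul_comp] }
  have hM : ∀ c, M c ∈ LinearMap.range ι := fun c => by
    rw [hι.mem_range_iff]
    intro a ha
    change b.constr 𝕜 c (J.mkQ a) = 0
    rw [(Submodule.Quotient.mk_eq_zero J).2 ha |> (fun h => (h : J.mkQ a = 0)), map_zero]
  let e := LinearEquiv.ofInjective ι hι.isEmbedding.injective
  let L := e.symm.toLinearMap.comp (M.codRestrict _ hM)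
  have hL : ∀ c, ι (L c) = M c := fun c => by
    have := congrArg Subtype.val (e.apply_symm_apply (M.codRestrict _ hM c))
    exact this
  refine ⟨_, r, ⟨L, ?_⟩, fun x => ?_⟩
  · rw [hι.isEmbedding.continuous_iff]
    refine ConvAlg.continuous_iff.2 fun a => ?_
    have : (fun c => ((ι ∘ L) c).ofConv a) =
        fun c => ∑ i ∈ (b.repr (J.mkQ a)).support, b.repr (J.mkQ a) i • c i := by
      ext c
      rw [Function.comp_apply, hL]
      exact b.constr_apply 𝕜 c (J.mkQ a)
    exact this ▸ continuous_finsetSum _ fun i _ => (continuous_apply i).const_smul _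
  · apply hι.isEmbedding.injective
    refine (hL _).trans (ConvAlg.ext_apply fun a => ?_)
    have hx : J ≤ LinearMap.ker (ι x).ofConv := (hι.mem_range_iff (ι x)).1 ⟨x, rfl⟩
    have h₁ : b.constr 𝕜 (fun i => (ι x).ofConv (r i)) = J.liftQ _ hx := by
      refine b.ext fun i => ?_
      rw [Module.Basis.constr_basis, ← hr, Submodule.mkQ_apply, Submodule.liftQ_apply]
    change b.constr 𝕜 (fun i => (ι x).ofConv (r i)) (J.mkQ a) = _
    rw [h₁, Submodule.mkQ_apply, Submodule.liftQ_apply]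

/-- A map into a space of linear maps `H → B` is analytic if all its values are continuous
polynomial maps. -/
theorem lcAnalyticOn_univ [IsTopologicalRing B] [ContinuousSMul 𝕜 B] {f : E → F}
    (hf : ∀ a, (fun x => (ι (f x)).ofConv a) ∈ polyMaps 𝕜 E B) :
    LCAnalyticOn 𝕜 f Set.univ := by
  obtain ⟨κ, r, L, hL⟩ := hι.exists_coordinates
  have := lcAnalyticOn_of_mem_polyMaps (fun i => hf (r i)) L
  simpa only [hL] using this

/-- Over the field `𝕜` itself, such a map is smooth. -/
theorem cInftyOn_univ [IsTopologicalRing B] [ContinuousSMul 𝕜 B] {f : E → F}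
    (hf : ∀ a, (fun x => (ι (f x)).ofConv a) ∈ polyMaps 𝕜 E B) :
    CInftyOn 𝕜 f Set.univ := by
  obtain ⟨κ, r, L, hL⟩ := hι.exists_coordinates
  have := (cInftyOn_pi_of_mem_polyMaps (fun i => hf (r i))).clm_comp L
  simpa only [hL] using this

/-- Evaluation at `a` on a space of linear maps `H → B`. -/
theorem eval_mem_polyMaps (a : H) : (fun x => (ι x).ofConv a) ∈ polyMaps 𝕜 F B :=
  clm_mem_polyMaps
    ((ConvAlg.evalCLM 𝕜 B a).comp (⟨ι, hι.isEmbedding.continuous⟩ : F →L[𝕜] ConvAlg 𝕜 H B))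

theorem lcAnalyticOn_id [IsTopologicalRing B] [ContinuousSMul 𝕜 B] :
    LCAnalyticOn 𝕜 (fun x : F => x) Set.univ :=
  hι.lcAnalyticOn_univ hι.eval_mem_polyMaps

end IsAnnihilatorEmbedding

end AnnihilatorEmbedding

/-! ### The filtration of `Hom (H, B)` by order of vanishing -/

theorem IsConnectedGrading.eq_span_one {𝕜 H : Type*} [Field 𝕜] [Ring H] [HopfAlgebra 𝕜 H]
    {𝓗 : ℕ → Submodule 𝕜 H} (h𝓗 : IsConnectedGrading 𝓗) : 𝓗 0 = 𝕜 ∙ (1 : H) := by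
  have hnt : Nontrivial (𝓗 0) := Module.nontrivial_of_finrank_pos (R := 𝕜) (by
    rw [h𝓗.connected]; exact one_pos)
  have : Nontrivial H := (𝓗 0).subtype_injective.nontrivial
  have h1 : (⟨1, h𝓗.one_mem⟩ : 𝓗 0) ≠ 0 := fun h => one_ne_zero (congrArg Subtype.val h)
  refine le_antisymm (fun a ha => ?_) ((Submodule.span_singleton_le_iff_mem _ _).2 h𝓗.one_mem)
  obtain ⟨c, hc⟩ := (finrank_eq_one_iff_of_nonzero' _ h1).1 h𝓗.connected ⟨a, ha⟩
  exact Submodule.mem_span_singleton.2 ⟨c, congrArg Subtype.val hc⟩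

section Filtration

variable {𝕜 H B : Type*} [RCLike 𝕜] [Ring H] [HopfAlgebra 𝕜 H] [CommRing B] [Algebra 𝕜 B]

/-- The linear maps which vanish in all degrees less than `n`. -/
def filt (B : Type*) [CommRing B] [Algebra 𝕜 B] (𝓗 : ℕ → Submodule 𝕜 H) (n : ℕ) :
    Submodule 𝕜 (ConvAlg 𝕜 H B) where
  carrier := {φ | ∀ m < n, ∀ a ∈ 𝓗 m, φ.ofConv a = 0}
  add_mem' {φ ψ} hφ hψ m hm a ha := by simp [hφ m hm a ha, hψ m hm a ha]
  zero_mem' m hm a ha := by simp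
  smul_mem' c φ hφ m hm a ha := by simp [hφ m hm a ha]

variable {𝓗 : ℕ → Submodule 𝕜 H}

theorem filt_antitone : Antitone (filt B 𝓗) :=
  fun _ _ h _ hφ m hm => hφ m (hm.trans_le h)

theorem mem_filt_zero (φ : ConvAlg 𝕜 H B) : φ ∈ filt B 𝓗 0 := fun m hm => absurd hm (by simp)

variable (h𝓗 : IsConnectedGrading 𝓗)
include h𝓗

/-- An element of `H` is killed by all linear maps of sufficiently high order of vanishing. -/
theorem IsConnectedGrading.exists_apply_eq_zero (a : H) :
    ∃ N, ∀ φ ∈ filt B 𝓗 N, φ.ofConv a = 0 := by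
  have ha : a ∈ ⨆ n, 𝓗 n := h𝓗.isInternal.submodule_iSup_eq_top ▸ Submodule.mem_top
  induction ha using Submodule.iSup_induction' with
  | mem n a ha => exact ⟨n + 1, fun φ hφ => hφ n n.lt_succ_self a ha⟩
  | zero => exact ⟨0, fun φ _ => map_zero _⟩
  | add a b _ _ ha hb =>
    obtain ⟨M, hM⟩ := ha
    obtain ⟨N, hN⟩ := hb
    refine ⟨max M N, fun φ hφ => ?_⟩
    rw [map_add, hM φ (filt_antitone (le_max_left _ _) hφ),
      hN φ (filt_antitone (le_max_right _ _) hφ), add_zero]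

theorem IsConnectedGrading.eq_of_sub_mem_filt {φ ψ : ConvAlg 𝕜 H B}
    (h : ∀ n, φ - ψ ∈ filt B 𝓗 n) : φ = ψ := by
  refine ConvAlg.ext_apply fun a => ?_
  obtain ⟨N, hN⟩ := h𝓗.exists_apply_eq_zero (B := B) a
  exact sub_eq_zero.1 (hN _ (h N))

theorem IsConnectedGrading.mul_mem_filt {i j : ℕ} {φ ψ : ConvAlg 𝕜 H B}
    (hφ : φ ∈ filt B 𝓗 i) (hψ : ψ ∈ filt B 𝓗 j) : φ * ψ ∈ filt B 𝓗 (i + j) := by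
  intro m hm a ha
  have : (⨆ p ∈ Finset.HasAntidiagonal.antidiagonal m,
      LinearMap.range (TensorProduct.map (𝓗 p.1).subtype (𝓗 p.2).subtype)) ≤
      LinearMap.ker (LinearMap.mul' 𝕜 B ∘ₗ TensorProduct.map φ.ofConv ψ.ofConv) := by
    refine iSup₂_le fun p hp => ?_
    rintro _ ⟨t, rfl⟩
    rw [LinearMap.mem_ker, LinearMap.comp_apply, ← LinearMap.comp_apply (TensorProduct.map _ _),
      ← TensorProduct.map_comp]
    replace hp := Finset.HasAntidiagonal.mem_antidiagonal.1 hp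
    rcases (by omega : p.1 < i ∨ p.2 < j) with h | h
    · have : φ.ofConv ∘ₗ (𝓗 p.1).subtype = 0 := LinearMap.ext fun x => hφ _ h x x.2
      rw [this, TensorProduct.map_zero_left, LinearMap.zero_apply, map_zero]
    · have : ψ.ofConv ∘ₗ (𝓗 p.2).subtype = 0 := LinearMap.ext fun x => hψ _ h x x.2
      rw [this, TensorProduct.map_zero_right, LinearMap.zero_apply, map_zero]
  exact this (h𝓗.comul_mem m a ha)

theorem IsConnectedGrading.pow_mem_filt {φ : ConvAlg 𝕜 H B} (hφ : φ ∈ filt B 𝓗 1) (n : ℕ) :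
    φ ^ n ∈ filt B 𝓗 n := by
  induction n with
  | zero => exact mem_filt_zero _
  | succ n ih => exact pow_succ φ n ▸ h𝓗.mul_mem_filt ih hφ

theorem IsConnectedGrading.mul_mem_filt_left {n : ℕ} {φ : ConvAlg 𝕜 H B} (ψ : ConvAlg 𝕜 H B)
    (hφ : φ ∈ filt B 𝓗 n) : ψ * φ ∈ filt B 𝓗 n := by
  simpa using h𝓗.mul_mem_filt (mem_filt_zero ψ) hφ

theorem IsConnectedGrading.mul_mem_filt_right {n : ℕ} {φ : ConvAlg 𝕜 H B} (ψ : ConvAlg 𝕜 H B)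
    (hφ : φ ∈ filt B 𝓗 n) : φ * ψ ∈ filt B 𝓗 n := by
  simpa using h𝓗.mul_mem_filt hφ (mem_filt_zero ψ)

/-- Since `𝓗 0` is spanned by the unit, `filt 1` consists of the linear maps vanishing at `1`. -/
theorem IsConnectedGrading.mem_filt_one {φ : ConvAlg 𝕜 H B} :
    φ ∈ filt B 𝓗 1 ↔ φ.ofConv 1 = 0 := by
  refine ⟨fun h => h 0 one_pos 1 h𝓗.one_mem, fun h m hm a ha => ?_⟩
  obtain rfl : m = 0 := by omega
  rw [h𝓗.eq_span_one] at ha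
  obtain ⟨c, rfl⟩ := Submodule.mem_span_singleton.1 ha
  rw [map_smul, h, smul_zero]

end Filtration

/-! ### Evaluation of power series -/

section Series

variable {𝕜 H B : Type*} [RCLike 𝕜] [Ring H] [HopfAlgebra 𝕜 H] [CommRing B] [Algebra 𝕜 B]
  [TopologicalSpace B]
  {𝓗 : ℕ → Submodule 𝕜 H} (h𝓗 : IsConnectedGrading 𝓗)
include h𝓗

/-- A series whose terms vanish to increasing order converges: at each element of `H`, only
finitely many terms are nonzero. -/
theorem IsConnectedGrading.summable {u : ℕ → ConvAlg 𝕜 H B} (hu : ∀ n, u n ∈ filt B 𝓗 n) :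
    Summable u := by
  have hfin : ∀ a, (Function.support fun n => (u n).ofConv a).Finite := fun a => by
    obtain ⟨N, hN⟩ := h𝓗.exists_apply_eq_zero (B := B) a
    refine (Set.finite_lt_nat N).subset fun n hn => ?_
    by_contra h
    exact hn (hN _ (filt_antitone (not_lt.1 h) (hu n)))
  let s : H →ₗ[𝕜] B :=
    { toFun := fun a => ∑ᶠ n, (u n).ofConv a
      map_add' := fun a b => by
        simp only [map_add]
        exact finsum_add_distrib (hfin a) (hfin b)
      map_smul' := fun c a => by
        simp only [map_smul, RingHom.id_apply]
        exact (smul_finsum' c (hfin a)).symm }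
  refine ⟨WithConv.toConv s, ConvAlg.hasSum_iff.2 fun a => ?_⟩
  have := hasSum_sum_of_ne_finset_zero (L := .unconditional ℕ) (f := fun n => (u n).ofConv a)
    (s := (hfin a).toFinset) (fun n hn => by simpa using hn)
  rwa [← finsum_eq_sum _ (hfin a)] at this

variable [T2Space B]

theorem IsConnectedGrading.tsum_apply {u : ℕ → ConvAlg 𝕜 H B} (hu : ∀ n, u n ∈ filt B 𝓗 n)
    {a : H} {N : ℕ} (hN : ∀ φ ∈ filt B 𝓗 N, φ.ofConv a = 0) :
    (∑' n, u n).ofConv a = ∑ n ∈ Finset.range N, (u n).ofConv a := by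
  have h₁ := ConvAlg.hasSum_iff.1 ((h𝓗.summable hu : Summable u).hasSum) a
  refine h₁.unique (hasSum_sum_of_ne_finset_zero fun n hn => ?_)
  rw [Finset.mem_range, not_lt] at hn
  exact hN _ (filt_antitone hn (hu n))

theorem IsConnectedGrading.tsum_sub_sum_mem {u : ℕ → ConvAlg 𝕜 H B}
    (hu : ∀ n, u n ∈ filt B 𝓗 n) (N : ℕ) :
    ∑' n, u n - ∑ n ∈ Finset.range N, u n ∈ filt B 𝓗 N := by
  intro m hm a ha
  rw [WithConv.ofConv_sub, LinearMap.sub_apply,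
    h𝓗.tsum_apply hu (N := N) (fun φ hφ => hφ m hm a ha)]
  simp

omit h𝓗 [T2Space B] in
/-- The value `∑ f_n X^n` of the power series `f = ∑ f_n T^n` at the linear map `X`, with respect
to the convolution product. (The series converges if `X 1 = 0`. A divergent series has the junk
value `0`, which never occurs below.) -/
def seriesEval (f : PowerSeries 𝕜) (X : ConvAlg 𝕜 H B) : ConvAlg 𝕜 H B :=
  ∑' n, PowerSeries.coeff n f • X ^ n

variable {X : ConvAlg 𝕜 H B} (hX : X ∈ filt B 𝓗 1)
include hX

omit [TopologicalSpace B] [T2Space B] in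
theorem IsConnectedGrading.term_mem_filt (f : PowerSeries 𝕜) (n : ℕ) :
    PowerSeries.coeff n f • X ^ n ∈ filt B 𝓗 n :=
  Submodule.smul_mem _ _ (h𝓗.pow_mem_filt hX n)

omit [T2Space B] in
theorem IsConnectedGrading.hasSum_seriesEval (f : PowerSeries 𝕜) :
    HasSum (fun n => PowerSeries.coeff n f • X ^ n) (seriesEval f X) :=
  (h𝓗.summable (h𝓗.term_mem_filt hX f)).hasSum

theorem IsConnectedGrading.seriesEval_apply (f : PowerSeries 𝕜) {a : H} {N : ℕ}
    (hN : ∀ φ ∈ filt B 𝓗 N, φ.ofConv a = 0) :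
    (seriesEval f X).ofConv a =
      ∑ n ∈ Finset.range N, PowerSeries.coeff n f • (X ^ n).ofConv a :=
  h𝓗.tsum_apply (h𝓗.term_mem_filt hX f) hN

theorem IsConnectedGrading.seriesEval_sub_trunc_mem (f : PowerSeries 𝕜) (N : ℕ) :
    seriesEval f X - Polynomial.aeval X (PowerSeries.trunc N f) ∈ filt B 𝓗 N := by
  have h : Polynomial.aeval X (PowerSeries.trunc N f) =
      ∑ n ∈ Finset.range N, PowerSeries.coeff n f • X ^ n := by
    rw [PowerSeries.trunc_apply, map_sum, Nat.Ico_zero_eq_range]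
    simp [Polynomial.aeval_monomial, Algebra.smul_def]
  rw [h]
  exact h𝓗.tsum_sub_sum_mem (h𝓗.term_mem_filt hX f) N

omit [TopologicalSpace B] [T2Space B] in
theorem IsConnectedGrading.aeval_mem_filt {p : Polynomial 𝕜} {N : ℕ}
    (hp : ∀ n < N, p.coeff n = 0) : Polynomial.aeval X p ∈ filt B 𝓗 N := by
  obtain ⟨q, rfl⟩ := Polynomial.X_pow_dvd_iff.2 hp
  rw [map_mul, map_pow, Polynomial.aeval_X]
  exact h𝓗.mul_mem_filt_right _ (h𝓗.pow_mem_filt hX N)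

theorem IsConnectedGrading.seriesEval_coe (p : Polynomial 𝕜) :
    seriesEval (p : PowerSeries 𝕜) X = Polynomial.aeval X p := by
  refine h𝓗.eq_of_sub_mem_filt fun N => ?_
  have h := add_mem (h𝓗.seriesEval_sub_trunc_mem hX p N)
    (h𝓗.aeval_mem_filt hX (p := PowerSeries.trunc N (p : PowerSeries 𝕜) - p) (N := N)
      fun n hn => by simp [PowerSeries.coeff_trunc, hn])
  simpa using h

theorem IsConnectedGrading.seriesEval_one : seriesEval (1 : PowerSeries 𝕜) X = 1 := by
  have := h𝓗.seriesEval_coe hX 1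
  simpa using this

theorem IsConnectedGrading.seriesEval_X : seriesEval (PowerSeries.X : PowerSeries 𝕜) X = X := by
  have := h𝓗.seriesEval_coe hX Polynomial.X
  simpa using this

theorem IsConnectedGrading.seriesEval_add [IsTopologicalRing B] (f g : PowerSeries 𝕜) :
    seriesEval (f + g) X = seriesEval f X + seriesEval g X := by
  refine (h𝓗.hasSum_seriesEval hX (f + g)).unique ?_
  simpa only [map_add, add_smul] using
    (h𝓗.hasSum_seriesEval hX f).add (h𝓗.hasSum_seriesEval hX g)

theorem IsConnectedGrading.seriesEval_mul (f g : PowerSeries 𝕜) :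
    seriesEval (f * g) X = seriesEval f X * seriesEval g X := by
  refine h𝓗.eq_of_sub_mem_filt fun N => ?_
  have hf := h𝓗.seriesEval_sub_trunc_mem hX f N
  have hg := h𝓗.seriesEval_sub_trunc_mem hX g N
  have hfg := h𝓗.seriesEval_sub_trunc_mem hX (f * g) N
  have hp := h𝓗.aeval_mem_filt hX (N := N)
    (p := PowerSeries.trunc N (f * g) - PowerSeries.trunc N f * PowerSeries.trunc N g)
    fun n hn => by
      rw [Polynomial.coeff_sub, PowerSeries.coeff_trunc, if_pos hn,
        PowerSeries.coeff_mul_eq_coeff_trunc_mul_trunc f g hn, ← Polynomial.coe_mul,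
        Polynomial.coeff_coe, sub_self]
  rw [map_sub, map_mul (Polynomial.aeval X)] at hp
  have key := sub_mem (add_mem hfg hp)
    (add_mem (h𝓗.mul_mem_filt_right (seriesEval g X) hf)
      (h𝓗.mul_mem_filt_left (Polynomial.aeval X (PowerSeries.trunc N f)) hg))
  convert key using 1
  noncomm_ring

theorem IsConnectedGrading.seriesEval_pow (f : PowerSeries 𝕜) (k : ℕ) :
    seriesEval (f ^ k) X = seriesEval f X ^ k := by
  induction k with
  | zero => simpa using h𝓗.seriesEval_one hX
  | succ k ih => rw [pow_succ, h𝓗.seriesEval_mul hX, ih, pow_succ]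

theorem IsConnectedGrading.seriesEval_smul [IsTopologicalRing B] [ContinuousSMul 𝕜 B] (c : 𝕜)
    (f : PowerSeries 𝕜) : seriesEval (c • f) X = c • seriesEval f X := by
  refine (h𝓗.hasSum_seriesEval hX (c • f)).unique ?_
  simpa only [map_smul, smul_assoc] using (h𝓗.hasSum_seriesEval hX f).const_smul c

theorem IsConnectedGrading.seriesEval_aeval [IsTopologicalRing B] [ContinuousSMul 𝕜 B]
    (g : PowerSeries 𝕜) (p : Polynomial 𝕜) :
    seriesEval (Polynomial.aeval g p) X = Polynomial.aeval (seriesEval g X) p := by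
  induction p using Polynomial.induction_on' with
  | add p q hp hq => rw [map_add, map_add, h𝓗.seriesEval_add hX, hp, hq]
  | monomial n c =>
    rw [Polynomial.aeval_monomial, Polynomial.aeval_monomial, ← Algebra.smul_def,
      ← Algebra.smul_def, h𝓗.seriesEval_smul hX, h𝓗.seriesEval_pow hX]

theorem IsConnectedGrading.seriesEval_mem_filt {f : PowerSeries 𝕜} {N : ℕ}
    (hf : PowerSeries.X ^ N ∣ f) : seriesEval f X ∈ filt B 𝓗 N := by
  obtain ⟨g, rfl⟩ := hf
  rw [h𝓗.seriesEval_mul hX, h𝓗.seriesEval_pow hX, h𝓗.seriesEval_X hX]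
  exact h𝓗.mul_mem_filt_right _ (h𝓗.pow_mem_filt hX N)

/-- Evaluation of power series is compatible with substitution. -/
theorem IsConnectedGrading.seriesEval_subst [IsTopologicalRing B] [ContinuousSMul 𝕜 B]
    (f : PowerSeries 𝕜) {g : PowerSeries 𝕜} (hg : PowerSeries.constantCoeff g = 0) :
    seriesEval (f.subst g) X = seriesEval f (seriesEval g X) := by
  have hs : PowerSeries.HasSubst g := PowerSeries.HasSubst.of_constantCoeff_zero' hg
  have hgX : seriesEval g X ∈ filt B 𝓗 1 := by
    refine h𝓗.seriesEval_mem_filt hX ?_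
    rw [pow_one]
    exact PowerSeries.X_dvd_iff.2 hg
  refine h𝓗.eq_of_sub_mem_filt fun N => ?_
  have h₁ := h𝓗.seriesEval_sub_trunc_mem hgX f N
  obtain ⟨h, hh⟩ : PowerSeries.X ^ N ∣ f - (PowerSeries.trunc N f : PowerSeries 𝕜) := by
    rw [PowerSeries.X_pow_dvd_iff]
    intro n hn
    simp [PowerSeries.coeff_trunc, hn]
  have h₂ : f.subst g = Polynomial.aeval g (PowerSeries.trunc N f) + g ^ N * h.subst g := by
    rw [sub_eq_iff_eq_add'] at hh
    conv_lhs => rw [hh]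
    rw [PowerSeries.subst_add hs, PowerSeries.subst_mul hs, PowerSeries.subst_pow hs,
      PowerSeries.subst_X hs, PowerSeries.subst_coe hs]
  have h₃ : seriesEval (g ^ N * h.subst g) X ∈ filt B 𝓗 N :=
    h𝓗.seriesEval_mem_filt hX
      (Dvd.dvd.mul_right (pow_dvd_pow_of_dvd (PowerSeries.X_dvd_iff.2 hg) N) _)
  rw [h₂, h𝓗.seriesEval_add hX, h𝓗.seriesEval_aeval hX]
  convert sub_mem h₃ h₁ using 1
  abel

end Series

/-! ### The power series of the exponential function and the logarithm -/

section ExpLog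

open PowerSeries in
/-- `log (1 + (exp T - 1)) = T`, as both sides have derivative `1` and no constant term. -/
theorem log_subst_exp_sub_one {𝕜 : Type*} [Field 𝕜] [CharZero 𝕜] :
    (PowerSeries.log 𝕜).subst (PowerSeries.exp 𝕜 - 1) = PowerSeries.X := by
  have hs : HasSubst (exp 𝕜 - 1) := HasSubst.exp_sub_one
  refine derivative.ext ?_ ?_
  · rw [derivative_subst hs, deriv_log, map_sub, derivative_exp, derivative_one, sub_zero,
      derivative_X]
    -- The derivative of the logarithm series is the inverse of `1 + T`.
    have h : (1 + X : PowerSeries 𝕜) * mk (fun n => algebraMap ℚ 𝕜 ((-1 : ℚ) ^ n)) = 1 := by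
      ext n
      cases n with
      | zero => simp [add_mul]
      | succ n => simp [add_mul, coeff_succ_X_mul, pow_succ, coeff_one]
    have h' := congrArg (fun f => PowerSeries.subst (exp 𝕜 - 1) f) h
    simp only [subst_mul hs, subst_add hs, subst_X hs] at h'
    have h1 : (1 : PowerSeries 𝕜).subst (exp 𝕜 - 1) = 1 := by
      rw [← coe_substAlgHom hs, map_one]
    rw [h1, add_sub_cancel, mul_comm] at h'
    exact h'
  · rw [constantCoeff_X]
    exact constantCoeff_subst_eq_zero (by
      change constantCoeff (exp 𝕜 - 1) = 0
      simp) _ constantCoeff_log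

open PowerSeries in
/-- The series `log (1 + T)`, being a left inverse of `exp T - 1` under substitution, is the
inverse, and thus also a right inverse. -/
theorem exp_sub_one_subst_log {𝕜 : Type*} [Field 𝕜] [CharZero 𝕜] :
    (PowerSeries.exp 𝕜 - 1).subst (PowerSeries.log 𝕜) = PowerSeries.X := by
  set g := exp 𝕜 - 1
  have hg0 : constantCoeff g = 0 := by simp [g]
  have hg1 : IsUnit (coeff 1 g) := by simp [g, coeff_exp, coeff_one]
  have hs : HasSubst g := HasSubst.exp_sub_one
  have hinv : HasSubst (g.substInvOfIsUnit hg1) := HasSubst.substInvOfIsUnit _ hg1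
  have hr : g.subst (g.substInvOfIsUnit hg1) = X := subst_substInvOfIsUnit_right _ hg0 hg1
  have hl : PowerSeries.log 𝕜 = g.substInvOfIsUnit hg1 := by
    have h := subst_comp_subst_apply hs hinv (PowerSeries.log 𝕜)
    rw [log_subst_exp_sub_one, hr, subst_X hinv, X_subst] at h
    exact h.symm
  rw [hl, hr]

end ExpLog

/-! ### Powers of infinitesimal characters on products -/

section Product

variable {𝕜 H B : Type*} [Field 𝕜] [Ring H] [HopfAlgebra 𝕜 H] [CommRing B] [Algebra 𝕜 B]

/-- The linear map `a ⊗ b ↦ f a * g b`. -/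
def boxMul (f g : ConvAlg 𝕜 H B) : ConvAlg 𝕜 (H ⊗[𝕜] H) B :=
  WithConv.toConv (LinearMap.mul' 𝕜 B ∘ₗ TensorProduct.map f.ofConv g.ofConv)

theorem boxMul_apply (f g : ConvAlg 𝕜 H B) (a b : H) :
    (boxMul f g).ofConv (a ⊗ₜ b) = f.ofConv a * g.ofConv b := rfl

/-- As `B` is commutative, `boxMul` is multiplicative for the convolution products. -/
theorem boxMul_mul_boxMul (f g f' g' : ConvAlg 𝕜 H B) :
    boxMul f g * boxMul f' g' = boxMul (f * f') (g * g') := by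
  apply WithConv.ofConv_injective
  have h := LinearMap.algHom_comp_convMul_distrib (Algebra.TensorProduct.lmul' 𝕜 (S := B))
    (WithConv.toConv (TensorProduct.map f.ofConv g.ofConv))
    (WithConv.toConv (TensorProduct.map f'.ofConv g'.ofConv))
  rw [TensorProduct.map_convMul_map] at h
  exact h.symm

theorem boxMul_one_one : boxMul (1 : ConvAlg 𝕜 H B) 1 = 1 := by
  apply WithConv.ofConv_injective
  ext a b
  simp [boxMul, mul_comm]

theorem boxMul_pow (f g : ConvAlg 𝕜 H B) (n : ℕ) : boxMul f g ^ n = boxMul (f ^ n) (g ^ n) := by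
  induction n with
  | zero => simp only [pow_zero, boxMul_one_one]
  | succ n ih => rw [pow_succ, ih, boxMul_mul_boxMul, ← pow_succ, ← pow_succ]

/-- The linear map `a ⊗ b ↦ f (a * b)`. -/
def precompMul (f : ConvAlg 𝕜 H B) : ConvAlg 𝕜 (H ⊗[𝕜] H) B :=
  WithConv.toConv (f.ofConv ∘ₗ LinearMap.mul' 𝕜 H)

theorem precompMul_apply (f : ConvAlg 𝕜 H B) (a b : H) :
    (precompMul f).ofConv (a ⊗ₜ b) = f.ofConv (a * b) := rfl

theorem precompMul_pow (f : ConvAlg 𝕜 H B) (n : ℕ) : precompMul (f ^ n) = precompMul f ^ n := by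
  induction n with
  | zero =>
    apply WithConv.ofConv_injective
    ext a b
    simp [precompMul, mul_comm]
  | succ n ih =>
    rw [pow_succ, pow_succ, ← ih]
    apply WithConv.ofConv_injective
    exact LinearMap.convMul_comp_coalgHom_distrib (f ^ n) f (Bialgebra.mulCoalgHom 𝕜 H)

theorem mem_infChar_iff {φ : ConvAlg 𝕜 H B} : φ ∈ InfChar 𝕜 H B ↔ ∀ a b : H, φ.ofConv (a * b) =
    Coalgebra.counit (R := 𝕜) b • φ.ofConv a + Coalgebra.counit (R := 𝕜) a • φ.ofConv b := Iff.rfl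

theorem apply_one_of_mem_infChar {φ : ConvAlg 𝕜 H B} (hφ : φ ∈ InfChar 𝕜 H B) :
    φ.ofConv 1 = 0 := by
  simpa using hφ 1 1

/-- The Leibniz rule for the powers of an infinitesimal character. -/
theorem pow_apply_mul_of_mem_infChar {φ : ConvAlg 𝕜 H B} (hφ : φ ∈ InfChar 𝕜 H B) (n : ℕ)
    (a b : H) : (φ ^ n).ofConv (a * b) = ∑ m ∈ Finset.HasAntidiagonal.antidiagonal n,
      n.choose m.1 • ((φ ^ m.1).ofConv a * (φ ^ m.2).ofConv b) := by
  have h : precompMul φ = boxMul φ 1 + boxMul 1 φ := by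
    apply WithConv.ofConv_injective
    ext a b
    simp only [TensorProduct.AlgebraTensorModule.curry_apply, LinearMap.restrictScalars_self,
      TensorProduct.curry_apply, precompMul_apply, WithConv.ofConv_add, LinearMap.add_apply,
      boxMul_apply, LinearMap.convOne_apply, hφ a b, Algebra.smul_def]
    ring
  have hc : Commute (boxMul φ 1) (boxMul 1 φ) := by
    rw [Commute, SemiconjBy, boxMul_mul_boxMul, boxMul_mul_boxMul, mul_one, one_mul]
  rw [← precompMul_apply, precompMul_pow, h, hc.add_pow', WithConv.ofConv_sum,
    LinearMap.sum_apply]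
  refine Finset.sum_congr rfl fun m _ => ?_
  rw [boxMul_pow, boxMul_pow, boxMul_mul_boxMul, one_pow, one_pow, one_mul, mul_one,
    WithConv.ofConv_smul, LinearMap.smul_apply, boxMul_apply]

end Product

/-! ### The exponential function and the logarithm of the convolution product -/

/-- A polynomial with coefficients in a `𝕜`-algebra which vanishes at all natural numbers is
zero. -/
theorem polynomial_eq_zero_of_eval_natCast {𝕜 B : Type*} [Field 𝕜] [CharZero 𝕜] [CommRing B]
    [Algebra 𝕜 B] (p : Polynomial B) (hp : ∀ k : ℕ, p.eval (k : B) = 0) : p = 0 := by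
  ext n
  rw [Polynomial.coeff_zero, ← Module.forall_dual_apply_eq_zero_iff 𝕜]
  intro l
  -- Apply the linear functional `l` to the coefficients, to get a polynomial over a field.
  let q : Polynomial 𝕜 := ∑ i ∈ Finset.range (p.natDegree + 1 + n),
    Polynomial.monomial i (l (p.coeff i))
  have hq : q = 0 := by
    refine Polynomial.eq_zero_of_infinite_isRoot q
      ((Set.infinite_range_of_injective (Nat.cast_injective (R := 𝕜))).mono ?_)
    rintro _ ⟨k, rfl⟩
    have h := congrArg l (hp k)
    rw [Polynomial.eval_eq_sum_range' (n := p.natDegree + 1 + n) (by omega), map_zero,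
      map_sum] at h
    change q.eval (k : 𝕜) = 0
    rw [Polynomial.eval_finsetSum, ← h]
    refine Finset.sum_congr rfl fun i _ => ?_
    have : p.coeff i * (k : B) ^ i = ((k : 𝕜) ^ i) • p.coeff i := by
      rw [Algebra.smul_def, mul_comm]; simp
    rw [this, map_smul, Polynomial.eval_monomial, smul_eq_mul, mul_comm]
  have h := congrArg (fun r => Polynomial.coeff r n) hq
  have hn : n < p.natDegree + 1 + n := by omega
  simpa [q, Polynomial.coeff_monomial, hn] using h

section ExpLog

variable {𝕜 H B : Type*} [RCLike 𝕜] [Ring H] [HopfAlgebra 𝕜 H] [CommRing B] [Algebra 𝕜 B]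
  [TopologicalSpace B]

/-- The exponential series with respect to the convolution product. -/
def convExp (X : ConvAlg 𝕜 H B) : ConvAlg 𝕜 H B := seriesEval (PowerSeries.exp 𝕜) X

/-- The logarithm series `∑ (-1)^(n + 1) (Y - 1)^n / n` with respect to the convolution product. -/
def convLog (Y : ConvAlg 𝕜 H B) : ConvAlg 𝕜 H B := seriesEval (PowerSeries.log 𝕜) (Y - 1)

theorem coeff_exp_eq (n : ℕ) : PowerSeries.coeff n (PowerSeries.exp 𝕜) = (n.factorial : 𝕜)⁻¹ := by
  simp [PowerSeries.coeff_exp]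

theorem convExp_smul (c : 𝕜) (X : ConvAlg 𝕜 H B) :
    convExp (c • X) = seriesEval (PowerSeries.rescale c (PowerSeries.exp 𝕜)) X := by
  unfold convExp seriesEval
  refine tsum_congr fun n => ?_
  rw [smul_pow, smul_smul, PowerSeries.coeff_rescale, mul_comm]

variable {𝓗 : ℕ → Submodule 𝕜 H} (h𝓗 : IsConnectedGrading 𝓗) [T2Space B]
include h𝓗

theorem IsConnectedGrading.convExp_apply {X : ConvAlg 𝕜 H B} (hX : X ∈ filt B 𝓗 1) {a : H} {N : ℕ}
    (hN : ∀ φ ∈ filt B 𝓗 N, φ.ofConv a = 0) :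
    (convExp X).ofConv a = ∑ n ∈ Finset.range N, (n.factorial : 𝕜)⁻¹ • (X ^ n).ofConv a := by
  simp only [convExp, h𝓗.seriesEval_apply hX _ hN, coeff_exp_eq]

omit [T2Space B] in
theorem IsConnectedGrading.hasSum_convExp {X : ConvAlg 𝕜 H B} (hX : X ∈ filt B 𝓗 1) :
    HasSum (fun n : ℕ => (n.factorial : 𝕜)⁻¹ • X ^ n) (convExp X) := by
  have h := h𝓗.hasSum_seriesEval hX (PowerSeries.exp 𝕜)
  simp only [coeff_exp_eq] at h
  exact h

theorem IsConnectedGrading.convExp_add_smul {X : ConvAlg 𝕜 H B} (hX : X ∈ filt B 𝓗 1) (s t : 𝕜) :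
    convExp ((s + t) • X) = convExp (s • X) * convExp (t • X) := by
  rw [convExp_smul, convExp_smul, convExp_smul, ← PowerSeries.exp_mul_exp_eq_exp_add,
    h𝓗.seriesEval_mul hX]

theorem IsConnectedGrading.convExp_natCast_smul {X : ConvAlg 𝕜 H B} (hX : X ∈ filt B 𝓗 1) (k : ℕ) :
    convExp ((k : 𝕜) • X) = convExp X ^ k := by
  rw [convExp_smul, ← PowerSeries.exp_pow_eq_rescale_exp, h𝓗.seriesEval_pow hX, convExp]

/-- The value of `exp (c X)` at `a` is a polynomial in `c`. -/
theorem IsConnectedGrading.exists_polynomial {X : ConvAlg 𝕜 H B} (hX : X ∈ filt B 𝓗 1) (a : H) :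
    ∃ p : Polynomial B, (∀ n, p.coeff n = (n.factorial : 𝕜)⁻¹ • (X ^ n).ofConv a) ∧
      ∀ c : 𝕜, p.eval (algebraMap 𝕜 B c) = (convExp (c • X)).ofConv a := by
  obtain ⟨N, hN⟩ := h𝓗.exists_apply_eq_zero (B := B) a
  refine ⟨∑ n ∈ Finset.range N,
    Polynomial.monomial n ((n.factorial : 𝕜)⁻¹ • (X ^ n).ofConv a), fun n => ?_, fun c => ?_⟩
  · simp only [Polynomial.finsetSum_coeff, Polynomial.coeff_monomial, Finset.sum_ite_eq',
      Finset.mem_range]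
    split_ifs with h
    · rfl
    · rw [hN _ (filt_antitone (not_lt.1 h) (h𝓗.pow_mem_filt hX n)), smul_zero]
  · rw [h𝓗.convExp_apply (Submodule.smul_mem _ c hX) hN, Polynomial.eval_finsetSum]
    refine Finset.sum_congr rfl fun n _ => ?_
    rw [Polynomial.eval_monomial, smul_pow, WithConv.ofConv_smul, LinearMap.smul_apply,
      smul_mul_assoc, ← map_pow, mul_comm, ← Algebra.smul_def]

theorem IsConnectedGrading.convExp_apply_one {X : ConvAlg 𝕜 H B} (hX : X ∈ filt B 𝓗 1) :
    (convExp X).ofConv 1 = 1 := by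
  have hN : ∀ φ ∈ filt B 𝓗 1, φ.ofConv 1 = 0 := fun φ hφ => h𝓗.mem_filt_one.1 hφ
  rw [h𝓗.convExp_apply hX hN]
  simp

theorem IsConnectedGrading.convExp_sub_one_mem {X : ConvAlg 𝕜 H B} (hX : X ∈ filt B 𝓗 1) :
    convExp X - 1 ∈ filt B 𝓗 1 := by
  rw [h𝓗.mem_filt_one]
  simp [h𝓗.convExp_apply_one hX]

theorem IsConnectedGrading.convLog_mem {Y : ConvAlg 𝕜 H B} (hY : Y - 1 ∈ filt B 𝓗 1) :
    convLog Y ∈ filt B 𝓗 1 := by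
  refine h𝓗.seriesEval_mem_filt hY ?_
  rw [pow_one, PowerSeries.X_dvd_iff, PowerSeries.constantCoeff_log]

section

variable [IsTopologicalRing B]

theorem IsConnectedGrading.convExp_eq_one_add {X : ConvAlg 𝕜 H B} (hX : X ∈ filt B 𝓗 1) :
    convExp X = 1 + seriesEval (PowerSeries.exp 𝕜 - 1) X := by
  rw [← h𝓗.seriesEval_one hX, ← h𝓗.seriesEval_add hX, add_sub_cancel, convExp]

variable [ContinuousSMul 𝕜 B]

theorem IsConnectedGrading.convLog_convExp {X : ConvAlg 𝕜 H B} (hX : X ∈ filt B 𝓗 1) :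
    convLog (convExp X) = X := by
  rw [convLog, h𝓗.convExp_eq_one_add hX, add_sub_cancel_left,
    ← h𝓗.seriesEval_subst hX _ (by simp), log_subst_exp_sub_one, h𝓗.seriesEval_X hX]

theorem IsConnectedGrading.convExp_convLog {Y : ConvAlg 𝕜 H B} (hY : Y - 1 ∈ filt B 𝓗 1) :
    convExp (convLog Y) = Y := by
  rw [h𝓗.convExp_eq_one_add (h𝓗.convLog_mem hY), convLog,
    ← h𝓗.seriesEval_subst hY _ PowerSeries.constantCoeff_log, exp_sub_one_subst_log,
    h𝓗.seriesEval_X hY, add_sub_cancel]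

end

omit [TopologicalSpace B] [T2Space B] in
theorem IsConnectedGrading.mem_filt_one_of_mem_infChar {φ : ConvAlg 𝕜 H B}
    (hφ : φ ∈ InfChar 𝕜 H B) : φ ∈ filt B 𝓗 1 :=
  h𝓗.mem_filt_one.2 (apply_one_of_mem_infChar hφ)

/-- The exponential of an infinitesimal character is multiplicative: by the Leibniz rule, the
polynomials `c ↦ (exp (c φ)) (a b)` and `c ↦ (exp (c φ)) a * (exp (c φ)) b` have the same
coefficients. -/
theorem IsConnectedGrading.convExp_apply_mul {φ : ConvAlg 𝕜 H B} (hφ : φ ∈ InfChar 𝕜 H B)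
    (a b : H) : (convExp φ).ofConv (a * b) = (convExp φ).ofConv a * (convExp φ).ofConv b := by
  have hX := h𝓗.mem_filt_one_of_mem_infChar hφ
  obtain ⟨p, hp, hp'⟩ := h𝓗.exists_polynomial hX a
  obtain ⟨q, hq, hq'⟩ := h𝓗.exists_polynomial hX b
  obtain ⟨r, hr, hr'⟩ := h𝓗.exists_polynomial hX (a * b)
  have h : r = p * q := by
    ext n
    rw [hr, Polynomial.coeff_mul, pow_apply_mul_of_mem_infChar hφ, Finset.smul_sum]
    refine Finset.sum_congr rfl fun m hm => ?_
    rw [hp, hq, smul_mul_smul_comm, ← Nat.cast_smul_eq_nsmul 𝕜, smul_smul]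
    congr 1
    have hmn : m.1 + m.2 = n := Finset.HasAntidiagonal.mem_antidiagonal.1 hm
    have hfac : (n.choose m.1 : 𝕜) * m.1.factorial * m.2.factorial = n.factorial := by
      rw [← hmn, Nat.choose_symm_add]
      exact_mod_cast Nat.add_choose_mul_factorial_mul_factorial m.1 m.2
    have h₁ : (m.1.factorial : 𝕜) ≠ 0 := Nat.cast_ne_zero.2 m.1.factorial_ne_zero
    have h₂ : (m.2.factorial : 𝕜) ≠ 0 := Nat.cast_ne_zero.2 m.2.factorial_ne_zero
    have h₃ : (n.factorial : 𝕜) ≠ 0 := Nat.cast_ne_zero.2 n.factorial_ne_zero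
    field_simp
    rw [← hfac]
  have h1 := hr' 1
  rwa [h, Polynomial.eval_mul, hp', hq', one_smul, eq_comm] at h1

/-- If the exponential of `φ` is a character, then `φ` is an infinitesimal character: compare the
linear terms of the polynomials `k ↦ (exp (k φ)) (a b)` and `k ↦ exp (k φ) a * exp (k φ) b`. -/
theorem IsConnectedGrading.mem_infChar_of_convExp {φ : ConvAlg 𝕜 H B} (hφ : φ ∈ filt B 𝓗 1)
    (χ : CharGroup 𝕜 H B) (h : convExp φ = χ.toHom) : φ ∈ InfChar 𝕜 H B := by
  intro a b
  obtain ⟨p, hp, hp'⟩ := h𝓗.exists_polynomial hφ a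
  obtain ⟨q, hq, hq'⟩ := h𝓗.exists_polynomial hφ b
  obtain ⟨r, hr, hr'⟩ := h𝓗.exists_polynomial hφ (a * b)
  have key : ∀ k : ℕ, convExp ((k : 𝕜) • φ) = (χ ^ k).toHom := fun k => by
    rw [h𝓗.convExp_natCast_smul hφ, h]
    induction k with
    | zero => rw [pow_zero, pow_zero, CharGroup.toHom_one]
    | succ k ih => rw [pow_succ, ih, ← CharGroup.toHom_mul, pow_succ]
  have hrpq : r - p * q = 0 := by
    refine polynomial_eq_zero_of_eval_natCast (𝕜 := 𝕜) _ fun k => ?_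
    have hk : (k : B) = algebraMap 𝕜 B (k : 𝕜) := by simp
    rw [Polynomial.eval_sub, Polynomial.eval_mul, hk, hp', hq', hr', key, sub_eq_zero]
    exact map_mul (χ ^ k).ofConv a b
  have h1 := congrArg (fun s => Polynomial.coeff s 1) (sub_eq_zero.1 hrpq)
  simp only [Polynomial.mul_coeff_one, hr, hp, hq] at h1
  simpa [Algebra.smul_def, mul_comm, add_comm] using h1

end ExpLog

/-! ### Manifolds with a single global chart -/

section GlobalChart

variable {𝕜 : Type*} [RCLike 𝕜] {E F M N G : Type*}
  [AddCommGroup E] [Module 𝕜 E] [TopologicalSpace E]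
  [AddCommGroup F] [Module 𝕜 F] [TopologicalSpace F]
  [TopologicalSpace M] [TopologicalSpace N]

/-- The atlas of `M` consists of the single chart `Λ`, which is defined on the whole of `M` and
onto the whole model space. -/
structure IsGlobalChart {F M : Type*} [TopologicalSpace F] [TopologicalSpace M] [ChartedSpace F M]
    (Λ : M ≃ₜ F) : Prop where
  atlas_eq : atlas F M = {Λ.toOpenPartialHomeomorph}
  chartAt_eq : ∀ x, chartAt F x = Λ.toOpenPartialHomeomorph

theorem isGlobalChart_refl (F : Type*) [TopologicalSpace F] :
    IsGlobalChart (Homeomorph.refl F) := by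
  refine ⟨?_, fun x => ?_⟩
  · rw [Homeomorph.refl_toOpenPartialHomeomorph]
    rfl
  · rw [chartAt_self_eq, Homeomorph.refl_toOpenPartialHomeomorph]

/-- The manifold structure given by a single global chart. -/
abbrev globalChart {F M : Type*} [TopologicalSpace F] [TopologicalSpace M] (Λ : M ≃ₜ F) :
    ChartedSpace F M :=
  Λ.toOpenPartialHomeomorph.singletonChartedSpace rfl

theorem isGlobalChart_globalChart {F M : Type*} [TopologicalSpace F] [TopologicalSpace M]
    (Λ : M ≃ₜ F) : @IsGlobalChart F M _ _ (globalChart Λ) Λ :=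
  letI := globalChart Λ
  ⟨rfl, fun _ => rfl⟩

variable [ChartedSpace E M] [ChartedSpace F N] {Λ : M ≃ₜ E} {Λ' : N ≃ₜ F}

theorem IsGlobalChart.isAnalyticMap (hΛ : IsGlobalChart Λ) (hΛ' : IsGlobalChart Λ') {f : M → N}
    (hf : LCAnalyticOn 𝕜 (fun x => Λ' (f (Λ.symm x))) Set.univ) : IsAnalyticMap 𝕜 E F f := by
  intro e he e' he'
  rw [hΛ.atlas_eq, Set.mem_singleton_iff] at he
  rw [hΛ'.atlas_eq, Set.mem_singleton_iff] at he'
  subst he he'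
  convert hf using 1 <;>
    (ext x; simp)

theorem IsGlobalChart.mem_analyticMaximalAtlas (hΛ : IsGlobalChart Λ) {Φ : M ≃ₜ E}
    (h₁ : LCAnalyticOn 𝕜 (fun x => Λ (Φ.symm x)) Set.univ)
    (h₂ : LCAnalyticOn 𝕜 (fun x => Φ (Λ.symm x)) Set.univ) :
    Φ.toOpenPartialHomeomorph ∈ analyticMaximalAtlas 𝕜 E M := by
  intro e he
  rw [hΛ.atlas_eq, Set.mem_singleton_iff] at he
  subst he
  constructor
  · convert h₁ using 1 <;>
      (ext x; simp)
  · convert h₂ using 1 <;>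
      (ext x; simp)

theorem IsGlobalChart.isAnalyticManifold (hΛ : IsGlobalChart Λ) (hE : IsLocallyConvexTVS 𝕜 E)
    (hid : LCAnalyticOn 𝕜 (fun x : E => x) Set.univ) : IsAnalyticManifold 𝕜 E M where
  model := hE
  t2 := by
    have := hE.t2
    exact Λ.symm.t2Space
  compatible e he := by
    rw [hΛ.atlas_eq, Set.mem_singleton_iff] at he
    subst he
    exact hΛ.mem_analyticMaximalAtlas (by simpa using hid) (by simpa using hid)

theorem IsGlobalChart.isAnalyticLieGroup [Group M] (hΛ : IsGlobalChart Λ)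
    (hE : IsLocallyConvexTVS 𝕜 E) (hid : LCAnalyticOn 𝕜 (fun x : E => x) Set.univ)
    (hmul : LCAnalyticOn 𝕜 (fun p : E × E => Λ (Λ.symm p.1 * Λ.symm p.2)) Set.univ)
    (hinv : LCAnalyticOn 𝕜 (fun x : E => Λ (Λ.symm x)⁻¹) Set.univ) :
    IsAnalyticLieGroup 𝕜 E M where
  toIsAnalyticManifold := hΛ.isAnalyticManifold hE hid
  analytic_mul e₁ h₁ e₂ h₂ e₃ h₃ := by
    rw [hΛ.atlas_eq, Set.mem_singleton_iff] at h₁ h₂ h₃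
    subst h₁ h₂ h₃
    convert hmul using 1 <;>
      (ext x; simp)
  analytic_inv := hΛ.isAnalyticMap hΛ hinv

end GlobalChart

/-! ### Maps into `Hom (H, B)` with polynomial values -/

section PolyValued

variable {𝕜 H B E : Type*} [RCLike 𝕜] [Ring H] [HopfAlgebra 𝕜 H] [CommRing B] [Algebra 𝕜 B]
  [TopologicalSpace B] [AddCommGroup E] [Module 𝕜 E] [TopologicalSpace E]

/-- The values at all elements of `H` of the map `f` into `Hom_𝕜 (H, B)` are continuous polynomial
maps. (Their degrees need not be bounded.) -/
def IsPolyValued (𝕜 : Type*) {H B E : Type*} [RCLike 𝕜] [Ring H] [HopfAlgebra 𝕜 H] [CommRing B]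
    [Algebra 𝕜 B] [TopologicalSpace B] [AddCommGroup E] [Module 𝕜 E] [TopologicalSpace E]
    (f : E → ConvAlg 𝕜 H B) : Prop :=
  ∀ a, (fun x => (f x).ofConv a) ∈ polyMaps 𝕜 E B

namespace IsPolyValued

theorem const (φ : ConvAlg 𝕜 H B) : IsPolyValued 𝕜 (fun _ : E => φ) :=
  fun _ => const_mem_polyMaps _

variable {f g : E → ConvAlg 𝕜 H B}

theorem add (hf : IsPolyValued 𝕜 f) (hg : IsPolyValued 𝕜 g) : IsPolyValued 𝕜 fun x => f x + g x :=
  fun a => add_mem (hf a) (hg a)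

theorem sub (hf : IsPolyValued 𝕜 f) (hg : IsPolyValued 𝕜 g) : IsPolyValued 𝕜 fun x => f x - g x :=
  fun a => sub_mem (hf a) (hg a)

theorem neg (hf : IsPolyValued 𝕜 f) : IsPolyValued 𝕜 fun x => -f x :=
  fun a => neg_mem (hf a)

theorem smul (c : 𝕜) (hf : IsPolyValued 𝕜 f) : IsPolyValued 𝕜 fun x => c • f x :=
  fun a => smul_mem_polyMaps c (hf a)

theorem sum {κ : Type*} (s : Finset κ) {f : κ → E → ConvAlg 𝕜 H B}
    (hf : ∀ i ∈ s, IsPolyValued 𝕜 (f i)) : IsPolyValued 𝕜 fun x => ∑ i ∈ s, f i x := fun a => by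
  simpa only [WithConv.ofConv_sum, LinearMap.sum_apply] using
    sum_mem_polyMaps s fun i hi => hf i hi a

theorem mul (hf : IsPolyValued 𝕜 f) (hg : IsPolyValued 𝕜 g) :
    IsPolyValued 𝕜 fun x => f x * g x := fun a => by
  obtain ⟨s, hs⟩ := ConvAlg.exists_mul_apply (𝕜 := 𝕜) (B := B) a
  simp only [hs]
  exact sum_mem_polyMaps s fun i _ => mul_mem (hf i.1) (hg i.2)

theorem pow (hf : IsPolyValued 𝕜 f) (n : ℕ) : IsPolyValued 𝕜 fun x => f x ^ n := by
  induction n with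
  | zero => simpa only [pow_zero] using const 1
  | succ n ih => simpa only [pow_succ] using ih.mul hf

variable [T2Space B] {𝓗 : ℕ → Submodule 𝕜 H} (h𝓗 : IsConnectedGrading 𝓗)
include h𝓗

theorem tsum {f : ℕ → E → ConvAlg 𝕜 H B} (hf : ∀ n, IsPolyValued 𝕜 (f n))
    (hf' : ∀ n x, f n x ∈ filt B 𝓗 n) : IsPolyValued 𝕜 fun x => ∑' n, f n x := fun a => by
  obtain ⟨N, hN⟩ := h𝓗.exists_apply_eq_zero (B := B) a
  have h : ∀ x, (∑' n, f n x).ofConv a = ∑ n ∈ Finset.range N, (f n x).ofConv a :=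
    fun x => h𝓗.tsum_apply (hf' · x) hN
  simp only [h]
  exact sum_mem_polyMaps _ fun n _ => hf n a

theorem seriesEval (F : PowerSeries 𝕜) (hf : IsPolyValued 𝕜 f) (hf' : ∀ x, f x ∈ filt B 𝓗 1) :
    IsPolyValued 𝕜 fun x => seriesEval F (f x) :=
  tsum h𝓗 (fun n => (hf.pow n).smul _) fun n x => h𝓗.term_mem_filt (hf' x) F n

theorem convExp (hf : IsPolyValued 𝕜 f) (hf' : ∀ x, f x ∈ filt B 𝓗 1) :
    IsPolyValued 𝕜 fun x => convExp (f x) :=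
  seriesEval h𝓗 _ hf hf'

theorem convLog (hf : IsPolyValued 𝕜 f) (hf' : ∀ x, f x - 1 ∈ filt B 𝓗 1) :
    IsPolyValued 𝕜 fun x => convLog (f x) :=
  seriesEval h𝓗 _ (hf.sub (const 1)) hf'

end IsPolyValued

theorem IsConnectedGrading.continuous_seriesEval [T2Space B] [IsTopologicalRing B]
    [ContinuousSMul 𝕜 B] {𝓗 : ℕ → Submodule 𝕜 H} (h𝓗 : IsConnectedGrading 𝓗) {Y : Type*}
    [TopologicalSpace Y] (F : PowerSeries 𝕜) {f : Y → ConvAlg 𝕜 H B} (hf : Continuous f)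
    (hf' : ∀ x, f x ∈ filt B 𝓗 1) : Continuous fun x => seriesEval F (f x) := by
  refine ConvAlg.continuous_iff.2 fun a => ?_
  obtain ⟨N, hN⟩ := h𝓗.exists_apply_eq_zero (B := B) a
  simp only [h𝓗.seriesEval_apply (hf' _) F hN]
  refine continuous_finsetSum _ fun n _ => ?_
  exact ((ConvAlg.evalCLM 𝕜 B a).continuous.comp (hf.pow n)).const_smul _

end PolyValued

/-! ### Groups parametrized by the exponential function -/

section ExpModel

variable {𝕜 H B F G : Type*} [RCLike 𝕜] [Ring H] [HopfAlgebra 𝕜 H] [CommRing B] [Algebra 𝕜 B]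
  [TopologicalSpace B] [AddCommGroup F] [Module 𝕜 F] [TopologicalSpace F]
  [Group G] [TopologicalSpace G]

/-- The topological group `G` is, via `τ`, a subgroup of the group of units of the algebra
`Hom_𝕜 (H, B)`, and the convolution exponential maps the space `F` of linear maps vanishing on `J`
bijectively onto it. -/
structure IsExpModel (ι : F →ₗ[𝕜] ConvAlg 𝕜 H B) (J : Submodule 𝕜 H) (τ : G → ConvAlg 𝕜 H B)
    (e : F ≃ G) : Prop extends IsAnnihilatorEmbedding ι J where
  apply_one : ∀ x, (ι x).ofConv 1 = 0
  isEmbedding_group : Topology.IsEmbedding τ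
  map_mul : ∀ g h, τ (g * h) = τ g * τ h
  map_exp : ∀ x, τ (e x) = convExp (ι x)

namespace IsExpModel

variable {ι : F →ₗ[𝕜] ConvAlg 𝕜 H B} {J : Submodule 𝕜 H} {τ : G → ConvAlg 𝕜 H B} {e : F ≃ G}
  (he : IsExpModel ι J τ e) {𝓗 : ℕ → Submodule 𝕜 H} (h𝓗 : IsConnectedGrading 𝓗)
include he h𝓗

theorem mem_filt (x : F) : ι x ∈ filt B 𝓗 1 := h𝓗.mem_filt_one.2 (he.apply_one x)

variable [T2Space B]

theorem sub_one_mem (g : G) : τ g - 1 ∈ filt B 𝓗 1 := by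
  obtain ⟨x, rfl⟩ := e.surjective g
  rw [he.map_exp]
  exact h𝓗.convExp_sub_one_mem (he.mem_filt h𝓗 x)

theorem map_add_smul (x : F) (s t : 𝕜) : e ((s + t) • x) = e (s • x) * e (t • x) := by
  apply he.isEmbedding_group.injective
  rw [he.map_mul, he.map_exp, he.map_exp, he.map_exp, map_smul, map_smul, map_smul,
    h𝓗.convExp_add_smul (he.mem_filt h𝓗 x)]

theorem map_zero : e 0 = 1 := by
  have h := he.map_add_smul h𝓗 0 0 0
  simp only [smul_zero] at h
  exact left_eq_mul.1 h

theorem map_neg (x : F) : e (-x) = (e x)⁻¹ := by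
  have h := he.map_add_smul h𝓗 x (-1) 1
  rw [neg_add_cancel, zero_smul, he.map_zero h𝓗, neg_one_smul, one_smul] at h
  exact eq_inv_of_mul_eq_one_left h.symm

variable [IsTopologicalRing B] [ContinuousSMul 𝕜 B]

theorem coe_symm (g : G) : ι (e.symm g) = convLog (τ g) := by
  obtain ⟨x, rfl⟩ := e.surjective g
  rw [e.symm_apply_apply, he.map_exp, h𝓗.convLog_convExp (he.mem_filt h𝓗 x)]

/-- The logarithm, as a global chart of `G`. -/
def logHomeomorph : G ≃ₜ F where
  toEquiv := e.symm
  continuous_toFun := by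
    rw [he.isEmbedding.continuous_iff]
    have : ι ∘ e.symm = fun g => seriesEval (PowerSeries.log 𝕜) (τ g - 1) :=
      funext (he.coe_symm h𝓗)
    exact this ▸ h𝓗.continuous_seriesEval _
      (he.isEmbedding_group.continuous.sub continuous_const) (he.sub_one_mem h𝓗)
  continuous_invFun := by
    rw [he.isEmbedding_group.continuous_iff]
    have : τ ∘ e = fun x => seriesEval (PowerSeries.exp 𝕜) (ι x) := funext he.map_exp
    exact this ▸ h𝓗.continuous_seriesEval _ he.isEmbedding.continuous (he.mem_filt h𝓗)

omit h𝓗 [T2Space B] [IsTopologicalRing B] [ContinuousSMul 𝕜 B] in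
theorem isPolyValued : IsPolyValued 𝕜 ι := he.eval_mem_polyMaps

omit h𝓗 [T2Space B] [IsTopologicalRing B] [ContinuousSMul 𝕜 B] in
theorem isPolyValued_fst : IsPolyValued 𝕜 fun p : F × F => ι p.1 :=
  fun a => comp_clm_mem_polyMaps (ContinuousLinearMap.fst 𝕜 F F) (he.isPolyValued a)

omit h𝓗 [T2Space B] [IsTopologicalRing B] [ContinuousSMul 𝕜 B] in
theorem isPolyValued_snd : IsPolyValued 𝕜 fun p : F × F => ι p.2 :=
  fun a => comp_clm_mem_polyMaps (ContinuousLinearMap.snd 𝕜 F F) (he.isPolyValued a)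

theorem coe_symm_mul (x y : F) :
    ι (e.symm (e x * e y)) = convLog (convExp (ι x) * convExp (ι y)) := by
  rw [he.coe_symm h𝓗, he.map_mul, he.map_exp, he.map_exp]

/-- In the logarithmic chart the multiplication of `G` has polynomial values. -/
theorem isPolyValued_mul : IsPolyValued 𝕜 fun p : F × F => ι (e.symm (e p.1 * e p.2)) := by
  simp only [he.coe_symm_mul h𝓗]
  refine IsPolyValued.convLog h𝓗 ((he.isPolyValued_fst.convExp h𝓗 fun p => he.mem_filt h𝓗 _).mul
    (he.isPolyValued_snd.convExp h𝓗 fun p => he.mem_filt h𝓗 _)) fun p => ?_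
  rw [← he.map_exp, ← he.map_exp, ← he.map_mul]
  exact he.sub_one_mem h𝓗 _

variable [ChartedSpace F G] (hΛ : IsGlobalChart (he.logHomeomorph h𝓗))
include hΛ

theorem isAnalyticLieGroup [PolynormableSpace 𝕜 B] : IsAnalyticLieGroup 𝕜 F G :=
  hΛ.isAnalyticLieGroup he.isLocallyConvexTVS he.lcAnalyticOn_id
    (he.lcAnalyticOn_univ (he.isPolyValued_mul h𝓗)) <| by
      -- In the logarithmic chart, the inversion is `x ↦ -x`.
      have h : ∀ x : F, he.logHomeomorph h𝓗 ((he.logHomeomorph h𝓗).symm x)⁻¹ = -x := fun x => by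
        change e.symm (e x)⁻¹ = -x
        rw [← he.map_neg h𝓗, e.symm_apply_apply]
      simp only [h]
      refine he.lcAnalyticOn_univ fun a => ?_
      simpa only [_root_.map_neg] using he.isPolyValued.neg a

theorem isAnalyticDiffeo : IsAnalyticDiffeo 𝕜 F F e := by
  refine ⟨(isGlobalChart_refl F).isAnalyticMap hΛ ?_, hΛ.isAnalyticMap (isGlobalChart_refl F) ?_⟩
  · convert he.lcAnalyticOn_id using 2 with x
    exact e.symm_apply_apply x
  · convert he.lcAnalyticOn_id using 2 with x
    exact e.symm_apply_apply x

theorem isLieExponential : IsLieExponential 𝕜 e where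
  analytic := (he.isAnalyticDiffeo h𝓗 hΛ).1
  map_add v s t := by
    rw [← he.map_add_smul h𝓗, RCLike.ofReal_add]
  velocity v := by
    rw [hΛ.chartAt_eq]
    have h : ∀ x : F, (he.logHomeomorph h𝓗).toOpenPartialHomeomorph (e x) = x := e.symm_apply_apply
    rw [← he.map_zero h𝓗]
    simp only [h, sub_zero]
    refine tendsto_const_nhds.congr' ?_
    filter_upwards [self_mem_nhdsWithin] with t ht
    have ht' : (t : 𝕜) ≠ 0 := RCLike.ofReal_ne_zero.2 ht
    rw [smul_smul, RCLike.ofReal_inv, inv_mul_cancel₀ ht', one_smul]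

theorem log_mem_analyticMaximalAtlas :
    (he.logHomeomorph h𝓗).toOpenPartialHomeomorph ∈ analyticMaximalAtlas 𝕜 F G :=
  hΛ.mem_analyticMaximalAtlas (by simpa using he.lcAnalyticOn_id)
    (by simpa using he.lcAnalyticOn_id)

theorem isBCHLieGroup [PolynormableSpace 𝕜 B] : IsBCHLieGroup 𝕜 F G where
  toIsAnalyticLieGroup := he.isAnalyticLieGroup h𝓗 hΛ
  exists_exp := ⟨e, he.isLieExponential h𝓗 hΛ,
    (he.logHomeomorph h𝓗).toOpenPartialHomeomorph.symm, trivial, fun _ _ => rfl,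
    he.log_mem_analyticMaximalAtlas h𝓗 hΛ⟩

end IsExpModel

end ExpModel

/-! ### Jets and the Lie bracket -/

section MixedDeriv

variable {𝕜 : Type*} [RCLike 𝕜] {E F B : Type*}
  [AddCommGroup E] [Module 𝕜 E] [TopologicalSpace E]
  [AddCommGroup F] [Module 𝕜 F] [TopologicalSpace F]

/-- The mixed derivative of a smooth map is its second derivative in the directions `(v, 0)` and
`(0, w)`. -/
theorem CInftyOn.exists_hasMixedDeriv {m : E → E → E}
    (hm : CInftyOn 𝕜 (fun p : E × E => m p.1 p.2) Set.univ) (v w : E) :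
    ∃ b, HasMixedDeriv 𝕜 m v w b := by
  obtain ⟨D, h0, h1, -⟩ := hm
  let y : Fin 1 → E × E := Fin.snoc (α := fun _ => E × E) Fin.elim0 (v, 0)
  refine ⟨D 2 (0, 0) (Fin.snoc (α := fun _ => E × E) y (0, w)), fun t => D 1 (0, t • w) y,
    Filter.Eventually.of_forall fun t => ?_, ?_⟩
  · have h := h1 0 (0, t • w) trivial Fin.elim0 (v, 0)
    refine Filter.Tendsto.congr (fun s => ?_) h
    simp only [h0 _ (Set.mem_univ _)]
    simp
  · have h := h1 1 (0, 0) trivial y (0, w)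
    refine Filter.Tendsto.congr (fun s => ?_) h
    simp

/-- The function `g` of two scalars has the `1`-jet `(g₀, g₁, g₂)` at `(0, 0)` and the mixed second
derivative `g₁₂` there. -/
def HasJet (g : 𝕜 → 𝕜 → F) (g₀ g₁ g₂ g₁₂ : F) : Prop :=
  ∃ D : 𝕜 → F, (∀ t, HasDirDeriv 𝕜 (fun s => g s t) 0 1 (D t)) ∧ HasDirDeriv 𝕜 D 0 1 g₁₂ ∧
    D 0 = g₁ ∧ HasDirDeriv 𝕜 (fun t => g 0 t) 0 1 g₂ ∧ g 0 0 = g₀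

theorem hasJet_const (c : F) : HasJet (fun _ _ : 𝕜 => c) c 0 0 0 :=
  ⟨fun _ => 0, fun _ => hasDirDeriv_const c _ _, hasDirDeriv_const 0 _ _, rfl,
    hasDirDeriv_const c _ _, rfl⟩

theorem hasJet_smul_left [ContinuousSMul 𝕜 F] (c : F) : HasJet (fun s _ : 𝕜 => s • c) 0 c 0 0 := by
  refine ⟨fun _ => c, fun t => ?_, hasDirDeriv_const c _ _, rfl, ?_, zero_smul 𝕜 c⟩
  · have h := hasDirDeriv_linear ((LinearMap.id : 𝕜 →ₗ[𝕜] 𝕜).smulRight c) 0 1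
    rwa [LinearMap.smulRight_apply, LinearMap.id_apply, one_smul] at h
  · exact hasDirDeriv_const _ _ _

theorem hasJet_smul_right [ContinuousSMul 𝕜 F] (c : F) : HasJet (fun _ t : 𝕜 => t • c) 0 0 c 0 := by
  refine ⟨fun _ => 0, fun t => hasDirDeriv_const _ _ _, hasDirDeriv_const 0 _ _, rfl, ?_,
    zero_smul 𝕜 c⟩
  have h := hasDirDeriv_linear ((LinearMap.id : 𝕜 →ₗ[𝕜] 𝕜).smulRight c) 0 1
  rwa [LinearMap.smulRight_apply, LinearMap.id_apply, one_smul] at h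

theorem HasJet.add [ContinuousAdd F] {g h : 𝕜 → 𝕜 → F} {g₀ g₁ g₂ g₁₂ h₀ h₁ h₂ h₁₂ : F}
    (hg : HasJet g g₀ g₁ g₂ g₁₂) (hh : HasJet h h₀ h₁ h₂ h₁₂) :
    HasJet (fun s t => g s t + h s t) (g₀ + h₀) (g₁ + h₁) (g₂ + h₂) (g₁₂ + h₁₂) := by
  obtain ⟨D, hD, hD', rfl, hg₂, rfl⟩ := hg
  obtain ⟨D₁, hD₁, hD₁', rfl, hh₂, rfl⟩ := hh
  exact ⟨fun t => D t + D₁ t, fun t => (hD t).add (hD₁ t), hD'.add hD₁', rfl, hg₂.add hh₂, rfl⟩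

theorem HasJet.mul [CommRing B] [Algebra 𝕜 B] [TopologicalSpace B] [IsTopologicalRing B]
    [ContinuousSMul 𝕜 B] {g h : 𝕜 → 𝕜 → B} {g₀ g₁ g₂ g₁₂ h₀ h₁ h₂ h₁₂ : B}
    (hg : HasJet g g₀ g₁ g₂ g₁₂) (hh : HasJet h h₀ h₁ h₂ h₁₂) :
    HasJet (fun s t => g s t * h s t) (g₀ * h₀) (g₁ * h₀ + g₀ * h₁) (g₂ * h₀ + g₀ * h₂)
      (g₁₂ * h₀ + g₁ * h₂ + g₂ * h₁ + g₀ * h₁₂) := by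
  obtain ⟨D, hD, hD', rfl, hg₂, rfl⟩ := hg
  obtain ⟨D₁, hD₁, hD₁', rfl, hh₂, rfl⟩ := hh
  refine ⟨fun t => D t * h 0 t + g 0 t * D₁ t, fun t => (hD t).mul (hD₁ t), ?_, rfl,
    hg₂.mul hh₂, rfl⟩
  have key := (hD'.mul hh₂).add (hg₂.mul hD₁')
  rwa [← add_assoc] at key

theorem HasJet.sum [ContinuousAdd F] {κ : Type*} (S : Finset κ) {g : κ → 𝕜 → 𝕜 → F}
    {g₀ g₁ g₂ g₁₂ : κ → F} (hg : ∀ i ∈ S, HasJet (g i) (g₀ i) (g₁ i) (g₂ i) (g₁₂ i)) :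
    HasJet (fun s t => ∑ i ∈ S, g i s t) (∑ i ∈ S, g₀ i) (∑ i ∈ S, g₁ i) (∑ i ∈ S, g₂ i)
      (∑ i ∈ S, g₁₂ i) := by
  classical
  induction S using Finset.induction_on with
  | empty => simpa using hasJet_const (𝕜 := 𝕜) (0 : F)
  | insert i S hi ih =>
    simp only [Finset.sum_insert hi]
    exact (hg i (Finset.mem_insert_self i S)).add
      (ih fun j hj => hg j (Finset.mem_insert_of_mem hj))

theorem HasJet.clm_comp {g : 𝕜 → 𝕜 → E} {g₀ g₁ g₂ g₁₂ : E} (hg : HasJet g g₀ g₁ g₂ g₁₂)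
    (L : E →L[𝕜] F) : HasJet (fun s t => L (g s t)) (L g₀) (L g₁) (L g₂) (L g₁₂) := by
  obtain ⟨D, hD, hD', rfl, hg₂, rfl⟩ := hg
  exact ⟨fun t => L (D t), fun t => (hD t).clm_comp L, hD'.clm_comp L, rfl, hg₂.clm_comp L, rfl⟩

theorem HasJet.smul [ContinuousConstSMul 𝕜 F] {g : 𝕜 → 𝕜 → F} {g₀ g₁ g₂ g₁₂ : F} (c : 𝕜)
    (hg : HasJet g g₀ g₁ g₂ g₁₂) :
    HasJet (fun s t => c • g s t) (c • g₀) (c • g₁) (c • g₂) (c • g₁₂) :=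
  hg.clm_comp (c • ContinuousLinearMap.id 𝕜 F)

/-- A mixed derivative is determined by the jet of the function of two scalars. -/
theorem HasMixedDeriv.eq_of_hasJet [T2Space F] {m : E → E → E} {v w b : E}
    (hb : HasMixedDeriv 𝕜 m v w b) (L : E →L[𝕜] F) {g₀ g₁ g₂ g₁₂ : F}
    (hg : HasJet (fun s t : 𝕜 => L (m (s • v) (t • w))) g₀ g₁ g₂ g₁₂) : L b = g₁₂ := by
  obtain ⟨D, hD, hDb⟩ := hb
  obtain ⟨D', hD', hD₁₂, -⟩ := hg
  have hev : ∀ᶠ t in 𝓝 (0 : 𝕜), L (D t) = D' t := by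
    filter_upwards [hD] with t ht
    refine HasDirDeriv.unique (𝕜 := 𝕜) ?_ (hD' t)
    refine Filter.Tendsto.congr (fun s => ?_) (ht.clm_comp L)
    simp
  refine HasDirDeriv.unique (hDb.clm_comp L) (Filter.Tendsto.congr' ?_ hD₁₂)
  filter_upwards [nhdsWithin_le_nhds hev] with t ht
  simp only [smul_eq_mul, mul_one, zero_add]
  rw [ht, hev.self_of_nhds]

end MixedDeriv

section ConvJet

variable {𝕜 H B : Type*} [RCLike 𝕜] [Ring H] [HopfAlgebra 𝕜 H] [CommRing B] [Algebra 𝕜 B]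
  [TopologicalSpace B]

/-- All values of the function `g` of two scalars with values in `Hom_𝕜 (H, B)` have jets, given
by the values of the linear maps `g₀`, `g₁`, `g₂`, `g₁₂`. -/
def HasConvJet (g : 𝕜 → 𝕜 → ConvAlg 𝕜 H B) (g₀ g₁ g₂ g₁₂ : ConvAlg 𝕜 H B) : Prop :=
  ∀ a, HasJet (fun s t => (g s t).ofConv a) (g₀.ofConv a) (g₁.ofConv a) (g₂.ofConv a)
    (g₁₂.ofConv a)

namespace HasConvJet

variable {g h : 𝕜 → 𝕜 → ConvAlg 𝕜 H B} {g₀ g₁ g₂ g₁₂ h₀ h₁ h₂ h₁₂ : ConvAlg 𝕜 H B}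

theorem const (φ : ConvAlg 𝕜 H B) : HasConvJet (fun _ _ : 𝕜 => φ) φ 0 0 0 :=
  fun a => hasJet_const (φ.ofConv a)

variable [IsTopologicalRing B] [ContinuousSMul 𝕜 B]

theorem mul (hg : HasConvJet g g₀ g₁ g₂ g₁₂) (hh : HasConvJet h h₀ h₁ h₂ h₁₂) :
    HasConvJet (fun s t => g s t * h s t) (g₀ * h₀) (g₁ * h₀ + g₀ * h₁) (g₂ * h₀ + g₀ * h₂)
      (g₁₂ * h₀ + g₁ * h₂ + g₂ * h₁ + g₀ * h₁₂) := fun a => by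
  obtain ⟨S, hS⟩ := ConvAlg.exists_mul_apply (𝕜 := 𝕜) (B := B) a
  simp only [WithConv.ofConv_add, LinearMap.add_apply, hS, ← Finset.sum_add_distrib]
  exact HasJet.sum S fun i _ => (hg i.1).mul (hh i.2)

/-- The jets of the powers of a function vanishing at `(0, 0)`: from the third power on, they
are zero. -/
theorem pow (hg : HasConvJet g 0 g₁ g₂ g₁₂) (n : ℕ) :
    HasConvJet (fun s t => g s t ^ n) (if n = 0 then 1 else 0) (if n = 1 then g₁ else 0)
      (if n = 1 then g₂ else 0)
      (if n = 1 then g₁₂ else if n = 2 then g₁ * g₂ + g₂ * g₁ else 0) := by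
  induction n with
  | zero => simpa using const (𝕜 := 𝕜) (1 : ConvAlg 𝕜 H B)
  | succ n ih =>
    have h := ih.mul hg
    simp only [← pow_succ] at h
    rcases n with _ | _ | n
    · simpa using h
    · simpa using h
    · simpa using h

theorem seriesEval [T2Space B] {𝓗 : ℕ → Submodule 𝕜 H} (h𝓗 : IsConnectedGrading 𝓗)
    (hg : HasConvJet g 0 g₁ g₂ g₁₂) (hg' : ∀ s t, g s t ∈ filt B 𝓗 1) (f : PowerSeries 𝕜) :
    HasConvJet (fun s t => seriesEval f (g s t)) (PowerSeries.coeff 0 f • 1)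
      (PowerSeries.coeff 1 f • g₁) (PowerSeries.coeff 1 f • g₂)
      (PowerSeries.coeff 1 f • g₁₂ + PowerSeries.coeff 2 f • (g₁ * g₂ + g₂ * g₁)) := fun a => by
  obtain ⟨N, hN⟩ := h𝓗.exists_apply_eq_zero (B := B) a
  have hN' : ∀ φ ∈ filt B 𝓗 (N + 3), φ.ofConv a = 0 :=
    fun φ hφ => hN φ (filt_antitone (by omega) hφ)
  simp only [h𝓗.seriesEval_apply (hg' _ _) f hN']
  have h := HasJet.sum (Finset.range (N + 3)) fun n _ =>
    ((hg.pow n) a).smul (PowerSeries.coeff n f)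
  convert h using 1
  · rw [Finset.sum_eq_single 0 (fun n _ hn => by simp [hn]) (by simp)]
    simp
  · rw [Finset.sum_eq_single 1 (fun n _ hn => by simp [hn]) (by simp)]
    simp
  · rw [Finset.sum_eq_single 1 (fun n _ hn => by simp [hn]) (by simp)]
    simp
  · rw [Finset.sum_eq_add 1 2 (by simp) (fun n _ hn => by simp [hn.1, hn.2]) (by simp) (by simp)]
    simp

end HasConvJet

end ConvJet

section LieBracket

variable {𝕜 H B F G : Type*} [RCLike 𝕜] [Ring H] [HopfAlgebra 𝕜 H] [CommRing B] [Algebra 𝕜 B]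
  [TopologicalSpace B] [T2Space B] [IsTopologicalRing B] [ContinuousSMul 𝕜 B]
  {𝓗 : ℕ → Submodule 𝕜 H} (h𝓗 : IsConnectedGrading 𝓗)

include h𝓗 in
/-- The terms of order two of `log (exp (s v) * exp (t w))`. -/
theorem IsConnectedGrading.hasConvJet_log_exp_mul_exp {v w : ConvAlg 𝕜 H B}
    (hv : v ∈ filt B 𝓗 1) (hw : w ∈ filt B 𝓗 1) :
    HasConvJet (fun s t : 𝕜 => convLog (convExp (s • v) * convExp (t • w))) 0 v w
      ((2 : 𝕜)⁻¹ • (v * w - w * v)) := by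
  have hv' : HasConvJet (fun s _ : 𝕜 => s • v) 0 v 0 0 := fun a => hasJet_smul_left (v.ofConv a)
  have hw' : HasConvJet (fun _ t : 𝕜 => t • w) 0 0 w 0 := fun a => hasJet_smul_right (w.ofConv a)
  have h₁ := hv'.seriesEval h𝓗 (fun s t => Submodule.smul_mem _ s hv) (PowerSeries.exp 𝕜)
  have h₂ := hw'.seriesEval h𝓗 (fun s t => Submodule.smul_mem _ t hw) (PowerSeries.exp 𝕜)
  have h₃ : HasConvJet (fun s t : 𝕜 => convExp (s • v) * convExp (t • w) - 1) 0 v w (v * w) := by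
    have h : HasConvJet (fun s t : 𝕜 => convExp (s • v) * convExp (t • w)) _ _ _ _ := h₁.mul h₂
    simp only [coeff_exp_eq, Nat.factorial_zero, Nat.factorial_one, Nat.cast_one, inv_one,
      one_smul, mul_zero, zero_mul, smul_zero, add_zero, mul_one, one_mul, zero_add] at h
    intro a
    have h' := (h a).add (hasJet_const (𝕜 := 𝕜) (-(1 : ConvAlg 𝕜 H B).ofConv a))
    simpa [sub_eq_add_neg] using h'
  have h₄ := h₃.seriesEval h𝓗 (fun s t => ?_) (PowerSeries.log 𝕜)
  · have h2 : PowerSeries.coeff 2 (PowerSeries.log 𝕜) = -(2 : 𝕜)⁻¹ := by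
      simp [PowerSeries.coeff_log]; norm_num
    have h0 : PowerSeries.coeff 0 (PowerSeries.log 𝕜) = 0 := by simp
    rw [h0, zero_smul, PowerSeries.coeff_one_log, one_smul, one_smul, one_smul, h2] at h₄
    have h : (2 : 𝕜)⁻¹ • (v * w - w * v) = v * w + -(2 : 𝕜)⁻¹ • (v * w + w * v) := by
      match_scalars <;> norm_num
    rw [h]
    exact h₄
  · rw [h𝓗.mem_filt_one]
    have hs := h𝓗.convExp_sub_one_mem (Submodule.smul_mem _ s hv)
    have ht := h𝓗.convExp_sub_one_mem (Submodule.smul_mem _ t hw)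
    rw [← h𝓗.mem_filt_one]
    have := add_mem (h𝓗.mul_mem_filt_right (convExp (t • w)) hs) ht
    convert this using 1
    noncomm_ring

variable [AddCommGroup F] [Module 𝕜 F] [TopologicalSpace F] [Group G] [TopologicalSpace G]
  {ι : F →ₗ[𝕜] ConvAlg 𝕜 H B} {J : Submodule 𝕜 H} {τ : G → ConvAlg 𝕜 H B} {e : F ≃ G}
  (he : IsExpModel ι J τ e)
include he h𝓗

/-- In the logarithmic chart, the bilinear term of the multiplication is half of the commutator. -/
theorem IsExpModel.exists_hasMixedDeriv (v w : F) :
    ∃ b, HasMixedDeriv 𝕜 (fun x y => e.symm (e x * e y)) v w b ∧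
      ι b = (2 : 𝕜)⁻¹ • (ι v * ι w - ι w * ι v) := by
  obtain ⟨b, hb⟩ := CInftyOn.exists_hasMixedDeriv (m := fun x y => e.symm (e x * e y))
    (he.cInftyOn_univ (he.isPolyValued_mul h𝓗)) v w
  refine ⟨b, hb, ConvAlg.ext_apply fun a => ?_⟩
  have hj := h𝓗.hasConvJet_log_exp_mul_exp (he.mem_filt h𝓗 v) (he.mem_filt h𝓗 w) a
  refine hb.eq_of_hasJet ((ConvAlg.evalCLM 𝕜 B a).comp
    (⟨ι, he.isEmbedding.continuous⟩ : F →L[𝕜] ConvAlg 𝕜 H B)) (g₀ := 0)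
    (g₁ := (ι v).ofConv a) (g₂ := (ι w).ofConv a) ?_
  convert hj using 4 with s t
  · change (ι (e.symm (e (s • v) * e (t • w)))).ofConv a =
      (convLog (convExp (s • ι v) * convExp (t • ι w))).ofConv a
    rw [he.coe_symm_mul h𝓗, map_smul, map_smul]
  · rfl

end LieBracket

section LieAlgebra

variable {𝕜 H B F G : Type*} [RCLike 𝕜] [Ring H] [HopfAlgebra 𝕜 H] [CommRing B] [Algebra 𝕜 B]
  [TopologicalSpace B] [T2Space B] [IsTopologicalRing B] [ContinuousSMul 𝕜 B]
  {𝓗 : ℕ → Submodule 𝕜 H} (h𝓗 : IsConnectedGrading 𝓗)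
  [LieRing F] [LieAlgebra 𝕜 F] [TopologicalSpace F] [Group G] [TopologicalSpace G]
  {ι : F →ₗ[𝕜] ConvAlg 𝕜 H B} {J : Submodule 𝕜 H} {τ : G → ConvAlg 𝕜 H B} {e : F ≃ G}
  (he : IsExpModel ι J τ e) (hlie : ∀ x y, ι ⁅x, y⁆ = ι x * ι y - ι y * ι x)
include hlie

/-- The Lie algebra of `G` is the model space `F` with the commutator bracket. -/
theorem IsExpModel.hasLieAlgebra [ChartedSpace F G]
    (hΛ : IsGlobalChart (he.logHomeomorph h𝓗)) : HasLieAlgebra 𝕜 F G := by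
  intro v w
  obtain ⟨b₁, hb₁, hb₁'⟩ := he.exists_hasMixedDeriv h𝓗 v w
  obtain ⟨b₂, hb₂, hb₂'⟩ := he.exists_hasMixedDeriv h𝓗 w v
  have h1 : (he.logHomeomorph h𝓗).toOpenPartialHomeomorph 1 = 0 := by
    change e.symm 1 = 0
    rw [← he.map_zero h𝓗, e.symm_apply_apply]
  have hm : (fun x y => (he.logHomeomorph h𝓗).toOpenPartialHomeomorph
      ((he.logHomeomorph h𝓗).toOpenPartialHomeomorph.symm (0 + x) *
        (he.logHomeomorph h𝓗).toOpenPartialHomeomorph.symm (0 + y))) =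
      fun x y => e.symm (e x * e y) := by
    funext x y
    rw [zero_add, zero_add]
    rfl
  refine ⟨b₁, b₂, ?_, ?_, he.isEmbedding.injective ?_⟩
  · rw [hΛ.chartAt_eq, h1, hm]
    exact hb₁
  · rw [hΛ.chartAt_eq, h1, hm]
    exact hb₂
  · rw [map_sub, hb₁', hb₂', hlie]
    module

end LieAlgebra

/-! ### The Baker–Campbell–Hausdorff series -/

section BCH

variable {𝕜 H B F : Type*} [RCLike 𝕜] [Ring H] [HopfAlgebra 𝕜 H] [CommRing B] [Algebra 𝕜 B]
  [TopologicalSpace B]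
  [LieRing F] [LieAlgebra 𝕜 F] [TopologicalSpace F]
  {ι : F →ₗ[𝕜] ConvAlg 𝕜 H B} {J : Submodule 𝕜 H} {𝓗 : ℕ → Submodule 𝕜 H}

/-- The family `T` of operators on `F` is parametrized by the pairs of elements of `F`. Applied to a
map with polynomial values on these pairs, it again gives such a map, and raises the order of
vanishing by `d`. -/
def IsPolyOperator (ι : F →ₗ[𝕜] ConvAlg 𝕜 H B) (𝓗 : ℕ → Submodule 𝕜 H)
    (T : F × F → Module.End 𝕜 F) (d : ℕ) : Prop :=
  ∀ (g : F × F → F) (r : ℕ), IsPolyValued 𝕜 (fun z => ι (g z)) → (∀ z, ι (g z) ∈ filt B 𝓗 r) →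
    IsPolyValued 𝕜 (fun z => ι (T z (g z))) ∧ ∀ z, ι (T z (g z)) ∈ filt B 𝓗 (d + r)

namespace IsPolyOperator

variable {S T : F × F → Module.End 𝕜 F} {d d' : ℕ}

theorem one : IsPolyOperator ι 𝓗 (fun _ => 1) 0 := fun _ r hg hg' =>
  ⟨hg, fun z => (zero_add r).symm ▸ hg' z⟩

theorem mul (hS : IsPolyOperator ι 𝓗 S d) (hT : IsPolyOperator ι 𝓗 T d') :
    IsPolyOperator ι 𝓗 (fun z => S z * T z) (d + d') := fun g r hg hg' => by
  have h := hT g r hg hg'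
  rw [add_assoc]
  exact hS (fun z => T z (g z)) (d' + r) h.1 h.2

theorem pow (hT : IsPolyOperator ι 𝓗 T 1) (n : ℕ) : IsPolyOperator ι 𝓗 (fun z => T z ^ n) n := by
  induction n with
  | zero => simpa only [pow_zero] using one
  | succ n ih => simpa only [pow_succ] using ih.mul hT

theorem prod_ofFn {k : ℕ} {T : Fin k → F × F → Module.End 𝕜 F} {d : Fin k → ℕ}
    (hT : ∀ i, IsPolyOperator ι 𝓗 (T i) (d i)) :
    IsPolyOperator ι 𝓗 (fun z => (List.ofFn fun i => T i z).prod) (∑ i, d i) := by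
  induction k with
  | zero => simpa using one
  | succ k ih =>
    simp only [List.ofFn_succ, List.prod_cons, Fin.sum_univ_succ]
    exact (hT 0).mul (ih fun i => hT i.succ)

theorem ad (h𝓗 : IsConnectedGrading 𝓗) (hlie : ∀ x y, ι ⁅x, y⁆ = ι x * ι y - ι y * ι x)
    {f : F × F → F} (hf : IsPolyValued 𝕜 fun z => ι (f z)) (hf' : ∀ z, ι (f z) ∈ filt B 𝓗 1) :
    IsPolyOperator ι 𝓗 (fun z => LieAlgebra.ad 𝕜 F (f z)) 1 := fun g r hg hg' => by
  simp only [LieAlgebra.ad_apply, hlie]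
  exact ⟨(hf.mul hg).sub (hg.mul hf), fun z => sub_mem (h𝓗.mul_mem_filt (hf' z) (hg' z))
    (add_comm r 1 ▸ h𝓗.mul_mem_filt (hg' z) (hf' z))⟩

end IsPolyOperator

variable (hι : IsAnnihilatorEmbedding ι J) (hι1 : ∀ x, (ι x).ofConv 1 = 0)
  (h𝓗 : IsConnectedGrading 𝓗) (hlie : ∀ x y, ι ⁅x, y⁆ = ι x * ι y - ι y * ι x)
include hι hι1 h𝓗 hlie

/-- A term of degree `n` in `x` and `y` has polynomial values, and vanishes in degrees less than
`n`, because `x` and `y` vanish in degree `0`. -/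
theorem IsAnnihilatorEmbedding.bchTerm_mem (n : ℕ) :
    IsPolyValued 𝕜 (fun z : F × F => ι (bchTerm 𝕜 n z.1 z.2)) ∧
      ∀ z : F × F, ι (bchTerm 𝕜 n z.1 z.2) ∈ filt B 𝓗 n := by
  have hfil : ∀ x, ι x ∈ filt B 𝓗 1 := fun x => h𝓗.mem_filt_one.2 (hι1 x)
  have hfst : IsPolyValued 𝕜 fun z : F × F => ι z.1 := fun a =>
    comp_clm_mem_polyMaps (ContinuousLinearMap.fst 𝕜 F F) (hι.eval_mem_polyMaps a)
  have hsnd : IsPolyValued 𝕜 fun z : F × F => ι z.2 := fun a =>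
    comp_clm_mem_polyMaps (ContinuousLinearMap.snd 𝕜 F F) (hι.eval_mem_polyMaps a)
  have hx := IsPolyOperator.ad h𝓗 hlie hfst fun z => hfil z.1
  have hy := IsPolyOperator.ad h𝓗 hlie hsnd fun z => hfil z.2
  have hsum : ∀ {κ : Type} (s : Finset κ) (u : κ → F × F → F),
      (∀ i ∈ s, IsPolyValued 𝕜 (fun z => ι (u i z)) ∧ ∀ z, ι (u i z) ∈ filt B 𝓗 n) →
      IsPolyValued 𝕜 (fun z => ι (∑ i ∈ s, u i z)) ∧ ∀ z, ι (∑ i ∈ s, u i z) ∈ filt B 𝓗 n := by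
    intro κ s u hu
    simp only [map_sum]
    exact ⟨IsPolyValued.sum s fun i hi => (hu i hi).1, fun z => sum_mem fun i hi => (hu i hi).2 z⟩
  have hzero : IsPolyValued 𝕜 (fun _ : F × F => ι 0) ∧ ∀ _ : F × F, ι 0 ∈ filt B 𝓗 n := by
    rw [map_zero]
    exact ⟨IsPolyValued.const 0, fun _ => zero_mem _⟩
  have h1 : IsPolyValued 𝕜 (fun z : F × F => ι (if n = 1 then z.1 else 0)) ∧
      ∀ z : F × F, ι (if n = 1 then z.1 else 0) ∈ filt B 𝓗 n := by
    split_ifs with h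
    · exact ⟨hfst, fun z => h ▸ hfil z.1⟩
    · exact hzero
  have h2 := hsum (Finset.range n) _ fun k _ =>
    hsum (Fintype.piFinset fun _ : Fin k => Finset.range n) _ fun p _ =>
    hsum (Fintype.piFinset fun _ : Fin k => Finset.range n) _ fun q _ =>
    hsum (Finset.range n) (fun m z =>
      if (∀ i, 0 < p i + q i) ∧ (∑ i, (p i + q i)) + m + 1 = n then
        ((-1 : 𝕜) ^ k / (((k : 𝕜) + 1) * ((∑ i, (q i : 𝕜)) + 1) *
            (∏ i, (((p i).factorial : 𝕜) * ((q i).factorial : 𝕜))) * (m.factorial : 𝕜))) •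
          ((List.ofFn fun i => LieAlgebra.ad 𝕜 F z.1 ^ p i * LieAlgebra.ad 𝕜 F z.2 ^ q i).prod *
            LieAlgebra.ad 𝕜 F z.1 ^ m) z.2
      else 0) fun m _ => by
        split_ifs with h
        · have hop := ((IsPolyOperator.prod_ofFn fun i => (hx.pow (p i)).mul (hy.pow (q i))).mul
            (hx.pow m)) Prod.snd 1 hsnd fun z => hfil z.2
          rw [h.2] at hop
          simp only [map_smul]
          exact ⟨hop.1.smul _, fun z => Submodule.smul_mem _ _ (hop.2 z)⟩
        · exact hzero
  simp only [bchTerm, map_add]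
  exact ⟨h1.1.add h2.1, fun z => add_mem (h1.2 z) (h2.2 z)⟩

/-- A Lie algebra of linear maps vanishing at `1` is a BCH Lie algebra: at each element of `H`,
only finitely many terms of the BCH series are nonzero, so that it converges everywhere. -/
theorem IsAnnihilatorEmbedding.isBCHLieAlgebra [T2Space B] [IsTopologicalRing B]
    [ContinuousSMul 𝕜 B] [PolynormableSpace 𝕜 B] : IsBCHLieAlgebra 𝕜 F where
  isLocallyConvexTVS := hι.isLocallyConvexTVS
  continuous_bracket := by
    rw [hι.isEmbedding.continuous_iff]
    have h₁ := hι.isEmbedding.continuous.comp (continuous_fst (X := F) (Y := F))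
    have h₂ := hι.isEmbedding.continuous.comp (continuous_snd (X := F) (Y := F))
    refine ((h₁.mul h₂).sub (h₂.mul h₁)).congr fun p => ?_
    exact (hlie p.1 p.2).symm
  exists_bch := by
    have hpoly := fun n => (hι.bchTerm_mem hι1 h𝓗 hlie n).1
    have hmem := fun n => (hι.bchTerm_mem hι1 h𝓗 hlie n).2
    have hrange : ∀ z : F × F, ∃ y, ι y = ∑' n, ι (bchTerm 𝕜 n z.1 z.2) := fun z => by
      refine (hι.mem_range_iff _).2 fun a ha => ?_
      obtain ⟨N, hN⟩ := h𝓗.exists_apply_eq_zero (B := B) a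
      rw [h𝓗.tsum_apply (hmem · z) hN]
      exact Finset.sum_eq_zero fun n _ => (hι.mem_range_iff _).1 ⟨_, rfl⟩ a ha
    choose f hf using hrange
    refine ⟨Set.univ, isOpen_univ, trivial, f, ?_, fun x _ y _ => ?_⟩
    · rw [Set.univ_prod_univ]
      refine hι.lcAnalyticOn_univ ?_
      simp only [hf]
      exact IsPolyValued.tsum h𝓗 hpoly hmem
    · rw [hι.isEmbedding.tendsto_nhds_iff, hf]
      have h := (h𝓗.summable (hmem · (x, y))).hasSum.tendsto_sum_nat.comp
        (Filter.tendsto_add_atTop_nat 1)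
      refine h.congr fun N => ?_
      have h0 : bchTerm 𝕜 0 x y = 0 := by simp [bchTerm]
      rw [Function.comp_apply, Function.comp_apply, map_sum, Finset.sum_range_succ', h0, map_zero,
        add_zero, Finset.range_eq_Ico, Finset.sum_Ico_add' (fun n => ι (bchTerm 𝕜 n x y)) 0 N 1]
      rfl

end BCH

/-! ### The logarithm as a submanifold chart of `Hom (H, B)` -/

section Submanifold

variable {𝕜 H B : Type*} [RCLike 𝕜] [Ring H] [HopfAlgebra 𝕜 H] [CommRing B] [Algebra 𝕜 B]

/-- The linear map `a ↦ ε (a) b`. -/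
def counitSMul (𝕜 H : Type*) {B : Type*} [RCLike 𝕜] [Ring H] [HopfAlgebra 𝕜 H] [CommRing B]
    [Algebra 𝕜 B] (b : B) : ConvAlg 𝕜 H B :=
  WithConv.toConv ((Coalgebra.counit (R := 𝕜) (A := H)).smulRight b)

theorem counitSMul_apply (b : B) (a : H) :
    (counitSMul 𝕜 H b).ofConv a = Coalgebra.counit (R := 𝕜) a • b := rfl

theorem counitSMul_apply_one (b : B) : (counitSMul 𝕜 H b).ofConv 1 = b := by
  simp [counitSMul_apply]

theorem counitSMul_zero : counitSMul 𝕜 H (0 : B) = 0 := by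
  refine ConvAlg.ext_apply fun a => ?_
  simp [counitSMul_apply]

variable [TopologicalSpace B] [T2Space B] [IsTopologicalRing B] [ContinuousSMul 𝕜 B]
  {𝓗 : ℕ → Submodule 𝕜 H} (h𝓗 : IsConnectedGrading 𝓗)

omit [T2Space B] [IsTopologicalRing B] [ContinuousSMul 𝕜 B] in
theorem isPolyValued_counitSMul {E : Type*} [AddCommGroup E] [Module 𝕜 E] [TopologicalSpace E]
    {p : E → B} (hp : p ∈ polyMaps 𝕜 E B) : IsPolyValued 𝕜 fun x => counitSMul 𝕜 H (p x) :=
  fun _ => smul_mem_polyMaps _ hp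

omit [T2Space B] [IsTopologicalRing B] [ContinuousSMul 𝕜 B] in
theorem isPolyValued_id : IsPolyValued 𝕜 fun φ : ConvAlg 𝕜 H B => φ :=
  fun a => clm_mem_polyMaps (ConvAlg.evalCLM 𝕜 B a)

omit [T2Space B] [ContinuousSMul 𝕜 B] in
theorem IsPolyValued.continuous {E : Type*} [AddCommGroup E] [Module 𝕜 E] [TopologicalSpace E]
    {f : E → ConvAlg 𝕜 H B} (hf : IsPolyValued 𝕜 f) : Continuous f :=
  ConvAlg.continuous_iff.2 fun a => continuous_of_mem_polyMaps (hf a)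

omit [TopologicalSpace B] [T2Space B] [IsTopologicalRing B] [ContinuousSMul 𝕜 B] in
include h𝓗 in
theorem IsConnectedGrading.sub_counitSMul_mem (φ : ConvAlg 𝕜 H B) :
    φ - counitSMul 𝕜 H (φ.ofConv 1) ∈ filt B 𝓗 1 := by
  rw [h𝓗.mem_filt_one, WithConv.ofConv_sub, LinearMap.sub_apply, counitSMul_apply_one, sub_self]

omit [TopologicalSpace B] [T2Space B] [IsTopologicalRing B] [ContinuousSMul 𝕜 B] in
include h𝓗 in
theorem IsConnectedGrading.sub_counitSMul_sub_one_mem (χ : ConvAlg 𝕜 H B) :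
    χ - counitSMul 𝕜 H (χ.ofConv 1 - 1) - 1 ∈ filt B 𝓗 1 := by
  rw [h𝓗.mem_filt_one, WithConv.ofConv_sub, WithConv.ofConv_sub, LinearMap.sub_apply,
    LinearMap.sub_apply, counitSMul_apply_one]
  simp

include h𝓗 in
omit [IsTopologicalRing B] [ContinuousSMul 𝕜 B] in
theorem IsConnectedGrading.isPolyValued_extendedLog : IsPolyValued 𝕜 fun χ : ConvAlg 𝕜 H B =>
    convLog (χ - counitSMul 𝕜 H (χ.ofConv 1 - 1)) + counitSMul 𝕜 H (χ.ofConv 1 - 1) := by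
  have h : IsPolyValued 𝕜 fun χ : ConvAlg 𝕜 H B => counitSMul 𝕜 H (χ.ofConv 1 - 1) :=
    isPolyValued_counitSMul (sub_mem (isPolyValued_id (1 : H)) (const_mem_polyMaps 1))
  exact ((isPolyValued_id.sub h).convLog h𝓗 h𝓗.sub_counitSMul_sub_one_mem).add h

include h𝓗 in
omit [IsTopologicalRing B] [ContinuousSMul 𝕜 B] in
theorem IsConnectedGrading.isPolyValued_extendedExp : IsPolyValued 𝕜 fun φ : ConvAlg 𝕜 H B =>
    convExp (φ - counitSMul 𝕜 H (φ.ofConv 1)) + counitSMul 𝕜 H (φ.ofConv 1) := by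
  have h : IsPolyValued 𝕜 fun φ : ConvAlg 𝕜 H B => counitSMul 𝕜 H (φ.ofConv 1) :=
    isPolyValued_counitSMul (isPolyValued_id (1 : H))
  exact ((isPolyValued_id.sub h).convExp h𝓗 h𝓗.sub_counitSMul_mem).add h

/-- The logarithm, extended to a global chart of `Hom_𝕜 (H, B)`: it is the usual logarithm on the
affine subspace of the linear maps with value `1` at `1`, and commutes with the addition of
multiples `ε b` of the counit. -/
def IsConnectedGrading.extendedLog : ConvAlg 𝕜 H B ≃ₜ ConvAlg 𝕜 H B where
  toFun χ := convLog (χ - counitSMul 𝕜 H (χ.ofConv 1 - 1)) + counitSMul 𝕜 H (χ.ofConv 1 - 1)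
  invFun φ := convExp (φ - counitSMul 𝕜 H (φ.ofConv 1)) + counitSMul 𝕜 H (φ.ofConv 1)
  left_inv χ := by
    have h := h𝓗.sub_counitSMul_sub_one_mem χ
    have h1 : (convLog (χ - counitSMul 𝕜 H (χ.ofConv 1 - 1))).ofConv 1 = 0 :=
      h𝓗.mem_filt_one.1 (h𝓗.convLog_mem h)
    simp only [WithConv.ofConv_add, LinearMap.add_apply, h1, counitSMul_apply_one, zero_add,
      add_sub_cancel_right]
    rw [h𝓗.convExp_convLog h, sub_add_cancel]
  right_inv φ := by
    have h := h𝓗.sub_counitSMul_mem φ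
    have h1 := h𝓗.convExp_apply_one h
    simp only [WithConv.ofConv_add, LinearMap.add_apply, h1, counitSMul_apply_one,
      add_sub_cancel_left, add_sub_cancel_right]
    rw [h𝓗.convLog_convExp h, sub_add_cancel]
  continuous_toFun := h𝓗.isPolyValued_extendedLog.continuous
  continuous_invFun := h𝓗.isPolyValued_extendedExp.continuous

variable {F G : Type*} [AddCommGroup F] [Module 𝕜 F] [TopologicalSpace F] [Group G]
  [TopologicalSpace G]
  {ι : F →ₗ[𝕜] ConvAlg 𝕜 H B} {J : Submodule 𝕜 H} {τ : G → ConvAlg 𝕜 H B} {e : F ≃ G}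
  (he : IsExpModel ι J τ e)
include he

theorem IsExpModel.extendedLog_apply (g : G) : h𝓗.extendedLog (τ g) = ι (e.symm g) := by
  have h1 : (τ g).ofConv 1 = 1 := by
    simpa [sub_eq_zero] using h𝓗.mem_filt_one.1 (he.sub_one_mem h𝓗 g)
  change convLog (τ g - counitSMul 𝕜 H ((τ g).ofConv 1 - 1)) +
    counitSMul 𝕜 H ((τ g).ofConv 1 - 1) = _
  rw [h1, sub_self, counitSMul_zero, sub_zero, add_zero, he.coe_symm h𝓗]

/-- The extended logarithm flattens out `G` inside of `Hom_𝕜 (H, B)`. -/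
theorem IsExpModel.isClosedSubmanifold [ChartedSpace F G]
    (hΛ : IsGlobalChart (he.logHomeomorph h𝓗)) : IsClosedSubmanifold 𝕜 ι τ := by
  have hrange : Set.range τ = h𝓗.extendedLog ⁻¹' Set.range ι := by
    ext χ
    constructor
    · rintro ⟨g, rfl⟩
      exact ⟨e.symm g, (he.extendedLog_apply h𝓗 g).symm⟩
    · rintro ⟨x, hx⟩
      refine ⟨e x, h𝓗.extendedLog.injective ?_⟩
      rw [he.extendedLog_apply h𝓗, e.symm_apply_apply, hx]
  refine ⟨he.isClosedEmbedding, he.isEmbedding_group.injective, ?_, fun g =>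
    ⟨h𝓗.extendedLog.toOpenPartialHomeomorph, ?_, (he.logHomeomorph h𝓗).toOpenPartialHomeomorph,
      he.log_mem_analyticMaximalAtlas h𝓗 hΛ, trivial, rfl, ?_, fun x _ => ?_⟩⟩
  · rw [hrange]
    exact he.isClosedEmbedding.isClosed_range.preimage h𝓗.extendedLog.continuous
  · exact (isGlobalChart_refl _).mem_analyticMaximalAtlas
      (isAnnihilatorEmbedding_id.lcAnalyticOn_univ h𝓗.isPolyValued_extendedExp)
      (isAnnihilatorEmbedding_id.lcAnalyticOn_univ h𝓗.isPolyValued_extendedLog)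
  · rw [hrange]
    change h𝓗.extendedLog '' (Set.univ ∩ _) = Set.univ ∩ _
    rw [Set.univ_inter, Set.univ_inter, Set.image_preimage_eq _ h𝓗.extendedLog.surjective]
  · exact (he.extendedLog_apply h𝓗 x).symm

end Submanifold

/-! ### The Lie groups `Char (H, B)` and `Ann (I, B) ∩ Char (H, B)` -/

section Models

variable {𝕜 H B : Type*} [RCLike 𝕜] [Ring H] [HopfAlgebra 𝕜 H] [CommRing B] [Algebra 𝕜 B]
  [TopologicalSpace B]

theorem CharGroup.isEmbedding_toHom :
    Topology.IsEmbedding (CharGroup.toHom : CharGroup 𝕜 H B → ConvAlg 𝕜 H B) :=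
  ⟨⟨rfl⟩, CharGroup.toHom_injective⟩

omit [TopologicalSpace B] in
theorem IsConnectedGrading.toHom_sub_one_mem {𝓗 : ℕ → Submodule 𝕜 H} (h𝓗 : IsConnectedGrading 𝓗)
    (χ : CharGroup 𝕜 H B) : χ.toHom - 1 ∈ filt B 𝓗 1 := by
  rw [h𝓗.mem_filt_one]
  have h : χ.toHom.ofConv 1 = 1 := map_one χ.ofConv
  simp [h]

variable [T2Space B]

/-- The exponential function, as a bijection from infinitesimal characters onto characters. -/
def IsConnectedGrading.expEquiv [IsTopologicalRing B] [ContinuousSMul 𝕜 B] {𝓗 : ℕ → Submodule 𝕜 H}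
    (h𝓗 : IsConnectedGrading 𝓗) : InfChar 𝕜 H B ≃ CharGroup 𝕜 H B where
  toFun φ := WithConv.toConv <| AlgHom.ofLinearMap (convExp (φ : ConvAlg 𝕜 H B)).ofConv
    (h𝓗.convExp_apply_one (h𝓗.mem_filt_one_of_mem_infChar φ.2)) (h𝓗.convExp_apply_mul φ.2)
  invFun χ := ⟨convLog χ.toHom, h𝓗.mem_infChar_of_convExp (h𝓗.convLog_mem (h𝓗.toHom_sub_one_mem χ))
    χ (h𝓗.convExp_convLog (h𝓗.toHom_sub_one_mem χ))⟩
  left_inv φ := Subtype.ext (h𝓗.convLog_convExp (h𝓗.mem_filt_one_of_mem_infChar φ.2))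
  right_inv χ := CharGroup.toHom_injective (h𝓗.convExp_convLog (h𝓗.toHom_sub_one_mem χ))

variable (𝕜 H) in
/-- The subspace of `H` on which precisely the infinitesimal characters vanish. -/
def derivationRelations : Submodule 𝕜 H :=
  Submodule.span 𝕜 (Set.range fun p : H × H => p.1 * p.2 -
    (Coalgebra.counit (R := 𝕜) p.2 • p.1 + Coalgebra.counit (R := 𝕜) p.1 • p.2))

omit [TopologicalSpace B] [T2Space B] in
theorem mem_infChar_iff_forall_derivationRelations {φ : ConvAlg 𝕜 H B} :
    φ ∈ InfChar 𝕜 H B ↔ ∀ a ∈ derivationRelations 𝕜 H, φ.ofConv a = 0 := by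
  have h : (∀ a ∈ derivationRelations 𝕜 H, φ.ofConv a = 0) ↔
      derivationRelations 𝕜 H ≤ LinearMap.ker φ.ofConv := Iff.rfl
  rw [h, derivationRelations, Submodule.span_le, Set.range_subset_iff, Prod.forall, mem_infChar_iff]
  simp [sub_eq_zero]

variable [IsTopologicalRing B] [ContinuousSMul 𝕜 B] {𝓗 : ℕ → Submodule 𝕜 H}
  (h𝓗 : IsConnectedGrading 𝓗)

theorem IsConnectedGrading.isExpModel_charGroup :
    IsExpModel (F := InfChar 𝕜 H B) (InfChar 𝕜 H B).toSubmodule.subtype (derivationRelations 𝕜 H)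
      (CharGroup.toHom : CharGroup 𝕜 H B → ConvAlg 𝕜 H B) h𝓗.expEquiv where
  isEmbedding := Topology.IsEmbedding.subtypeVal
  mem_range_iff φ := by
    rw [Submodule.range_subtype]
    exact mem_infChar_iff_forall_derivationRelations
  apply_one φ := apply_one_of_mem_infChar φ.2
  isEmbedding_group := CharGroup.isEmbedding_toHom
  map_mul := CharGroup.toHom_mul
  map_exp _ := rfl

variable (I : Ideal H) [I.IsTwoSided] [I.IsHopfIdeal 𝕜]

include h𝓗 in
omit [IsTopologicalRing B] [ContinuousSMul 𝕜 B] in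
/-- The subalgebra `Ann (I, B)` contains the power series in its elements. -/
theorem IsConnectedGrading.seriesEval_mem_annihilator (f : PowerSeries 𝕜) {X : ConvAlg 𝕜 H B}
    (hX : X ∈ filt B 𝓗 1) (hXI : X ∈ annihilator (𝕜 := 𝕜) B I) :
    seriesEval f X ∈ annihilator (𝕜 := 𝕜) B I := fun a ha => by
  obtain ⟨N, hN⟩ := h𝓗.exists_apply_eq_zero (B := B) a
  rw [h𝓗.seriesEval_apply hX f hN]
  refine Finset.sum_eq_zero fun n _ => ?_
  rw [pow_mem hXI n a ha, smul_zero]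

theorem IsConnectedGrading.mem_annLie_iff (φ : InfChar 𝕜 H B) :
    φ ∈ annLie (𝕜 := 𝕜) B I ↔ h𝓗.expEquiv φ ∈ annGroup (𝕜 := 𝕜) B I := by
  constructor
  · exact fun h => h𝓗.seriesEval_mem_annihilator I _ (h𝓗.mem_filt_one_of_mem_infChar φ.2) h
  · intro h
    rw [← h𝓗.expEquiv.symm_apply_apply φ]
    exact h𝓗.seriesEval_mem_annihilator I _ (h𝓗.toHom_sub_one_mem _)
      (sub_mem h (OneMemClass.one_mem _))

/-- The restriction of the exponential function to the annihilator of `I`. -/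
def IsConnectedGrading.annExpEquiv : annLie (𝕜 := 𝕜) B I ≃ annGroup (𝕜 := 𝕜) B I :=
  h𝓗.expEquiv.subtypeEquiv (h𝓗.mem_annLie_iff I)

theorem IsConnectedGrading.isExpModel_annGroup :
    IsExpModel (F := annLie (𝕜 := 𝕜) B I)
      ((InfChar 𝕜 H B).toSubmodule.subtype ∘ₗ (annLie (𝕜 := 𝕜) B I).toSubmodule.subtype)
      (derivationRelations 𝕜 H ⊔ I.restrictScalars 𝕜)
      (fun χ : annGroup (𝕜 := 𝕜) B I => (χ : CharGroup 𝕜 H B).toHom) (h𝓗.annExpEquiv I) where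
  isEmbedding := Topology.IsEmbedding.subtypeVal.comp Topology.IsEmbedding.subtypeVal
  mem_range_iff φ := by
    constructor
    · rintro ⟨x, rfl⟩ a ha
      have h : derivationRelations 𝕜 H ⊔ I.restrictScalars 𝕜 ≤
          LinearMap.ker ((x : InfChar 𝕜 H B) : ConvAlg 𝕜 H B).ofConv :=
        sup_le (mem_infChar_iff_forall_derivationRelations.1 (x : InfChar 𝕜 H B).2) x.2
      exact h ha
    · intro h
      exact ⟨⟨⟨φ, mem_infChar_iff_forall_derivationRelations.2 fun a ha =>
        h a (Submodule.mem_sup_left ha)⟩, fun a ha => h a (Submodule.mem_sup_right ha)⟩, rfl⟩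
  apply_one x := apply_one_of_mem_infChar (x : InfChar 𝕜 H B).2
  isEmbedding_group := CharGroup.isEmbedding_toHom.comp Topology.IsEmbedding.subtypeVal
  map_mul _ _ := CharGroup.toHom_mul _ _
  map_exp _ := rfl

omit [IsTopologicalRing B] [ContinuousSMul 𝕜 B] in
theorem isClosed_annLie : IsClosed (annLie (𝕜 := 𝕜) B I : Set (InfChar 𝕜 H B)) := by
  have h : (annLie (𝕜 := 𝕜) B I : Set (InfChar 𝕜 H B)) = ⋂ a ∈ I,
      (fun φ : InfChar 𝕜 H B => ConvAlg.evalCLM 𝕜 B a (φ : ConvAlg 𝕜 H B)) ⁻¹' {0} := by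
    ext φ
    simp only [Set.mem_iInter]
    rfl
  rw [h]
  exact isClosed_biInter fun a _ => isClosed_singleton.preimage
    ((ConvAlg.evalCLM 𝕜 B a).continuous.comp continuous_subtype_val)

variable [PolynormableSpace 𝕜 B]

theorem IsConnectedGrading.isCharLieGroup [ChartedSpace (InfChar 𝕜 H B) (CharGroup 𝕜 H B)]
    (hΛ : IsGlobalChart ((h𝓗.isExpModel_charGroup (B := B)).logHomeomorph h𝓗)) :
    IsCharLieGroup 𝕜 H B h𝓗.expEquiv where
  isAnalyticLieGroup := h𝓗.isExpModel_charGroup.isAnalyticLieGroup h𝓗 hΛ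
  isClosedSubmanifold := h𝓗.isExpModel_charGroup.isClosedSubmanifold h𝓗 hΛ
  hasSum_exp φ := h𝓗.hasSum_convExp (h𝓗.mem_filt_one_of_mem_infChar φ.2)
  isAnalyticDiffeo_exp := h𝓗.isExpModel_charGroup.isAnalyticDiffeo h𝓗 hΛ

/-- The logarithm of `Char (H, B)` is a chart which maps the subgroup onto the closed subspace
`Ann (I, B) ∩ InfChar (H, B)`. -/
theorem IsConnectedGrading.isClosedLieSubgroup_annGroup
    [ChartedSpace (InfChar 𝕜 H B) (CharGroup 𝕜 H B)]
    (hΛ : IsGlobalChart ((h𝓗.isExpModel_charGroup (B := B)).logHomeomorph h𝓗))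
    [ChartedSpace (annLie (𝕜 := 𝕜) B I) (annGroup (𝕜 := 𝕜) B I)]
    (hΛ' : IsGlobalChart ((h𝓗.isExpModel_annGroup (B := B) I).logHomeomorph h𝓗)) :
    IsClosedLieSubgroup 𝕜 (annLie (𝕜 := 𝕜) B I).toSubmodule.subtype (annGroup (𝕜 := 𝕜) B I) := by
  let Λ := (h𝓗.isExpModel_charGroup (B := B)).logHomeomorph h𝓗
  have hmem : ∀ χ, χ ∈ annGroup (𝕜 := 𝕜) B I ↔ Λ χ ∈ annLie (𝕜 := 𝕜) B I := fun χ => by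
    rw [h𝓗.mem_annLie_iff]
    change _ ↔ h𝓗.expEquiv (h𝓗.expEquiv.symm χ) ∈ _
    rw [Equiv.apply_symm_apply]
  have hset : (annGroup (𝕜 := 𝕜) B I : Set (CharGroup 𝕜 H B)) =
      Λ ⁻¹' (annLie (𝕜 := 𝕜) B I : Set (InfChar 𝕜 H B)) := Set.ext hmem
  have hj : Set.range (annLie (𝕜 := 𝕜) B I).toSubmodule.subtype =
      (annLie (𝕜 := 𝕜) B I : Set (InfChar 𝕜 H B)) := Subtype.range_coe
  refine ⟨(h𝓗.isExpModel_annGroup I).isAnalyticLieGroup h𝓗 hΛ',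
    ⟨⟨Topology.IsEmbedding.subtypeVal, ?_⟩, Subtype.val_injective, ?_, fun m =>
      ⟨Λ.toOpenPartialHomeomorph, h𝓗.isExpModel_charGroup.log_mem_analyticMaximalAtlas h𝓗 hΛ,
        ((h𝓗.isExpModel_annGroup (B := B) I).logHomeomorph h𝓗).toOpenPartialHomeomorph,
        (h𝓗.isExpModel_annGroup I).log_mem_analyticMaximalAtlas h𝓗 hΛ', trivial, rfl, ?_,
        fun _ _ => rfl⟩⟩⟩
  · rw [hj]
    exact isClosed_annLie I
  · rw [Subtype.range_coe]
    exact hset ▸ (isClosed_annLie I).preimage Λ.continuous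
  · rw [hj]
    change Λ '' (Set.univ ∩ Set.range Subtype.val) = Set.univ ∩ _
    rw [Set.univ_inter, Set.univ_inter, Subtype.range_coe]
    exact (congrArg (Λ '' ·) hset).trans (Set.image_preimage_eq _ Λ.surjective)

end Models

/-! ### The grading of the quotient by a homogeneous ideal -/

section QuotientGrading

variable {𝕜 H : Type*} [Field 𝕜] [Ring H] [HopfAlgebra 𝕜 H] {𝓗 : ℕ → Submodule 𝕜 H}
  (h𝓗 : IsConnectedGrading 𝓗)
include h𝓗

variable {I : Ideal H} [I.IsTwoSided]

theorem IsConnectedGrading.isInternal_quotientGrading (hI : IsHomogeneousIdeal 𝓗 I) :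
    DirectSum.IsInternal (quotientGrading 𝓗 I) := by
  classical
  constructor
  · refine (injective_iff_map_eq_zero _).2 fun x hx => ?_
    -- Homogeneous representatives of the components of `x`. Almost all of them are zero,
    -- and their sum is in `I`, so that each of them is in `I`.
    have hex : ∀ n, ∃ c ∈ 𝓗 n, Ideal.Quotient.mk I c = x n ∧ (x n = 0 → c = 0) := fun n => by
      obtain ⟨c, hc, hcx⟩ := (x n).2
      by_cases h : x n = 0
      · exact ⟨0, zero_mem _, by simp [h], fun _ => rfl⟩
      · exact ⟨c, hc, hcx, fun h' => absurd h' h⟩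
    choose c hc hcx hc0 using hex
    have hsupp : ∀ n, c n ≠ 0 → n ∈ DFinsupp.support x := fun n hn =>
      DFinsupp.mem_support_iff.2 fun h => hn (hc0 n h)
    have hmem := hI (Finsupp.onFinset (DFinsupp.support x) c hsupp) hc ?_
    · ext n
      rw [← hcx]
      exact Ideal.Quotient.eq_zero_iff_mem.2 (hmem n)
    · rw [Finsupp.onFinset_sum _ fun _ => rfl, ← Ideal.Quotient.eq_zero_iff_mem, map_sum]
      simp only [hcx]
      rw [DirectSum.coeAddMonoidHom_eq_dfinsuppSum] at hx
      exact hx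
  · change Function.Surjective (DirectSum.coeLinearMap (quotientGrading 𝓗 I))
    rw [← LinearMap.range_eq_top, DirectSum.range_coeLinearMap]
    simp only [quotientGrading]
    rw [← Submodule.map_iSup, h𝓗.isInternal.submodule_iSup_eq_top, Submodule.map_top,
      LinearMap.range_eq_top]
    exact Ideal.Quotient.mk_surjective

variable [I.IsHopfIdeal 𝕜]

/-- The quotient of a graded connected Hopf algebra by a homogeneous Hopf ideal is graded and
connected. -/
theorem IsConnectedGrading.quotient (hI : IsHomogeneousIdeal 𝓗 I) :
    IsConnectedGrading (quotientGrading 𝓗 I) where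
  isInternal := h𝓗.isInternal_quotientGrading hI
  one_mem := ⟨1, h𝓗.one_mem, rfl⟩
  mul_mem := by
    rintro m n _ ⟨a, ha, rfl⟩ _ ⟨b, hb, rfl⟩
    exact ⟨a * b, h𝓗.mul_mem m n a ha b hb, rfl⟩
  comul_mem := by
    rintro n _ ⟨a, ha, rfl⟩
    let q := (Ideal.Quotient.mkₐ 𝕜 I).toLinearMap
    suffices h : (⨆ p ∈ Finset.HasAntidiagonal.antidiagonal n,
        LinearMap.range (TensorProduct.map (𝓗 p.1).subtype (𝓗 p.2).subtype)) ≤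
        (⨆ p ∈ Finset.HasAntidiagonal.antidiagonal n, LinearMap.range (TensorProduct.map
          (quotientGrading 𝓗 I p.1).subtype
          (quotientGrading 𝓗 I p.2).subtype)).comap (TensorProduct.map q q) from
      h (h𝓗.comul_mem n a ha)
    refine iSup₂_le fun p hp => ?_
    rintro _ ⟨t, rfl⟩
    refine Submodule.mem_iSup_of_mem p (Submodule.mem_iSup_of_mem hp ?_)
    induction t using TensorProduct.induction_on with
    | zero => simp
    | add t₁ t₂ h₁ h₂ =>
      rw [map_add, map_add]
      exact add_mem h₁ h₂
    | tmul b c => exact ⟨(⟨q b, b, b.2, rfl⟩ : quotientGrading 𝓗 I p.1) ⊗ₜ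
        (⟨q c, c, c.2, rfl⟩ : quotientGrading 𝓗 I p.2), rfl⟩
  counit_eq_zero := by
    rintro n hn _ ⟨a, ha, rfl⟩
    exact h𝓗.counit_eq_zero n hn a ha
  connected := by
    -- The ideal is proper, since the counit vanishes on it.
    have h1 : (1 : H ⧸ I) ≠ 0 := fun h => by
      have h' := Submodule.IsCoideal.counit_eq_zero (I := I.restrictScalars 𝕜)
        (Ideal.Quotient.eq_zero_iff_mem.1 ((map_one (Ideal.Quotient.mk I)).trans h))
      rw [Bialgebra.counit_one] at h'
      exact one_ne_zero h'
    rw [quotientGrading, h𝓗.eq_span_one, Submodule.map_span, Set.image_singleton]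
    exact finrank_span_singleton h1

end QuotientGrading

/-! ### Characters of the quotient Hopf algebra -/

section Pullback

variable {𝕜 H B : Type*} [RCLike 𝕜] [Ring H] [HopfAlgebra 𝕜 H] [CommRing B] [Algebra 𝕜 B]
  [TopologicalSpace B] (I : Ideal H) [I.IsTwoSided] [I.IsHopfIdeal 𝕜]

/-- Composition with the quotient map `H → H ⧸ I`. -/
def ConvAlg.pullback : ConvAlg 𝕜 (H ⧸ I) B →L[𝕜] ConvAlg 𝕜 H B where
  toFun φ := WithConv.toConv (φ.ofConv ∘ₗ (Ideal.Quotient.mkₐ 𝕜 I).toLinearMap)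
  map_add' _ _ := rfl
  map_smul' _ _ := rfl
  cont := ConvAlg.continuous_iff.2 fun a =>
    (ConvAlg.evalCLM 𝕜 B (Ideal.Quotient.mk I a)).continuous

omit [I.IsHopfIdeal 𝕜] in
theorem ConvAlg.pullback_apply (φ : ConvAlg 𝕜 (H ⧸ I) B) (a : H) :
    (ConvAlg.pullback I φ).ofConv a = φ.ofConv (Ideal.Quotient.mk I a) := rfl

/-- As the quotient map is a homomorphism of coalgebras, composition with it respects the
convolution product. -/
theorem ConvAlg.pullback_mul (φ ψ : ConvAlg 𝕜 (H ⧸ I) B) :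
    ConvAlg.pullback I (φ * ψ) = ConvAlg.pullback I φ * ConvAlg.pullback I ψ := by
  apply WithConv.ofConv_injective
  exact LinearMap.convMul_comp_coalgHom_distrib φ ψ (Bialgebra.Quotient.mkBialgHom I).toCoalgHom

theorem ConvAlg.pullback_one : ConvAlg.pullback I (1 : ConvAlg 𝕜 (H ⧸ I) B) = 1 := rfl

theorem ConvAlg.pullback_pow (φ : ConvAlg 𝕜 (H ⧸ I) B) (n : ℕ) :
    ConvAlg.pullback I (φ ^ n) = ConvAlg.pullback I φ ^ n := by
  induction n with
  | zero => simp only [pow_zero, ConvAlg.pullback_one]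
  | succ n ih => rw [pow_succ, ConvAlg.pullback_mul, ih, pow_succ]

theorem ConvAlg.pullback_mem_annihilator (φ : ConvAlg 𝕜 (H ⧸ I) B) :
    ConvAlg.pullback I φ ∈ annihilator (𝕜 := 𝕜) B I := fun a ha => by
  rw [ConvAlg.pullback_apply, Ideal.Quotient.eq_zero_iff_mem.2 ha, map_zero]

omit [I.IsHopfIdeal 𝕜] in
theorem ConvAlg.isEmbedding_pullback :
    Topology.IsEmbedding (ConvAlg.pullback (𝕜 := 𝕜) (B := B) I) := by
  constructor
  · let s := Function.surjInv (Ideal.Quotient.mk_surjective (I := I))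
    refine Topology.IsInducing.of_comp (g := fun (φ : ConvAlg 𝕜 H B) (x : H ⧸ I) => φ.ofConv (s x))
      (ConvAlg.pullback I).continuous
      (continuous_pi fun x => (ConvAlg.evalCLM 𝕜 B (s x)).continuous) ?_
    convert ConvAlg.isInducing_toPi (𝕜 := 𝕜) (H := H ⧸ I) (B := B) using 1
    ext φ x
    exact congrArg φ.ofConv (Function.surjInv_eq Ideal.Quotient.mk_surjective x)
  · intro φ ψ h
    refine ConvAlg.ext_apply fun x => ?_
    obtain ⟨a, rfl⟩ := Ideal.Quotient.mk_surjective x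
    exact congrArg (fun χ : ConvAlg 𝕜 H B => χ.ofConv a) h

theorem CharGroup.continuous_iff {H X : Type*} [Ring H] [HopfAlgebra 𝕜 H] [TopologicalSpace X]
    {f : X → CharGroup 𝕜 H B} : Continuous f ↔ ∀ a, Continuous fun x => (f x).ofConv a := by
  rw [CharGroup.isEmbedding_toHom.continuous_iff, ConvAlg.continuous_iff]
  rfl

theorem CharGroup.continuous_eval {H : Type*} [Ring H] [HopfAlgebra 𝕜 H] (a : H) :
    Continuous fun χ : CharGroup 𝕜 H B => χ.ofConv a :=
  CharGroup.continuous_iff.1 continuous_id a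

/-- The character of `H` induced by a character of `H ⧸ I`. -/
def CharGroup.pullback (φ : CharGroup 𝕜 (H ⧸ I) B) : CharGroup 𝕜 H B :=
  WithConv.toConv (φ.ofConv.comp (Ideal.Quotient.mkₐ 𝕜 I))

theorem CharGroup.toHom_pullback (φ : CharGroup 𝕜 (H ⧸ I) B) :
    (CharGroup.pullback I φ).toHom = ConvAlg.pullback I φ.toHom := rfl

theorem CharGroup.pullback_mul (φ ψ : CharGroup 𝕜 (H ⧸ I) B) :
    CharGroup.pullback I (φ * ψ) = CharGroup.pullback I φ * CharGroup.pullback I ψ := by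
  apply CharGroup.toHom_injective
  rw [CharGroup.toHom_pullback, CharGroup.toHom_mul, ConvAlg.pullback_mul, CharGroup.toHom_mul,
    CharGroup.toHom_pullback, CharGroup.toHom_pullback]

/-- Composition with the quotient map identifies the characters of `H ⧸ I` with the characters
of `H` which annihilate `I`. -/
def charGroupQuotientMulEquiv : CharGroup 𝕜 (H ⧸ I) B ≃* annGroup (𝕜 := 𝕜) B I where
  toFun φ := ⟨CharGroup.pullback I φ, ConvAlg.pullback_mem_annihilator I φ.toHom⟩
  invFun χ := WithConv.toConv (Ideal.Quotient.liftₐ I (χ : CharGroup 𝕜 H B).ofConv χ.2)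
  left_inv φ := by
    apply WithConv.ofConv_injective
    ext x
    obtain ⟨a, rfl⟩ := Ideal.Quotient.mk_surjective x
    rfl
  right_inv χ := rfl
  map_mul' φ ψ := Subtype.ext (CharGroup.pullback_mul I φ ψ)

theorem continuous_charGroupQuotientMulEquiv :
    Continuous (charGroupQuotientMulEquiv (𝕜 := 𝕜) (B := B) I) :=
  (CharGroup.continuous_iff.2 fun a =>
    CharGroup.continuous_eval (Ideal.Quotient.mk I a)).subtype_mk _

theorem continuous_charGroupQuotientMulEquiv_symm :
    Continuous (charGroupQuotientMulEquiv (𝕜 := 𝕜) (B := B) I).symm := by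
  refine CharGroup.continuous_iff.2 fun x => ?_
  obtain ⟨a, rfl⟩ := Ideal.Quotient.mk_surjective x
  exact (CharGroup.continuous_eval a).comp continuous_subtype_val

/-- The identification of the characters of `H ⧸ I` with the characters of `H` which annihilate `I`,
as an isomorphism of topological groups. -/
def charGroupQuotientEquiv : CharGroup 𝕜 (H ⧸ I) B ≃ₜ* annGroup (𝕜 := 𝕜) B I where
  toMulEquiv := charGroupQuotientMulEquiv I
  continuous_toFun := continuous_charGroupQuotientMulEquiv I
  continuous_invFun := continuous_charGroupQuotientMulEquiv_symm I

theorem ConvAlg.pullback_mem_infChar_iff {φ : ConvAlg 𝕜 (H ⧸ I) B} :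
    ConvAlg.pullback I φ ∈ InfChar 𝕜 H B ↔ φ ∈ InfChar 𝕜 (H ⧸ I) B := by
  constructor
  · intro h x y
    obtain ⟨a, rfl⟩ := Ideal.Quotient.mk_surjective x
    obtain ⟨b, rfl⟩ := Ideal.Quotient.mk_surjective y
    exact h a b
  · intro h a b
    exact h (Ideal.Quotient.mk I a) (Ideal.Quotient.mk I b)

/-- Composition with the quotient map, on infinitesimal characters. -/
def infCharQuotientEquiv : InfChar 𝕜 (H ⧸ I) B ≃L[𝕜] annLie (𝕜 := 𝕜) B I where
  toFun φ := ⟨⟨ConvAlg.pullback I (φ : ConvAlg 𝕜 (H ⧸ I) B),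
    (ConvAlg.pullback_mem_infChar_iff I).2 φ.2⟩, by
      exact ConvAlg.pullback_mem_annihilator I (φ : ConvAlg 𝕜 (H ⧸ I) B)⟩
  map_add' _ _ := rfl
  map_smul' _ _ := rfl
  invFun ψ := ⟨WithConv.toConv ((I.restrictScalars 𝕜).liftQ
    ((ψ : InfChar 𝕜 H B) : ConvAlg 𝕜 H B).ofConv ψ.2),
    (ConvAlg.pullback_mem_infChar_iff I).1 (ψ : InfChar 𝕜 H B).2⟩
  left_inv φ := by
    refine Subtype.ext (ConvAlg.ext_apply fun x => ?_)
    obtain ⟨a, rfl⟩ := Ideal.Quotient.mk_surjective x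
    rfl
  right_inv ψ := rfl
  continuous_toFun := continuous_induced_rng.2 <| continuous_induced_rng.2 <|
    (ConvAlg.pullback I).continuous.comp continuous_subtype_val
  continuous_invFun := by
    refine continuous_induced_rng.2 ((ConvAlg.isEmbedding_pullback I).continuous_iff.2 ?_)
    exact continuous_subtype_val.comp continuous_subtype_val

variable [T2Space B] [IsTopologicalRing B] [ContinuousSMul 𝕜 B]
  {𝓗 : ℕ → Submodule 𝕜 H} (h𝓗 : IsConnectedGrading 𝓗)
  [ChartedSpace (InfChar 𝕜 (H ⧸ I) B) (CharGroup 𝕜 (H ⧸ I) B)]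
  {expQ : InfChar 𝕜 (H ⧸ I) B ≃ CharGroup 𝕜 (H ⧸ I) B} (hQ : IsCharLieGroup 𝕜 (H ⧸ I) B expQ)
include hQ

/-- Composition with the quotient map takes the exponential series to the exponential series. -/
theorem IsCharLieGroup.charGroupQuotientEquiv_exp (φ : InfChar 𝕜 (H ⧸ I) B) :
    charGroupQuotientEquiv I (expQ φ) = h𝓗.annExpEquiv I (infCharQuotientEquiv I φ) := by
  refine Subtype.ext (CharGroup.toHom_injective ?_)
  have h₁ := (hQ.hasSum_exp φ).mapL (ConvAlg.pullback I)
  simp only [map_smul, ConvAlg.pullback_pow] at h₁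
  exact h₁.unique (h𝓗.hasSum_convExp
    (h𝓗.mem_filt_one_of_mem_infChar ((ConvAlg.pullback_mem_infChar_iff I).2 φ.2)))

/-- In exponential coordinates, the identification of the groups of characters is the continuous
linear isomorphism of the spaces of infinitesimal characters, for whichever Lie group structure with
this exponential function. -/
theorem IsCharLieGroup.isAnalyticDiffeo_charGroupQuotientEquiv
    [ChartedSpace (annLie (𝕜 := 𝕜) B I) (annGroup (𝕜 := 𝕜) B I)]
    (hΛ : IsGlobalChart ((h𝓗.isExpModel_annGroup (B := B) I).logHomeomorph h𝓗)) :
    IsAnalyticDiffeo 𝕜 (InfChar 𝕜 (H ⧸ I) B) (annLie (𝕜 := 𝕜) B I)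
      (charGroupQuotientEquiv (𝕜 := 𝕜) (B := B) I).toMulEquiv.toEquiv := by
  let j := infCharQuotientEquiv (𝕜 := 𝕜) (B := B) I
  have hlog : ∀ χ, (h𝓗.annExpEquiv I).symm (charGroupQuotientEquiv I χ) = j (expQ.symm χ) :=
    fun χ => by
      rw [Equiv.symm_apply_eq, ← hQ.charGroupQuotientEquiv_exp, Equiv.apply_symm_apply]
  have hexp : ∀ y, (charGroupQuotientEquiv I).symm (h𝓗.annExpEquiv I y) = expQ (j.symm y) :=
    fun y => by
      rw [ContinuousMulEquiv.symm_apply_eq, hQ.charGroupQuotientEquiv_exp _ h𝓗]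
      exact congrArg _ (j.apply_symm_apply y).symm
  constructor
  · intro e he e' he'
    rw [hΛ.atlas_eq, Set.mem_singleton_iff] at he'
    subst he'
    have h := (hQ.isAnalyticDiffeo_exp.2 e he _ rfl).clm_comp
      (j : InfChar 𝕜 (H ⧸ I) B →L[𝕜] annLie (𝕜 := 𝕜) B I)
    exact (congrArg₂ (LCAnalyticOn 𝕜) (funext fun x => hlog _) rfl).mpr h
  · intro e he e' he'
    rw [hΛ.atlas_eq, Set.mem_singleton_iff] at he
    subst he
    have h := (hQ.isAnalyticDiffeo_exp.1 _ rfl e' he').comp_clm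
      (j.symm : annLie (𝕜 := 𝕜) B I →L[𝕜] InfChar 𝕜 (H ⧸ I) B)
    refine (congrArg₂ (LCAnalyticOn 𝕜) (funext fun x => congrArg e' (hexp x))
      (Set.ext fun x => and_congr Iff.rfl ?_)).mpr h
    exact iff_of_eq (congrArg (· ∈ e'.source) (hexp x))

end Pullback

end CharLie

end

theorem theorem3p3 {𝕜 H B : Type*} [RCLike 𝕜] [Ring H] [HopfAlgebra 𝕜 H]
    [CommRing B] [Algebra 𝕜 B] [TopologicalSpace B] [T2Space B] [IsTopologicalRing B]
    [ContinuousSMul 𝕜 B] [PolynormableSpace 𝕜 B]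
    (𝓗 : ℕ → Submodule 𝕜 H) (h𝓗 : IsConnectedGrading 𝓗)
    (I : Ideal H) [I.IsTwoSided] [I.IsHopfIdeal 𝕜] :
    -- the isomorphism of topological groups `φ ↦ φ ∘ q` with `q` the quotient map
    ∃ qStar : CharGroup 𝕜 (H ⧸ I) B ≃ₜ* annGroup (𝕜 := 𝕜) B I,
      (∀ (φ : CharGroup 𝕜 (H ⧸ I) B) (a : H),
        (qStar φ : CharGroup 𝕜 H B).ofConv a = φ.ofConv (Ideal.Quotient.mk I a)) ∧
    -- the Lie group `Char (H, B)` and its exponential function, given by the exponential series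
    ∃ (_ : ChartedSpace (InfChar 𝕜 H B) (CharGroup 𝕜 H B))
      (expG : InfChar 𝕜 H B ≃ CharGroup 𝕜 H B),
      IsCharLieGroup 𝕜 H B expG ∧
      HasLieAlgebra 𝕜 (InfChar 𝕜 H B) (CharGroup 𝕜 H B) ∧
      IsLieExponential 𝕜 expG ∧
    -- the closed BCH Lie subalgebra `Ann (I, B) ∩ InfChar (H, B)`
      IsClosed (annLie (𝕜 := 𝕜) B I : Set (InfChar 𝕜 H B)) ∧
      IsBCHLieAlgebra 𝕜 (annLie (𝕜 := 𝕜) B I) ∧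
    -- the closed Lie subgroup `Ann (I, B) ∩ Char (H, B)`, a BCH Lie group with this Lie algebra
    ∃ (_ : ChartedSpace (annLie (𝕜 := 𝕜) B I) (annGroup (𝕜 := 𝕜) B I))
      (expK : annLie (𝕜 := 𝕜) B I ≃ annGroup (𝕜 := 𝕜) B I),
      IsClosedLieSubgroup 𝕜 (annLie (𝕜 := 𝕜) B I).toSubmodule.subtype
        (annGroup (𝕜 := 𝕜) B I) ∧
      IsBCHLieGroup 𝕜 (annLie (𝕜 := 𝕜) B I) (annGroup (𝕜 := 𝕜) B I) ∧
      HasLieAlgebra 𝕜 (annLie (𝕜 := 𝕜) B I) (annGroup (𝕜 := 𝕜) B I) ∧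
    -- `exp` restricts to a global analytic diffeomorphism, the exponential function of the subgroup
      (∀ φ : annLie (𝕜 := 𝕜) B I, (expK φ : CharGroup 𝕜 H B) = expG φ) ∧
      IsLieExponential 𝕜 expK ∧
      IsAnalyticDiffeo 𝕜 (annLie (𝕜 := 𝕜) B I) (annLie (𝕜 := 𝕜) B I) expK ∧
    -- agreement with the Lie group `Char (H ⧸ I, B)` of the graded connected quotient
      (IsHomogeneousIdeal 𝓗 I →
        IsConnectedGrading (quotientGrading 𝓗 I) ∧
        (∃ (_ : ChartedSpace (InfChar 𝕜 (H ⧸ I) B) (CharGroup 𝕜 (H ⧸ I) B))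
          (expQ : InfChar 𝕜 (H ⧸ I) B ≃ CharGroup 𝕜 (H ⧸ I) B),
          IsCharLieGroup 𝕜 (H ⧸ I) B expQ) ∧
        ∀ (_ : ChartedSpace (InfChar 𝕜 (H ⧸ I) B) (CharGroup 𝕜 (H ⧸ I) B))
          (expQ : InfChar 𝕜 (H ⧸ I) B ≃ CharGroup 𝕜 (H ⧸ I) B),
          IsCharLieGroup 𝕜 (H ⧸ I) B expQ →
          IsAnalyticDiffeo 𝕜 (InfChar 𝕜 (H ⧸ I) B) (annLie (𝕜 := 𝕜) B I)
            qStar.toMulEquiv.toEquiv) := by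
  have he := h𝓗.isExpModel_charGroup (B := B)
  have heI := h𝓗.isExpModel_annGroup (B := B) I
  let _ := globalChart (he.logHomeomorph h𝓗)
  have hΛ := isGlobalChart_globalChart (he.logHomeomorph h𝓗)
  let _ := globalChart (heI.logHomeomorph h𝓗)
  have hΛI := isGlobalChart_globalChart (heI.logHomeomorph h𝓗)
  refine ⟨charGroupQuotientEquiv I, fun _ _ => rfl, inferInstance, h𝓗.expEquiv,
    h𝓗.isCharLieGroup hΛ, he.hasLieAlgebra h𝓗 (fun _ _ => Ring.lie_def _ _) hΛ,
    he.isLieExponential h𝓗 hΛ, isClosed_annLie I,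
    heI.isBCHLieAlgebra heI.apply_one h𝓗 (fun _ _ => Ring.lie_def _ _), inferInstance,
    h𝓗.annExpEquiv I, h𝓗.isClosedLieSubgroup_annGroup I hΛ hΛI, heI.isBCHLieGroup h𝓗 hΛI,
    heI.hasLieAlgebra h𝓗 (fun _ _ => Ring.lie_def _ _) hΛI, fun _ => rfl,
    heI.isLieExponential h𝓗 hΛI, heI.isAnalyticDiffeo h𝓗 hΛI, fun hI => ?_⟩
  have hQ := h𝓗.quotient hI
  have heQ := hQ.isExpModel_charGroup (B := B)
  refine ⟨hQ, ⟨globalChart (heQ.logHomeomorph hQ), hQ.expEquiv, ?_⟩, fun _ _ hexp =>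
    hexp.isAnalyticDiffeo_charGroupQuotientEquiv I h𝓗 hΛI⟩
  let _ := globalChart (heQ.logHomeomorph hQ)
  exact hQ.isCharLieGroup (isGlobalChart_globalChart _)
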